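/- An infinite-time Turing machine (ITTM) has three one-way infinite tapes (input, scratch, output) with cells holding $0$ or $1$, one head scanning the same position on all three tapes, and finitely many states, among them a start, a Limit and a Halt state. It works like an ordinary Turing machine at successor steps (a move to the left from the leftmost cell leaves the head in place). At a limit step every cell takes the limsup of its earlier values, the head returns to the leftmost cell, and the machine enters the Limit state. Computations are indexed by ordinals, and the result is the content of the output tape when the Halt state is first entered. Let $IT\text{-}\mathcal C$ be the set of partial functions $2^{\mathbb N}\to 2^{\mathbb N}$ computed by ITTMs. Let $\widehat n\in 2^{\mathbb N}$ consist of $n$ ones followed by zeros, and for $f\in IT\text{-}\mathcal C$ let $f^*(n)=k$ if $f(\widehat n)=\widehat k$, with $f^*(n)$ undefined if there is no such $k$. For $n\ge 1$ let \[\Sigma_\infty(n)=\max\{f^*(0) : f\in IT\text{-}\mathcal C,\ f^*(0)\text{ is defined, and } f \text{ is computed by an ITTM with at most } n \text{ non-halting, non-limit states}\},\] and let $\Sigma_\infty(0)=0$. A set $A\subseteq\mathbb N$ is ITTM-semi-decidable if there is $g\in IT\text{-}\mathcal C$ with $g(\widehat n)=\widehat 1$ for $n\in A$ and $g(\widehat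 n)$ undefined for $n\notin A$; let $sD$ be the collection of these sets. For a collection $\Gamma$ of subsets of $\mathbb N$ (a subset of $\mathbb N\times\mathbb N$ being counted in $\Gamma$ if the set of its codes under a standard recursive pairing function belongs to $\Gamma$), a function $f:\mathbb N\to\mathbb N$ is called $\Gamma$-recursive if its neighbourhood diagram $\{(n,s) : f(n)\in N_s\}$ is in $\Gamma$. Here $(N_s)_{s\in\mathbb N}$ is the standard enumeration of the basic neighbourhoods of the discrete space $\mathbb N$: if $s$ codes the triple $(i,a,b)$, then $N_s$ is the open ball with centre $i$ and radius $a/(b+1)$ in the metric in which distinct points have distance $1$. Then for every $sD$-recursive $f:\mathbb N\to\mathbb N$ we have $\Sigma_\infty(n)>f(n)$ for all sufficiently large $n$. Moreover, every (lightface) $\Pi^1_1$ set of natural numbers is in $sD$, and for every $\Pi^1_1$-recursive $f:\mathbb N\to\mathbb N$ we have $\Sigma_\infty(n)>f(n)$ for all sufficiently large $n$. -/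

import Mathlib

namespace ITBB

/-! Infinite-time Turing machines with three one-way infinite tapes
(`0` = input, `1` = scratch, `2` = output), one head that scans the same position on all
three tapes, and the alphabet `{0, 1}` (`false`, `true`). -/

/-- The non-halting states of a machine with `n` non-halting, non-limit states:
`some q` for such a state `q`, and `none` for the Limit state. -/
abbrev ActiveState (n : ℕ) : Type := Option (Fin n)

/-- All states: `none` is the Halt state. -/
abbrev State (n : ℕ) : Type := Option (ActiveState n)

/-- An infinite-time Turing machine with exactly `n` non-halting, non-limit states.
`trans q s` is the action in state `q` when the scanned column is `s`: the new state, the column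
to be written, and the direction of the move (`true` = right, `false` = left). -/
structure ITTM (n : ℕ) where
  start : Fin n
  trans : ActiveState n → (Fin 3 → Bool) → State n × (Fin 3 → Bool) × Bool

/-- A snapshot of a computation. -/
structure Cfg (n : ℕ) where
  state : State n
  head : ℕ
  tape : Fin 3 → ℕ → Bool

namespace ITTM

variable {n : ℕ}

/-- The initial snapshot: `x` on the input tape, the other tapes blank, the head at the left. -/
def init (M : ITTM n) (x : ℕ → Bool) : Cfg n where
  state := some (some M.start)
  head := 0
  tape := fun i => if i = 0 then x else fun _ => false

/-- One successor step. A move to the left from the leftmost cell leaves the head there. -/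
def step (M : ITTM n) (c : Cfg n) : Cfg n :=
  match c.state with
  | none => c
  | some q =>
    let r := M.trans q (fun i => c.tape i c.head)
    { state := r.1
      head := if r.2.2 then c.head + 1 else c.head - 1
      tape := fun i => Function.update (c.tape i) c.head (r.2.1 i) }

open Classical in
/-- The snapshot at a limit stage `o`, from the snapshots at the earlier stages: Limit state, head
at the left, and every cell holds the limsup of its earlier values (so it holds a one
exactly when it held a one at cofinally many earlier stages). -/
noncomputable def limitCfg (o : Ordinal.{0}) (c : (b : Ordinal.{0}) → b < o → Cfg n) : Cfg n where
  state := some none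
  head := 0
  tape := fun i k => decide (∀ b < o, ∃ d, ∃ h : d < o, b ≤ d ∧ (c d h).tape i k = true)

/-- The snapshot at stage `a` of the computation of `M` on input `x`. Only the stages up to the
first one in the Halt state belong to the computation, see `HaltsAt`. -/
noncomputable def run (M : ITTM n) (x : ℕ → Bool) (a : Ordinal.{0}) : Cfg n :=
  Ordinal.limitRecOn a (M.init x) (fun _ c => M.step c) (fun o _ c => limitCfg o c)

/-- `M` on input `x` halts at stage `a`. -/
def HaltsAt (M : ITTM n) (x : ℕ → Bool) (a : Ordinal.{0}) : Prop :=
  (M.run x a).state = none ∧ ∀ b < a, (M.run x b).state ≠ none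

/-- `M` on input `x` halts with `y` on the output tape. -/
def Outputs (M : ITTM n) (x y : ℕ → Bool) : Prop :=
  ∃ a, M.HaltsAt x a ∧ (M.run x a).tape 2 = y

/-- `M` computes the partial function `f` on Cantor space. -/
def Computes (M : ITTM n) (f : (ℕ → Bool) →. (ℕ → Bool)) : Prop :=
  ∀ x y, y ∈ f x ↔ M.Outputs x y

end ITTM

/-- The set of all infinite-time computable (partial) functions on Cantor space. -/
def ITC : Set ((ℕ → Bool) →. (ℕ → Bool)) :=
  {f | ∃ (n : ℕ) (M : ITTM n), M.Computes f}

/-- The unary code of `n`: ones in the first `n` cells, zeros elsewhere. -/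
def code (n : ℕ) : ℕ → Bool := fun i => decide (i < n)

theorem code_injective : Function.Injective code := by
  intro m n h
  have h1 := congrFun h m
  have h2 := congrFun h n
  simp [code] at h1 h2
  omega

/-- The partial function on `ℕ` given by a partial function on Cantor space: its value
at `n` is the number `k` with `f (code n) = code k`, if there is one. -/
noncomputable def star (f : (ℕ → Bool) →. (ℕ → Bool)) : ℕ →. ℕ := fun n =>
  ⟨∃ k, code k ∈ f (code n), fun h => h.choose⟩

theorem mem_star {f : (ℕ → Bool) →. (ℕ → Bool)} {n k : ℕ} :
    k ∈ star f n ↔ code k ∈ f (code n) := by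
  constructor
  · rintro ⟨h, rfl⟩
    exact h.choose_spec
  · intro h
    have hd : ∃ k, code k ∈ f (code n) := ⟨k, h⟩
    exact ⟨hd, code_injective (Part.mem_unique hd.choose_spec h)⟩

/-- The functions computable with at most `n` non-halting, non-limit states whose value at
the blank tape is the code of a number. -/
def BBInf (n : ℕ) : Set ((ℕ → Bool) →. (ℕ → Bool)) :=
  {f | f ∈ ITC ∧ (star f 0).Dom ∧ ∃ m ≤ n, ∃ M : ITTM m, M.Computes f}

/-- The values of which the infinite-time busy beaver function takes the maximum. -/
def scores (n : ℕ) : Set ℕ := {k | ∃ f ∈ BBInf n, k ∈ star f 0}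

/-- The infinite-time busy beaver function. The supremum is a maximum for `1 ≤ n`, see
`isGreatest_sigmaInf`; there is no machine without a start state, and the value at `0` is `0`. -/
noncomputable def sigmaInf (n : ℕ) : ℕ := sSup (scores n)

section WellDefined

variable {n : ℕ}

theorem ITTM.run_zero (M : ITTM n) (x : ℕ → Bool) : M.run x 0 = M.init x :=
  Ordinal.limitRecOn_zero ..

theorem ITTM.run_add_one (M : ITTM n) (x : ℕ → Bool) (a : Ordinal.{0}) :
    M.run x (a + 1) = M.step (M.run x a) :=
  Ordinal.limitRecOn_add_one ..

theorem ITTM.run_limit (M : ITTM n) (x : ℕ → Bool) {o : Ordinal.{0}} (ho : Order.IsSuccLimit o) :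
    M.run x o = ITTM.limitCfg o (fun b _ => M.run x b) :=
  Ordinal.limitRecOn_limit _ _ _ _ ho

theorem ITTM.haltsAt_unique {M : ITTM n} {x : ℕ → Bool} {a b : Ordinal.{0}}
    (ha : M.HaltsAt x a) (hb : M.HaltsAt x b) : a = b := by
  rcases lt_trichotomy a b with h | h | h
  · exact absurd ha.1 (hb.2 a h)
  · exact h
  · exact absurd hb.1 (ha.2 b h)

theorem ITTM.outputs_unique {M : ITTM n} {x y z : ℕ → Bool}
    (hy : M.Outputs x y) (hz : M.Outputs x z) : y = z := by
  obtain ⟨a, ha, rfl⟩ := hy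
  obtain ⟨b, hb, rfl⟩ := hz
  rw [ITTM.haltsAt_unique ha hb]

/-- Every machine computes a function. -/
theorem ITTM.exists_computes (M : ITTM n) : ∃ f, M.Computes f := by
  refine ⟨fun x => ⟨∃ y, M.Outputs x y, fun h => h.choose⟩, fun x y => ⟨?_, fun h => ?_⟩⟩
  · rintro ⟨h, rfl⟩
    exact h.choose_spec
  · have hd : ∃ y, M.Outputs x y := ⟨y, h⟩
    exact ⟨hd, ITTM.outputs_unique hd.choose_spec h⟩

instance instFiniteITTM : Finite (ITTM n) :=
  Finite.of_injective
    (fun M : ITTM n => (M.start, M.trans)) (by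
      rintro ⟨s, t⟩ ⟨s', t'⟩ h
      simp only [Prod.mk.injEq] at h
      obtain ⟨rfl, rfl⟩ := h
      rfl)

theorem scores_finite (n : ℕ) : (scores n).Finite := by
  have h : scores n ⊆ ⋃ p : (m : Fin (n + 1)) × ITTM m.1,
      {k | p.2.Outputs (code 0) (code k)} := by
    rintro k ⟨f, ⟨-, -, m, hm, M, hM⟩, hk⟩
    exact Set.mem_iUnion.2 ⟨⟨⟨m, by omega⟩, M⟩, (hM _ _).1 (mem_star.1 hk)⟩
  refine (Set.finite_iUnion fun p => Set.Subsingleton.finite ?_).subset h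
  exact fun j hj k hk => code_injective (ITTM.outputs_unique hj hk)

theorem scores_nonempty (hn : 1 ≤ n) : (scores n).Nonempty := by
  let M : ITTM 1 := ⟨0, fun _ s => (none, s, true)⟩
  obtain ⟨f, hf⟩ := M.exists_computes
  have h1 : M.run (code 0) 1 = M.step (M.init (code 0)) := by
    have h := M.run_add_one (code 0) 0
    rwa [zero_add, M.run_zero] at h
  have hk : (0 : ℕ) ∈ star f 0 := by
    refine mem_star.2 ((hf _ _).2 ⟨1, ⟨?_, ?_⟩, ?_⟩)
    · rw [h1]
      rfl
    · intro b hb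
      rw [Order.lt_one_iff.1 hb, M.run_zero]
      simp [ITTM.init]
    · rw [h1]
      funext k
      simp [ITTM.step, ITTM.init, code, M]
  exact ⟨0, f, ⟨⟨1, M, hf⟩, Part.dom_iff_mem.2 ⟨0, hk⟩, 1, hn, M, hf⟩, hk⟩

/-- The maximum in the definition of the infinite-time busy beaver function exists. -/
theorem isGreatest_sigmaInf (hn : 1 ≤ n) : IsGreatest (scores n) (sigmaInf n) :=
  ⟨Nat.sSup_mem (scores_nonempty hn) (scores_finite n).bddAbove,
    fun _ hk => le_csSup (scores_finite n).bddAbove hk⟩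

end WellDefined

/-- The ITTM-semi-decidable sets of natural numbers: the partial function with domain `A` and
constant value `1` is infinite-time computable (on unary codes). -/
def sD : Set (Set ℕ) :=
  {A | ∃ f ∈ ITC, ∀ n, f (code n) = ⟨n ∈ A, fun _ => code 1⟩}

/-- The semirecursive (lightface `Σ⁰₁`) subsets of `ℕ × ℕ^ℕ`: unions of recursively
enumerable families of basic open sets `{n} × {α | α extends σ}`. -/
def Semirecursive (P : Set (ℕ × (ℕ → ℕ))) : Prop :=
  ∃ W : Set (ℕ × List ℕ), REPred (fun p => p ∈ W) ∧
    ∀ n α, (n, α) ∈ P ↔ ∃ m, (n, (List.range m).map α) ∈ W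

/-- The lightface `Π¹₁` sets of natural numbers. -/
def Pi11 : Set (Set ℕ) :=
  {A | ∃ P, Semirecursive P ∧ ∀ n, n ∈ A ↔ ∀ α : ℕ → ℕ, (n, α) ∈ P}

/-- The standard enumeration of the basic neighbourhoods of the discrete space `ℕ`: if `s` codes
`(i, a, b)`, this is the open ball with centre `i` and radius `a / (b + 1)` in the metric with
`d(k, i) = 1` for `k ≠ i`. -/
def nbhd (s : ℕ) : Set ℕ :=
  {k | (if k = s.unpair.1 then (0 : ℚ) else 1) <
    (s.unpair.2.unpair.1 : ℚ) / ((s.unpair.2.unpair.2 : ℚ) + 1)}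

/-- `f : ℕ → ℕ` is `Γ`-recursive: its neighbourhood diagram `{(n, s) | f n ∈ nbhd s}` belongs
to `Γ`, where a subset of `ℕ × ℕ` belongs to `Γ` if the set of the codes of its pairs does. -/
def RecursiveFor (Γ : Set (Set ℕ)) (f : ℕ → ℕ) : Prop :=
  {c | ∃ n s, c = Nat.pair n s ∧ f n ∈ nbhd s} ∈ Γ

/-- `g` eventually dominates `f`. -/
def EventuallyDominates (g f : ℕ → ℕ) : Prop := ∃ N, ∀ n ≥ N, f n < g n

end ITBB

open Ordinal Order

namespace ITBB

/-! Let `f` be `sD`-recursive and let `d n` be `2 * n` or `2 * n + 1`. A single machine, given `n`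
on its input tape, can find `f (d n)`: it runs the semi-decisions of "`f (d n)` lies in the ball
`{j}`" for all `j` in parallel until one of them halts, and then outputs a number larger than `j`. A
prologue of `m + 2` states that writes the argument `m + 1` turns this into a machine that starts on
blank tapes, has at most `m + N` states for a constant `N`, and outputs more than `f (d (m + 1))`.
For large `m` we have `m + N ≤ 2 * (m + 1)`, so `sigmaInf` beats `f` at all large even and odd
arguments; monotonicity of `f` plays no role.

The machines are built through an intermediate model, `RAM`: a process with random access to a bit
memory and primitive recursive transition data, whose control state is reset at limits.
`RAM.IsPrimrec.exists_machine` compiles such a process into a machine. The control state and the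
auxiliary numbers are registers on the scratch tape, a number being the position of the first mark
in its slot. Whatever marks a limit leaves behind, a mark in block `0` resets a register.
`Emulate.proc` is a process that emulates an arbitrary machine, and `RAM.dovetail` runs infinitely
many computations of a process in parallel.

All these simulations rest on `exists_follows`. One step is matched by finitely many steps, during
which every relevant bit has its old or its new value. So no spurious ones arise, the limsups of
both sides agree at every multiple of `ω`, and the simulation can be set up again there from these
bits alone.

A `Π¹₁` set consists of those `n` for which a certain recursive tree is well-founded. `Tree.proc`
detects this. Each node records its dead children in order and flashes a bit with each record; a
limit turns infinitely many flashes into a permanent one, which says that all children are dead,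
while finitely many flashes leave no trace. Deadness thus climbs up the tree, and it reaches the
root if and only if the tree is well-founded (`Tree.stops_iff`). Hence `pi11_subset_sD`, which
reduces the last claim to the first. -/

/-! ### Limsups, and stages in blocks of length `ω` -/

/-- The limit superior at `o` of a transfinite sequence of bits is one. -/
def LimSup (o : Ordinal.{0}) (u : Ordinal.{0} → Bool) : Prop :=
  ∀ b < o, ∃ d < o, b ≤ d ∧ u d = true

theorem limSup_of_eventually {o : Ordinal.{0}} {u : Ordinal.{0} → Bool} {c : Ordinal.{0}}
    (hc : c < o) {v : Bool} (h : ∀ d, c ≤ d → d < o → u d = v) : LimSup o u ↔ v = true := by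
  constructor
  · intro H
    obtain ⟨d, hd, hcd, hu⟩ := H c hc
    rw [← h d hcd hd, hu]
  · intro hv b hb
    exact ⟨max b c, max_lt hb hc, le_max_left _ _, by
      rw [h _ (le_max_right _ _) (max_lt hb hc), hv]⟩

/-- An initial segment does not influence a limsup. This allows a simulation to begin after a
prologue of length `a`. -/
theorem limSup_add {a o : Ordinal.{0}} (ho : 0 < o) (u : Ordinal.{0} → Bool) :
    LimSup (a + o) u ↔ LimSup o (fun d => u (a + d)) := by
  constructor
  · intro H b hb
    obtain ⟨d, hd, hbd, hu⟩ := H (a + b) (by simpa using hb)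
    have hd' : a + (d - a) = d := Ordinal.add_sub_cancel_of_le (le_trans (by simp) hbd)
    refine ⟨d - a, ?_, ?_, ?_⟩
    · rw [← hd'] at hd
      simpa using hd
    · rw [← hd'] at hbd
      simpa using hbd
    · simpa [hd'] using hu
  · intro H b hb
    rcases le_total a b with h | h
    · have hb' : a + (b - a) = b := Ordinal.add_sub_cancel_of_le h
      obtain ⟨d, hd, hbd, hu⟩ := H (b - a) (by rw [← hb'] at hb; simpa using hb)
      exact ⟨a + d, by simpa using hd, by rw [← hb']; simpa using hbd, hu⟩
    · obtain ⟨d, hd, hbd, hu⟩ := H 0 ho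
      exact ⟨a + d, by simpa using hd, h.trans (by simp), hu⟩

theorem exists_eq_omega0_mul_add (a : Ordinal.{0}) : ∃ (l : Ordinal.{0}) (t : ℕ), a = ω * l + t := by
  obtain ⟨t, ht⟩ := lt_omega0.1 (Ordinal.mod_lt a omega0_ne_zero)
  exact ⟨a / ω, t, by rw [← ht, Ordinal.div_add_mod]⟩

theorem omega0_mul_add_nat_lt {l o : Ordinal.{0}} (h : l < o) (t : ℕ) : ω * l + t < ω * o :=
  calc ω * l + t < ω * l + ω := by simp
    _ = ω * (l + 1) := by rw [mul_add_one]
    _ ≤ ω * o := by gcongr; exact Order.add_one_le_of_lt h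

theorem lt_of_omega0_mul_add_lt {l o : Ordinal.{0}} {t : Ordinal.{0}} (h : ω * l + t < ω * o) : l < o := by
  by_contra! hl
  exact absurd (lt_of_lt_of_le h (by gcongr)) (not_lt.2 (le_self_add : ω * l ≤ ω * l + t))

theorem omega0_mul_zero_or_limit (l : Ordinal.{0}) : ω * l = 0 ∨ IsSuccLimit (ω * l) := by
  rcases eq_or_ne l 0 with rfl | h
  · simp
  · exact Or.inr (isSuccLimit_mul_left isSuccLimit_omega0 (pos_of_ne_zero h))

theorem iterate_stage {S : Type} {F : Ordinal.{0} → S} {stepF : S → S}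
    (hF : ∀ a, F (a + 1) = stepF (F a)) (a : Ordinal.{0}) (j : ℕ) :
    F (a + j) = stepF^[j] (F a) := by
  induction j with
  | zero => simp
  | succ j ih =>
    rw [Function.iterate_succ_apply', ← ih, ← hF]
    push_cast
    rw [add_assoc]

/-! ### Simulation of one transfinite process by another -/

section Simulation

variable {SC SF P : Type} (C : Ordinal.{0} → SC) (F : Ordinal.{0} → SF)
  (R : SC → SF → Prop) (stepF : SF → SF) (ok : SF → Prop) (live : SC → Prop)
  (oc : SC → P → Bool) (of : SF → P → Bool)

/-- In the `l`-th block of `ω` stages, the process `F` follows the process `C`, with stage `s t` of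
the block of `F` corresponding to stage `t` of the block of `C`. -/
def Follows (l : Ordinal.{0}) (s : ℕ → ℕ) : Prop :=
  StrictMono s ∧
  (∀ j ≤ s 0, ok (F (ω * l + j)) ∧ ∀ p, of (F (ω * l + j)) p = oc (C (ω * l)) p) ∧
  (∀ t : ℕ, (∀ b < ω * l + t, live (C b)) → R (C (ω * l + t)) (F (ω * l + s t))) ∧
  ∀ t : ℕ, (∀ b < ω * l + (t + 1 : ℕ), live (C b)) → ∀ j, s t ≤ j → j ≤ s (t + 1) →
    ok (F (ω * l + j)) ∧ ∀ p, of (F (ω * l + j)) p = oc (C (ω * l + t)) p ∨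
      of (F (ω * l + j)) p = oc (C (ω * l + (t + 1 : ℕ))) p

variable {C F R stepF ok live oc of}

/-- Within a block every stage is reached by finitely many steps, so the matched steps can be glued
by ordinary induction. Agreement of the observed bits at `ω * l` is all that `hent` needs to
establish `R` for the first time. -/
theorem exists_follows_of_obs
    (hF : ∀ a, F (a + 1) = stepF (F a))
    (hent : ∀ o, o = 0 ∨ IsSuccLimit o → (∀ p, of (F o) p = oc (C o) p) →
      ∃ N, R (C o) (stepF^[N] (F o)) ∧ ∀ j ≤ N, ok (stepF^[j] (F o)) ∧
        ∀ p, of (stepF^[j] (F o)) p = oc (C o) p)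
    (hstep : ∀ a f, live (C a) → R (C a) f → ∃ N, 0 < N ∧ R (C (a + 1)) (stepF^[N] f) ∧
      ∀ j ≤ N, ok (stepF^[j] f) ∧
        ∀ p, of (stepF^[j] f) p = oc (C a) p ∨ of (stepF^[j] f) p = oc (C (a + 1)) p)
    (l : Ordinal.{0}) (h : ∀ p, of (F (ω * l)) p = oc (C (ω * l)) p) :
    ∃ s, Follows C F R ok live oc of l s := by
  classical
  obtain ⟨N0, hN0, hN0'⟩ := hent _ (omega0_mul_zero_or_limit l) h
  -- The claim is made for all `t` and `m`, with liveness and `R` as premises, so that `N` becomes a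
  -- total function and `s` can be defined by recursion before `R` is known along it.
  have key : ∀ t m : ℕ, ∃ N, 0 < N ∧
      (live (C (ω * l + t)) → R (C (ω * l + t)) (F (ω * l + m)) →
        R (C (ω * l + (t + 1 : ℕ))) (F (ω * l + (m + N : ℕ))) ∧ ∀ j, m ≤ j → j ≤ m + N →
        ok (F (ω * l + j)) ∧ ∀ p, of (F (ω * l + j)) p = oc (C (ω * l + t)) p ∨
          of (F (ω * l + j)) p = oc (C (ω * l + (t + 1 : ℕ))) p) := by
    intro t m
    by_cases hl : live (C (ω * l + t)) ∧ R (C (ω * l + t)) (F (ω * l + m))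
    · obtain ⟨N, hN, hR, hj⟩ := hstep _ _ hl.1 hl.2
      have e : ∀ j : ℕ, stepF^[j] (F (ω * l + m)) = F (ω * l + (m + j : ℕ)) := fun j => by
        rw [← iterate_stage hF]
        push_cast
        rw [add_assoc]
      have e2 : ω * l + ((t + 1 : ℕ) : Ordinal.{0}) = ω * l + t + 1 := by
        push_cast
        rw [add_assoc]
      refine ⟨N, hN, fun _ _ => ⟨?_, ?_⟩⟩
      · rw [e2, ← e]
        exact hR
      · intro j hmj hjN
        obtain ⟨i, rfl⟩ := Nat.exists_eq_add_of_le hmj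
        rw [e2, ← e]
        exact hj i (by omega)
    · exact ⟨1, one_pos, fun h1 h2 => absurd ⟨h1, h2⟩ hl⟩
  choose N hN hNR using key
  obtain ⟨s, hs0, hs⟩ : ∃ s : ℕ → ℕ, s 0 = N0 ∧ ∀ t, s (t + 1) = s t + N t (s t) :=
    ⟨fun t => Nat.rec N0 (fun t m => m + N t m) t, rfl, fun _ => rfl⟩
  have hR : ∀ t : ℕ, (∀ b < ω * l + t, live (C b)) →
      R (C (ω * l + t)) (F (ω * l + s t)) := by
    intro t
    induction t with
    | zero =>
      intro _
      have : F (ω * l + (s 0 : ℕ)) = stepF^[N0] (F (ω * l)) := by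
        rw [hs0]
        exact iterate_stage hF _ _
      rw [this]
      simpa using hN0
    | succ t ih =>
      intro hl
      have ht : (ω * l + t : Ordinal.{0}) < ω * l + (t + 1 : ℕ) := by simp
      have := ih fun b hb => hl b (hb.trans ht)
      rw [hs]
      exact (hNR t (s t) (hl _ ht) this).1
  refine ⟨s, strictMono_nat_of_lt_succ fun t => ?_, ?_, hR, ?_⟩
  · rw [hs]
    have := hN t (s t)
    omega
  · intro j hj
    rw [iterate_stage hF]
    exact hN0' j (hs0 ▸ hj)
  · intro t hl j hj hj'
    have ht : (ω * l + t : Ordinal.{0}) < ω * l + (t + 1 : ℕ) := by simp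
    rw [hs] at hj'
    exact (hNR t (s t) (hl _ ht) (hR t fun b hb => hl b (hb.trans ht))).2 j hj hj'

/-- A one of `F` at any stage is a one of `C` at the corresponding stage or at the next one, and `F`
shows every bit of `C` at the stages `s t`. Both correspondences preserve cofinality below `ω * l`.
-/
theorem limSup_iff_of_follows (hRo : ∀ c f, R c f → ∀ p, of f p = oc c p)
    {l : Ordinal.{0}} (hlive : ∀ b < ω * l, live (C b))
    (hfol : ∀ m < l, ∃ s, Follows C F R ok live oc of m s) (p : P) :
    LimSup (ω * l) (fun d => of (F d) p) ↔ LimSup (ω * l) (fun d => oc (C d) p) := by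
  choose! s hs using hfol
  have hfull : ∀ m < l, ∀ t : ℕ, ∀ b < ω * m + t, live (C b) := fun m hm t b hb =>
    hlive b (hb.trans (omega0_mul_add_nat_lt hm t))
  constructor
  · intro H b hb
    obtain ⟨m, k, rfl⟩ := exists_eq_omega0_mul_add b
    have hm := lt_of_omega0_mul_add_lt hb
    obtain ⟨d, hd, hbd, hu⟩ := H (ω * m + (s m k : ℕ)) (omega0_mul_add_nat_lt hm _)
    obtain ⟨n, j, rfl⟩ := exists_eq_omega0_mul_add d
    have hn := lt_of_omega0_mul_add_lt hd
    have hmn : m ≤ n := by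
      by_contra! h
      exact absurd (omega0_mul_add_nat_lt h j) (not_lt.2 (le_trans le_self_add hbd))
    have hjk : m = n → s m k ≤ j := by
      rintro rfl
      simpa using hbd
    have hle : ∀ t : ℕ, (m = n → k ≤ t) → ω * m + (k : Ordinal.{0}) ≤ ω * n + t := by
      intro t ht
      rcases hmn.eq_or_lt with h | h
      · subst h
        simpa using ht rfl
      · exact (omega0_mul_add_nat_lt h k).le.trans le_self_add
    obtain ⟨h1, h2, -, h4⟩ := hs n hn
    by_cases hj : j ≤ s n 0
    · refine ⟨ω * n, ?_, ?_, ?_⟩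
      · simpa using omega0_mul_add_nat_lt hn 0
      · have := hle 0 (by
          rintro rfl
          have := h1.le_iff_le.1 ((hjk rfl).trans hj)
          omega)
        simpa using this
      · exact ((h2 j hj).2 p).symm.trans hu
    · obtain ⟨t, ht1, ht2⟩ : ∃ t, s n t ≤ j ∧ j ≤ s n (t + 1) := by
        have hex : ∃ t, j ≤ s n t := ⟨j, h1.id_le j⟩
        classical
        have h0 : Nat.find hex ≠ 0 := by
          intro h
          have := Nat.find_spec hex
          rw [h] at this
          exact hj this
        obtain ⟨t, ht⟩ := Nat.exists_eq_succ_of_ne_zero h0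
        refine ⟨t, ?_, by rw [← Nat.succ_eq_add_one, ← ht]; exact Nat.find_spec hex⟩
        have := Nat.find_min hex (m := t) (by omega)
        omega
      have hkt1 : m = n → k ≤ t + 1 := by
        rintro rfl
        exact h1.le_iff_le.1 ((hjk rfl).trans ht2)
      rcases (h4 t (hfull n hn _) j ht1 ht2).2 p with h | h
      · by_cases hkt : m = n → k ≤ t
        · exact ⟨_, omega0_mul_add_nat_lt hn t, hle t hkt, h.symm.trans hu⟩
        -- The stage `t` would lie before `b`. This only happens for `k = t + 1` and `j = s m (t +
        -- 1)`, and there `R` itself transfers the bit to stage `t + 1`.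
        · push Not at hkt
          obtain ⟨rfl, hkt⟩ := hkt
          have hk : k = t + 1 := by have := hkt1 rfl; omega
          subst hk
          have hj' : j = s m (t + 1) := le_antisymm ht2 (hjk rfl)
          refine ⟨_, omega0_mul_add_nat_lt hn (t + 1), le_rfl, ?_⟩
          have := hRo _ _ ((hs m hn).2.2.1 (t + 1) (hfull m hn _)) p
          rw [← hj'] at this
          exact this.symm.trans hu
      · exact ⟨_, omega0_mul_add_nat_lt hn (t + 1), hle _ hkt1, h.symm.trans hu⟩
  · intro H b hb
    obtain ⟨d, hd, hbd, hu⟩ := H b hb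
    obtain ⟨n, t, rfl⟩ := exists_eq_omega0_mul_add d
    have hn := lt_of_omega0_mul_add_lt hd
    refine ⟨ω * n + (s n t : ℕ), omega0_mul_add_nat_lt hn _, hbd.trans ?_, ?_⟩
    · simpa using (hs n hn).1.id_le t
    · exact (hRo _ _ ((hs n hn).2.2.1 t (hfull n hn _)) p).trans hu

/-- If a step of `C` is matched by finitely many steps of `F`, during which every observed bit
has its old or its new value, then `F` follows `C` through the transfinite. -/
theorem exists_follows
    (hRo : ∀ c f, R c f → ∀ p, of f p = oc c p)
    (hF : ∀ a, F (a + 1) = stepF (F a))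
    (hC : ∀ o, IsSuccLimit o → ∀ p, oc (C o) p = true ↔ LimSup o fun d => oc (C d) p)
    (hFl : ∀ o, IsSuccLimit o → ∀ p, of (F o) p = true ↔ LimSup o fun d => of (F d) p)
    (h0 : ∀ p, of (F 0) p = oc (C 0) p)
    (hent : ∀ o, o = 0 ∨ IsSuccLimit o → (∀ p, of (F o) p = oc (C o) p) →
      ∃ N, R (C o) (stepF^[N] (F o)) ∧ ∀ j ≤ N, ok (stepF^[j] (F o)) ∧
        ∀ p, of (stepF^[j] (F o)) p = oc (C o) p)
    (hstep : ∀ a f, live (C a) → R (C a) f → ∃ N, 0 < N ∧ R (C (a + 1)) (stepF^[N] f) ∧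
      ∀ j ≤ N, ok (stepF^[j] f) ∧
        ∀ p, of (stepF^[j] f) p = oc (C a) p ∨ of (stepF^[j] f) p = oc (C (a + 1)) p)
    (l : Ordinal.{0}) (hl : ∀ b < ω * l, live (C b)) :
    ∃ s, Follows C F R ok live oc of l s := by
  induction l using WellFoundedLT.induction with
  | ind l ih =>
    have ih' : ∀ m < l, ∃ s, Follows C F R ok live oc of m s := fun m hm =>
      ih m hm fun b hb => hl b (hb.trans_le (by gcongr))
    refine exists_follows_of_obs hF hent hstep l fun p => ?_
    rcases eq_or_ne l 0 with rfl | hl0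
    · simpa using h0 p
    · have hlim : IsSuccLimit (ω * l) := isSuccLimit_mul_left isSuccLimit_omega0 (pos_of_ne_zero hl0)
      have := limSup_iff_of_follows hRo hl ih' p
      rw [← hFl _ hlim, ← hC _ hlim] at this
      exact Bool.eq_iff_iff.2 this

theorem Follows.rel {l : Ordinal.{0}} {s : ℕ → ℕ} (h : Follows C F R ok live oc of l s) (t : ℕ)
    (hl : ∀ b < ω * l + t, live (C b)) : R (C (ω * l + t)) (F (ω * l + s t)) :=
  h.2.2.1 t hl

theorem Follows.ok_of_le {l : Ordinal.{0}} {s : ℕ → ℕ} (h : Follows C F R ok live oc of l s)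
    (t : ℕ) (hl : ∀ b < ω * l + t, live (C b)) {j : ℕ} (hj : j ≤ s t) : ok (F (ω * l + j)) := by
  induction t with
  | zero => exact (h.2.1 j hj).1
  | succ t ih =>
    by_cases hjt : j ≤ s t
    · exact ih (fun b hb => hl b (hb.trans (by simp))) hjt
    · exact (h.2.2.2 t hl j (by omega) hj).1

end Simulation

/-! ### Finite programs and their composition -/

/-- The contents of the three tapes. -/
abbrev Tapes : Type := Fin 3 → ℕ → Bool

/-- The column at position `h`. -/
def col (T : Tapes) (h : ℕ) : Fin 3 → Bool := fun i => T i h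

/-- The tapes after the column `w` has been written at position `h`. -/
def setCol (T : Tapes) (h : ℕ) (w : Fin 3 → Bool) : Tapes := fun i => Function.update (T i) h (w i)

theorem setCol_col (T : Tapes) (h : ℕ) : setCol T h (col T h) = T := by
  funext i
  exact Function.update_eq_self _ _

/-- A finite program with a single entry state and with exits indexed by `E`. -/
structure Frag (E : Type) where
  Q : Type
  fin : Fintype Q
  start : Q
  tr : Q → (Fin 3 → Bool) → (Q ⊕ E) × (Fin 3 → Bool) × Bool

attribute [instance] Frag.fin

namespace Frag

variable {E E' : Type}

/-- The successor of a snapshot in state `q`. -/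
def next (F : Frag E) (q : F.Q) (h : ℕ) (T : Tapes) : (F.Q ⊕ E) × ℕ × Tapes :=
  let r := F.tr q (col T h)
  (r.1, if r.2.2 then h + 1 else h - 1, setCol T h r.2.1)

/-- A single step between snapshots whose tapes satisfy `I`. -/
def Step (F : Frag E) (I : Tapes → Prop) (c d : (F.Q ⊕ E) × ℕ × Tapes) : Prop :=
  ∃ q, c.1 = Sum.inl q ∧ d = F.next q c.2.1 c.2.2 ∧ I c.2.2 ∧ I d.2.2

/-- At least one step, all tapes on the way satisfying `I`. -/
def Steps (F : Frag E) (I : Tapes → Prop) : (F.Q ⊕ E) × ℕ × Tapes → (F.Q ⊕ E) × ℕ × Tapes → Prop :=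
  Relation.TransGen (F.Step I)

/-- From the entry state with head position `h` and tapes `T`, the program leaves through the exit
`e` with head position `h'` and tapes `T'`, all tapes on the way satisfying `I`. -/
def Run (F : Frag E) (I : Tapes → Prop) (h : ℕ) (T : Tapes) (e : E) (h' : ℕ) (T' : Tapes) : Prop :=
  F.Steps I (Sum.inl F.start, h, T) (Sum.inr e, h', T')

theorem Steps.mono {F : Frag E} {I J : Tapes → Prop} (hIJ : ∀ T, I T → J T)
    {c d : (F.Q ⊕ E) × ℕ × Tapes} (h : F.Steps I c d) : F.Steps J c d :=
  Relation.TransGen.mono (fun _ _ ⟨q, h1, h2, h3, h4⟩ => ⟨q, h1, h2, hIJ _ h3, hIJ _ h4⟩) _ _ h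

theorem Run.mono {F : Frag E} {I J : Tapes → Prop} (hIJ : ∀ T, I T → J T)
    {h h' : ℕ} {T T' : Tapes} {e : E} (H : F.Run I h T e h' T') : F.Run J h T e h' T' :=
  Steps.mono hIJ H

theorem Steps.inv_right {F : Frag E} {I : Tapes → Prop} {c d : (F.Q ⊕ E) × ℕ × Tapes}
    (h : F.Steps I c d) : I d.2.2 := by
  cases h with
  | single h => exact h.choose_spec.2.2.2
  | tail _ h => exact h.choose_spec.2.2.2

theorem Run.inv_right {F : Frag E} {I : Tapes → Prop} {h h' : ℕ} {T T' : Tapes} {e : E}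
    (H : F.Run I h T e h' T') : I T' := Steps.inv_right H

/-- The program with a single state. -/
def act (g : (Fin 3 → Bool) → E × (Fin 3 → Bool) × Bool) : Frag E where
  Q := Unit
  fin := inferInstance
  start := ()
  tr _ s := (Sum.inr (g s).1, (g s).2.1, (g s).2.2)

theorem run_act {g : (Fin 3 → Bool) → E × (Fin 3 → Bool) × Bool} {I : Tapes → Prop} {h : ℕ}
    {T : Tapes} (hI : I T) (hI' : I (setCol T h (g (col T h)).2.1)) :
    (act g).Run I h T (g (col T h)).1 (if (g (col T h)).2.2 then h + 1 else h - 1)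
      (setCol T h (g (col T h)).2.1) :=
  Relation.TransGen.single ⟨(), rfl, rfl, hI, hI'⟩

/-- Sequential composition. -/
def bind [Fintype E] (F : Frag E) (G : E → Frag E') : Frag E' where
  Q := F.Q ⊕ Σ e, (G e).Q
  fin := inferInstance
  start := Sum.inl F.start
  tr
    | Sum.inl q, s =>
      let r := F.tr q s
      (match r.1 with
        | Sum.inl q' => Sum.inl (Sum.inl q')
        | Sum.inr e => Sum.inl (Sum.inr ⟨e, (G e).start⟩), r.2)
    | Sum.inr ⟨e, q⟩, s =>
      let r := (G e).tr q s
      (match r.1 with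
        | Sum.inl q' => Sum.inl (Sum.inr ⟨e, q'⟩)
        | Sum.inr e' => Sum.inr e', r.2)

theorem Steps.bind_left [Fintype E] {F : Frag E} (G : E → Frag E') {I : Tapes → Prop}
    {c d : (F.Q ⊕ E) × ℕ × Tapes} (h : F.Steps I c d) :
    (F.bind G).Steps I
      (Sum.elim (fun q => Sum.inl (Sum.inl q)) (fun e => Sum.inl (Sum.inr ⟨e, (G e).start⟩)) c.1, c.2)
      (Sum.elim (fun q => Sum.inl (Sum.inl q)) (fun e => Sum.inl (Sum.inr ⟨e, (G e).start⟩)) d.1, d.2) := by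
  refine Relation.TransGen.lift
    (fun c : (F.Q ⊕ E) × ℕ × Tapes => ((Sum.elim (fun q => Sum.inl (Sum.inl q))
      (fun e => Sum.inl (Sum.inr ⟨e, (G e).start⟩)) c.1, c.2) :
      ((F.bind G).Q ⊕ E') × ℕ × Tapes)) ?_ _ _ h
  rintro ⟨_, h, T⟩ _ ⟨q, rfl, rfl, h3, h4⟩
  refine ⟨Sum.inl q, rfl, ?_, h3, h4⟩
  simp only [next, bind]
  rcases (F.tr q (col T h)).1 with q' | e <;> rfl

theorem Steps.bind_right [Fintype E] (F : Frag E) {G : E → Frag E'} {I : Tapes → Prop} {e : E}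
    {c d : ((G e).Q ⊕ E') × ℕ × Tapes} (h : (G e).Steps I c d) :
    (F.bind G).Steps I (Sum.elim (fun q => Sum.inl (Sum.inr ⟨e, q⟩)) Sum.inr c.1, c.2)
      (Sum.elim (fun q => Sum.inl (Sum.inr ⟨e, q⟩)) Sum.inr d.1, d.2) := by
  refine Relation.TransGen.lift
    (fun c : ((G e).Q ⊕ E') × ℕ × Tapes => ((Sum.elim (fun q => Sum.inl (Sum.inr ⟨e, q⟩))
      Sum.inr c.1, c.2) : ((F.bind G).Q ⊕ E') × ℕ × Tapes)) ?_ _ _ h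
  rintro ⟨_, h, T⟩ _ ⟨q, rfl, rfl, h3, h4⟩
  refine ⟨Sum.inr ⟨e, q⟩, rfl, ?_, h3, h4⟩
  simp only [next, bind]
  rcases ((G e).tr q (col T h)).1 with q' | e <;> rfl

theorem Run.bind [Fintype E] {F : Frag E} {G : E → Frag E'} {I : Tapes → Prop}
    {h h' h'' : ℕ} {T T' T'' : Tapes} {e : E} {e' : E'}
    (hF : F.Run I h T e h' T') (hG : (G e).Run I h' T' e' h'' T'') :
    (F.bind G).Run I h T e' h'' T'' :=
  Relation.TransGen.trans (Steps.bind_left G hF) (Steps.bind_right F hG)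

/-- The program that is restarted whenever it leaves through the exit `none`. -/
def loop (F : Frag (Option E)) : Frag E where
  Q := F.Q
  fin := F.fin
  start := F.start
  tr q s :=
    let r := F.tr q s
    (match r.1 with
      | Sum.inl q' => Sum.inl q'
      | Sum.inr none => Sum.inl F.start
      | Sum.inr (some e) => Sum.inr e, r.2)

/-- The state of the loop that belongs to a state or an exit of its body. -/
def loopState (F : Frag (Option E)) : F.Q ⊕ Option E → F.loop.Q ⊕ E
  | Sum.inl q => Sum.inl q
  | Sum.inr none => Sum.inl F.start
  | Sum.inr (some e) => Sum.inr e

theorem Steps.loop {F : Frag (Option E)} {I : Tapes → Prop}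
    {c d : (F.Q ⊕ Option E) × ℕ × Tapes} (h : F.Steps I c d) :
    F.loop.Steps I (F.loopState c.1, c.2) (F.loopState d.1, d.2) := by
  refine Relation.TransGen.lift (fun c : (F.Q ⊕ Option E) × ℕ × Tapes =>
    ((F.loopState c.1, c.2) : (F.loop.Q ⊕ E) × ℕ × Tapes)) ?_ _ _ h
  rintro ⟨_, h, T⟩ _ ⟨q, rfl, rfl, h3, h4⟩
  refine ⟨q, rfl, ?_, h3, h4⟩
  simp only [next, Frag.loop]
  rcases (F.tr q (col T h)).1 with q' | (_ | e) <;> rfl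

theorem Run.loop_exit {F : Frag (Option E)} {I : Tapes → Prop} {h h' : ℕ} {T T' : Tapes} {e : E}
    (H : F.Run I h T (some e) h' T') : F.loop.Run I h T e h' T' :=
  Steps.loop H

theorem Run.loop_step {F : Frag (Option E)} {I : Tapes → Prop} {h h' h'' : ℕ} {T T' T'' : Tapes}
    {e : E} (H : F.Run I h T none h' T') (H' : F.loop.Run I h' T' e h'' T'') :
    F.loop.Run I h T e h'' T'' :=
  Relation.TransGen.trans (Steps.loop H) H'

/-! ### Conversion to a machine -/

/-- The machine that runs `F` and enters the state `L` of `F` at limits. -/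
noncomputable def toITTM (F : Frag Unit) (L : F.Q) : ITTM (Fintype.card F.Q) where
  start := Fintype.equivFin F.Q F.start
  trans q s :=
    let r := F.tr (q.elim L (Fintype.equivFin F.Q).symm) s
    (match r.1 with
      | Sum.inl q' => some (some (Fintype.equivFin F.Q q'))
      | Sum.inr _ => none, r.2)

/-- The snapshot of the machine that belongs to a snapshot of the program. -/
noncomputable def toCfg (F : Frag Unit) (c : (F.Q ⊕ Unit) × ℕ × Tapes) : Cfg (Fintype.card F.Q) where
  state := match c.1 with
    | Sum.inl q' => some (some (Fintype.equivFin F.Q q'))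
    | Sum.inr _ => none
  head := c.2.1
  tape := c.2.2

theorem step_toCfg (F : Frag Unit) (L q : F.Q) (h : ℕ) (T : Tapes) :
    (F.toITTM L).step (F.toCfg (Sum.inl q, h, T)) = F.toCfg (F.next q h T) := by
  simp only [ITTM.step, toCfg, toITTM, Option.elim, Equiv.symm_apply_apply]
  rfl

/-- The Limit state is not the state `L`, but both have the same successor. Snapshots at limits
therefore agree with snapshots of the program from the first step on. -/
theorem step_limit (F : Frag Unit) (L : F.Q) (h : ℕ) (T : Tapes) :
    (F.toITTM L).step ⟨some none, h, T⟩ = (F.toITTM L).step (F.toCfg (Sum.inl L, h, T)) := by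
  simp [ITTM.step, toCfg, toITTM]
  rfl

theorem Steps.iterate {F : Frag Unit} (L : F.Q) {I : Tapes → Prop} {c d : (F.Q ⊕ Unit) × ℕ × Tapes}
    (H : F.Steps I c d) : ∃ N, 0 < N ∧ (F.toITTM L).step^[N] (F.toCfg c) = F.toCfg d ∧
      ∀ j < N, ((F.toITTM L).step^[j] (F.toCfg c)).state ≠ none ∧
        I ((F.toITTM L).step^[j] (F.toCfg c)).tape := by
  have one : ∀ c d, F.Step I c d → (F.toITTM L).step (F.toCfg c) = F.toCfg d ∧
      (F.toCfg c).state ≠ none ∧ I (F.toCfg c).tape := by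
    rintro ⟨_, h, T⟩ _ ⟨q, rfl, rfl, h3, h4⟩
    exact ⟨step_toCfg F L q h T, by simp [toCfg], h3⟩
  induction H with
  | single h =>
    obtain ⟨h1, h2, h3⟩ := one _ _ h
    refine ⟨1, one_pos, h1, fun j hj => ?_⟩
    obtain rfl : j = 0 := by omega
    exact ⟨h2, h3⟩
  | tail _ h ih =>
    obtain ⟨N, hN, hNd, hj⟩ := ih
    obtain ⟨h1, h2, h3⟩ := one _ _ h
    refine ⟨N + 1, by omega, by rw [Function.iterate_succ_apply', hNd, h1], fun j hjN => ?_⟩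
    rcases Nat.lt_succ_iff_lt_or_eq.1 hjN with h | rfl
    · exact hj j h
    · rw [hNd]
      exact ⟨h2, h3⟩

end Frag
-- Unary registers on the scratch tape
namespace Frag

variable {E : Type}

/-- The tapes after the bit `b` has been written at position `c` of tape `i`. -/
def put (T : Tapes) (i : Fin 3) (c : ℕ) (b : Bool) : Tapes :=
  Function.update T i (Function.update (T i) c b)

theorem put_apply (T : Tapes) (i j : Fin 3) (c d : ℕ) (b : Bool) :
    put T i c b j d = if j = i ∧ d = c then b else T j d := by
  unfold put
  by_cases h : j = i
  · subst h
    by_cases h' : d = c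
    · simp [h']
    · simp [h']
  · simp [h]

theorem setCol_update (T : Tapes) (i : Fin 3) (c : ℕ) (b : Bool) :
    setCol T c (Function.update (col T c) i b) = put T i c b := by
  funext j d
  rw [put_apply]
  by_cases h' : d = c
  · subst h'
    by_cases h : j = i
    · subst h; simp [setCol]
    · simp [setCol, h, col]
  · simp [setCol, h']

theorem run_act_of {g : (Fin 3 → Bool) → E × (Fin 3 → Bool) × Bool} {I : Tapes → Prop} {h h' : ℕ}
    {T T' : Tapes} {e : E} (w : Fin 3 → Bool) (d : Bool) (hg : g (col T h) = (e, w, d))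
    (hT : T' = setCol T h w) (hh : h' = if d then h + 1 else h - 1) (hI : I T) (hI' : I T') :
    (act g).Run I h T e h' T' := by
  have := run_act (g := g) (I := I) (h := h) (T := T) hI (by rw [hg]; exact hT ▸ hI')
  rw [hg] at this
  rw [hT, hh]
  exact this

/-- A single move without any change of the tapes. -/
def mv (d : Bool) (e : E) : Frag E := act fun s => (e, s, d)

theorem run_mv {I : Tapes → Prop} {T : Tapes} (hI : I T) (d : Bool) (e : E) (h : ℕ) :
    (mv d e).Run I h T e (if d then h + 1 else h - 1) T :=
  run_act_of (col T h) d rfl (setCol_col T h).symm rfl hI hI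

/-- Every step moves the head, so a left move at the leftmost cell has to serve as the program that
does nothing. -/
theorem run_mv_zero {I : Tapes → Prop} {T : Tapes} (hI : I T) (e : E) :
    (mv false e).Run I 0 T e 0 T := run_mv hI false e 0

/-- `j + 1` moves in the same direction. -/
def mvs (d : Bool) : ℕ → E → Frag E
  | 0, e => mv d e
  | j + 1, e => (mv d ()).bind fun _ => mvs d j e

theorem run_mvs_right {I : Tapes → Prop} {T : Tapes} (hI : I T) (e : E) (j h : ℕ) :
    (mvs true j e).Run I h T e (h + (j + 1)) T := by
  induction j generalizing h with
  | zero => exact run_mv hI true e h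
  | succ j ih =>
    have := (run_mv hI true () h).bind (G := fun _ => mvs true j e) (ih (h + 1))
    rwa [show h + 1 + (j + 1) = h + (j + 1 + 1) by omega] at this

theorem run_mvs_left {I : Tapes → Prop} {T : Tapes} (hI : I T) (e : E) (j h : ℕ) :
    (mvs false j e).Run I h T e (h - (j + 1)) T := by
  induction j generalizing h with
  | zero => exact run_mv hI false e h
  | succ j ih =>
    have := (run_mv hI false () h).bind (G := fun _ => mvs false j e) (ih (h - 1))
    rwa [show h - 1 - (j + 1) = h - (j + 1 + 1) by omega] at this

/-- Move from the leftmost cell to the cell `i`. -/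
def goto : ℕ → Frag Unit
  | 0 => mv false ()
  | i + 1 => (goto i).bind fun _ => mv true ()

theorem run_goto {I : Tapes → Prop} {T : Tapes} (hI : I T) (i : ℕ) :
    (goto i).Run I 0 T () i T := by
  induction i with
  | zero => exact run_mv hI false () 0
  | succ i ih => exact ih.bind (run_mv hI true () i)

/-- The third tape marks the leftmost cell. -/
def Marked (T : Tapes) : Prop := ∀ v, T 2 v = decide (v = 0)

/-- Return to the leftmost cell. -/
def rewind (e : E) : Frag E :=
  loop (act fun s => (if s 2 then some e else none, s, false))

theorem run_rewind {I : Tapes → Prop} {T : Tapes} (hI : I T) (hT : Marked T) (e : E) (h : ℕ) :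
    (rewind e).Run I h T e 0 T := by
  induction h with
  | zero =>
    exact Run.loop_exit (run_act_of (col T 0) false (by simp [col, hT 0]) (setCol_col _ _).symm rfl
      hI hI)
  | succ h ih =>
    exact Run.loop_step (run_act_of (col T (h + 1)) false (by simp [col, hT (h + 1)])
      (setCol_col _ _).symm rfl hI hI) ih

/-- Slot `i` of the second tape holds the number `v`: its first mark is in block `v`. -/
def Holds (k : ℕ) (T : Tapes) (i v : ℕ) : Prop :=
  T 1 ((k + 2) * v + i) = true ∧ ∀ u < v, T 1 ((k + 2) * u + i) = false

/-- Move from the leftmost cell to the first mark in slot `i` and apply `g` there. -/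
def seek [Fintype E] (k i : ℕ) (g : (Fin 3 → Bool) → E × (Fin 3 → Bool)) : Frag E :=
  (goto i).bind fun _ => loop
    -- On success the head cannot stay in place, so it moves right and back again. Otherwise the one
    -- move of `act` and the `k + 1` moves of `mvs true k` lead to the same slot of the next block.
    ((act fun s => if s 1 then (some (g s).1, (g s).2, true) else (none, s, true)).bind fun
      | some e => mv false (some e)
      | none => mvs true k none)

theorem run_seek [Fintype E] {k i v : ℕ} {g : (Fin 3 → Bool) → E × (Fin 3 → Bool)}
    {I : Tapes → Prop} {T : Tapes} (hv : Holds k T i v) {e : E} {w : Fin 3 → Bool} {T' : Tapes}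
    (hg : g (col T ((k + 2) * v + i)) = (e, w)) (hT : T' = setCol T ((k + 2) * v + i) w)
    (hI : I T) (hI' : I T') :
    (seek k i g).Run I 0 T e ((k + 2) * v + i) T' := by
  refine (run_goto hI i).bind ?_
  suffices H : ∀ d u, u + d = v → (loop
    ((act fun s => if s 1 then (some (g s).1, (g s).2, true) else (none, s, true)).bind fun
      | some e => mv false (some e)
      | none => mvs true k none)).Run I ((k + 2) * u + i) T e ((k + 2) * v + i) T' by
    simpa using H v 0 (by simp)
  intro d
  induction d with
  | zero =>
    rintro u rfl
    refine Run.loop_exit (Run.bind (e := some e)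
      (run_act_of (e := some e) w true ?_ hT rfl hI hI') (run_mv hI' false (some e) _))
    have := hv.1
    simp only [add_zero] at this hg
    simp [col, this]
    exact ⟨congrArg Prod.fst hg, congrArg Prod.snd hg⟩
  | succ d ih =>
    intro u hu
    have h1 := ih (u + 1) (by omega)
    refine Run.loop_step (Run.bind (e := none) (run_act_of (e := none) (T' := T)
      (col T ((k + 2) * u + i)) true ?_ (setCol_col _ _).symm rfl hI hI)
        (run_mvs_right hI none k _)) ?_
    · have := hv.2 u (by omega)
      simp [col, this]
    · convert h1 using 1
      simp
      ring

/-- The two tapes agree on the parts that arithmetic on the registers `1, 2, …` leaves alone. -/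
def Same (k : ℕ) (T T' : Tapes) : Prop :=
  T' 0 = T 0 ∧ T' 2 = T 2 ∧ ∀ v, T' 1 ((k + 2) * v) = T 1 ((k + 2) * v)

theorem Same.refl (k : ℕ) (T : Tapes) : Same k T T := ⟨rfl, rfl, fun _ => rfl⟩

theorem Same.trans {k : ℕ} {T T' T'' : Tapes} (h : Same k T T') (h' : Same k T' T'') :
    Same k T T'' :=
  ⟨h'.1.trans h.1, h'.2.1.trans h.2.1, fun v => (h'.2.2 v).trans (h.2.2 v)⟩

theorem slot_inj {k u v i j : ℕ} (hi : i < k + 2) (hj : j < k + 2)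
    (h : (k + 2) * u + i = (k + 2) * v + j) : u = v ∧ i = j := by
  have h1 := congrArg (· / (k + 2)) h
  have h2 := congrArg (· % (k + 2)) h
  simp only [Nat.mul_add_div (by omega : k + 2 > 0), Nat.mul_add_mod, Nat.div_eq_of_lt hi,
    Nat.div_eq_of_lt hj, Nat.mod_eq_of_lt hi, Nat.mod_eq_of_lt hj] at h1 h2
  omega

theorem same_put {k i v : ℕ} (hi : 0 < i) (hik : i < k + 2) (T : Tapes) (b : Bool) :
    Same k T (put T 1 ((k + 2) * v + i) b) := by
  refine ⟨?_, ?_, ?_⟩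
  · funext d; simp [put_apply]
  · funext d; simp [put_apply]
  · intro u
    rw [put_apply, if_neg]
    rintro ⟨-, h⟩
    have := (slot_inj (k := k) (i := 0) (by omega) hik (by simpa using h)).2
    omega

theorem holds_put_of_ne {k i j v x : ℕ} (hij : i ≠ j) (hi : i < k + 2) (hj : j < k + 2) {T : Tapes}
    {b : Bool} (h : Holds k T j x) : Holds k (put T 1 ((k + 2) * v + i) b) j x := by
  have key : ∀ u, put T 1 ((k + 2) * v + i) b 1 ((k + 2) * u + j) = T 1 ((k + 2) * u + j) := by
    intro u
    rw [put_apply, if_neg]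
    rintro ⟨-, h⟩
    exact hij (slot_inj hj hi h).2.symm
  exact ⟨by rw [key]; exact h.1, fun u hu => by rw [key]; exact h.2 u hu⟩

theorem put_slot {k i v u : ℕ} (hi : i < k + 2) (T : Tapes) (b : Bool) :
    put T 1 ((k + 2) * v + i) b 1 ((k + 2) * u + i) = if u = v then b else T 1 ((k + 2) * u + i) := by
  rw [put_apply]
  by_cases h : u = v
  · simp [h]
  · rw [if_neg, if_neg h]
    rintro ⟨-, h'⟩
    exact h (slot_inj hi hi h').1

theorem marked_put {T : Tapes} (h : Marked T) (c : ℕ) (b : Bool) : Marked (put T 1 c b) := by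
  intro v
  rw [put_apply]
  simpa using h v

/-- Increase the number in slot `i`. -/
def inc (k i : ℕ) : Frag Unit :=
  (seek k i fun s => ((), Function.update s 1 false)).bind fun _ =>
    (mvs true (k + 1) ()).bind fun _ =>
      (act fun s => ((), Function.update s 1 true, false)).bind fun _ => rewind ()

theorem run_inc {k i v : ℕ} {I : Tapes → Prop} {T : Tapes} (hm : Marked T) (hv : Holds k T i v)
    (h0 : I T) (h1 : I (put T 1 ((k + 2) * v + i) false))
    (h2 : I (put (put T 1 ((k + 2) * v + i) false) 1 ((k + 2) * (v + 1) + i) true)) :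
    (inc k i).Run I 0 T () 0
      (put (put T 1 ((k + 2) * v + i) false) 1 ((k + 2) * (v + 1) + i) true) := by
  have e1 : (k + 2) * v + i + (k + 1 + 1) = (k + 2) * (v + 1) + i := by ring
  have s1 := run_seek (g := fun s => ((), Function.update s 1 false)) hv (e := ())
    (w := Function.update (col T ((k + 2) * v + i)) 1 false) rfl (setCol_update _ _ _ _).symm h0 h1
  have s2 := run_mvs_right h1 () (k + 1) ((k + 2) * v + i)
  rw [e1] at s2
  exact s1.bind (s2.bind (Run.bind (e := ()) (run_act_of (Function.update (col _ _) 1 true) false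
    rfl (setCol_update _ _ _ _).symm rfl h1 h2)
      (run_rewind h2 (marked_put (marked_put hm _ _) _ _) () _)))

theorem holds_inc {k i v : ℕ} (hi : i < k + 2) {T : Tapes} (hv : Holds k T i v) :
    Holds k (put (put T 1 ((k + 2) * v + i) false) 1 ((k + 2) * (v + 1) + i) true) i (v + 1) := by
  refine ⟨by rw [put_slot hi, if_pos rfl], fun u hu => ?_⟩
  rw [put_slot hi, if_neg (by omega), put_slot hi]
  split_ifs with h
  · rfl
  · exact hv.2 u (by omega)

/-- Decrease the number in slot `i`, if it is positive. -/
def dec (k i : ℕ) : Frag Unit :=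
  (seek k i fun s => ((), s)).bind fun _ =>
    (mvs false (k + 1) ()).bind fun _ =>
      (act fun s => ((), Function.update s 1 true, false)).bind fun _ => rewind ()

theorem run_dec {k i v : ℕ} {I : Tapes → Prop} {T : Tapes} (hm : Marked T)
    (hv : Holds k T i (v + 1)) (h0 : I T) (h1 : I (put T 1 ((k + 2) * v + i) true)) :
    (dec k i).Run I 0 T () 0 (put T 1 ((k + 2) * v + i) true) := by
  refine (run_seek hv rfl (setCol_col _ _).symm h0 h0).bind
    ((run_mvs_left h0 () (k + 1) _).bind (Run.bind (e := ()) (run_act_of _ false rfl ?_ rfl h0 h1)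
      (run_rewind h1 (marked_put hm _ _) () _)))
  rw [setCol_update]
  congr 1
  rw [mul_add]
  omega

/-- Only the first mark counts, so the old mark in block `v + 1` may stay. By contrast, `inc` has to
erase the old mark. -/
theorem holds_dec {k i v : ℕ} (hi : i < k + 2) {T : Tapes} (hv : Holds k T i (v + 1)) :
    Holds k (put T 1 ((k + 2) * v + i) true) i v := by
  refine ⟨by rw [put_slot hi, if_pos rfl], fun u hu => ?_⟩
  rw [put_slot hi, if_neg (by omega)]
  exact hv.2 u (by omega)

/-- Decide whether the number in slot `i` is zero. -/
def test (i : ℕ) : Frag Bool :=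
  (goto i).bind fun _ => (act fun s => (s 1, s, false)).bind fun b => rewind b

theorem run_test {k i v : ℕ} {I : Tapes → Prop} {T : Tapes} (hm : Marked T)
    (hv : Holds k T i v) (h0 : I T) : (test i).Run I 0 T (decide (v = 0)) 0 T := by
  refine (run_goto h0 i).bind (Run.bind (run_act_of _ false ?_ (setCol_col _ _).symm rfl h0 h0)
    (run_rewind h0 hm _ _))
  have : T 1 i = decide (v = 0) := by
    rcases Nat.eq_zero_or_pos v with rfl | h
    · simpa using hv.1
    · have := hv.2 0 h
      simp at this
      simp [this, h.ne']
  simp [col, this]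

/-- Decide whether the slots `0` and `i` hold the same number. -/
def isEq (k i : ℕ) : Frag Bool :=
  (seek k i fun s => ((), s)).bind fun _ => (mvs false (i - 1) ()).bind fun _ =>
    (act fun s => (s 1, s, false)).bind fun b => rewind b

/-- Nothing is known about slot `0` beyond its first mark. The assumption `v ≤ x` ensures that a
mark found in block `v` is that one. -/
theorem run_isEq {k i v x : ℕ} {I : Tapes → Prop} {T : Tapes} (hi : 0 < i) (hm : Marked T)
    (hv : Holds k T i v) (hx : Holds k T 0 x) (hvx : v ≤ x) (h0 : I T) :
    (isEq k i).Run I 0 T (decide (v = x)) 0 T := by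
  refine (run_seek hv rfl (setCol_col _ _).symm h0 h0).bind ((run_mvs_left h0 () _ _).bind
    (Run.bind (run_act_of _ false ?_ (setCol_col _ _).symm rfl h0 h0) (run_rewind h0 hm _ _)))
  have : T 1 ((k + 2) * v) = decide (v = x) := by
    rcases hvx.eq_or_lt with rfl | h
    · simpa using hx.1
    · have := hx.2 v h
      simp at this
      simp [this, h.ne]
  simp [col, Nat.sub_add_cancel hi, this]

/-- Put a mark into block `0` of slot `i`. -/
def setZero (i : ℕ) : Frag Unit :=
  (goto i).bind fun _ => (act fun s => ((), Function.update s 1 true, false)).bind fun _ => rewind ()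

theorem run_setZero {i : ℕ} {I : Tapes → Prop} {T : Tapes} (hm : Marked T)
    (h0 : I T) (h1 : I (put T 1 i true)) : (setZero i).Run I 0 T () 0 (put T 1 i true) :=
  (run_goto h0 i).bind (Run.bind (e := ()) (run_act_of _ false rfl (setCol_update _ _ _ _).symm rfl
    h0 h1) (run_rewind h1 (marked_put hm _ _) _ _))

/-- No assumption on the previous contents of the slot is needed. This is what makes the registers
usable again after a limit, where the limsup leaves stray marks. -/
theorem holds_setZero (k i : ℕ) (T : Tapes) : Holds k (put T 1 i true) i 0 :=
  ⟨by simp [put_apply], fun u hu => absurd hu (by omega)⟩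

/-- Read the cell of the first tape in the column marked by slot `1`. -/
def readBit (k : ℕ) : Frag Bool :=
  (seek k 1 fun s => (s 0, s)).bind fun b => rewind b

theorem run_readBit {k v : ℕ} {I : Tapes → Prop} {T : Tapes} (hm : Marked T) (hv : Holds k T 1 v)
    (h0 : I T) : (readBit k).Run I 0 T (T 0 ((k + 2) * v + 1)) 0 T :=
  (run_seek (g := fun s => (s 0, s)) hv (e := T 0 ((k + 2) * v + 1)) (w := col T _) rfl
    (setCol_col _ _).symm h0 h0).bind (run_rewind h0 hm _ _)

/-- Write `b` into the cell of the first tape in the column marked by slot `1`. -/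
def writeBit (k : ℕ) (b : Bool) (e : E) : Frag E :=
  (seek k 1 fun s => ((), Function.update s 0 b)).bind fun _ => rewind e

theorem run_writeBit {k v : ℕ} {b : Bool} {e : E} {I : Tapes → Prop} {T : Tapes} (hm : Marked T)
    (hv : Holds k T 1 v) (h0 : I T) (h1 : I (put T 0 ((k + 2) * v + 1) b)) :
    (writeBit k b e).Run I 0 T e 0 (put T 0 ((k + 2) * v + 1) b) := by
  refine (run_seek (g := fun s => ((), Function.update s 0 b)) hv (e := ())
    (w := Function.update (col T _) 0 b) rfl (setCol_update _ _ _ _).symm h0 h1).bind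
      (run_rewind h1 ?_ _ _)
  intro v
  rw [put_apply]
  simpa using hm v

/-- Fill the third tape up to the column marked by slot `i`. -/
def fill (k i : ℕ) (e : E) : Frag E :=
  (seek k i fun s => ((), s)).bind fun _ =>
    loop (act fun s => (if s 2 then some e else none, Function.update s 2 true, false))

theorem run_fill {k i v : ℕ} {e : E} {T : Tapes} (hm : Marked T) (hv : Holds k T i v) :
    ∃ T', (fill k i e).Run (fun _ => True) 0 T e 0 T' ∧ T' 2 = code ((k + 2) * v + i + 1) := by
  -- While the head moves left from column `c`, the third tape carries the marker at `0` and ones in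
  -- the interval `(h, c]`. The marker, not yet passed, tells the loop when to stop.
  suffices H : ∀ c h (T : Tapes), h ≤ c → (∀ u, T 2 u = decide (u = 0 ∨ h < u ∧ u ≤ c)) →
      ∃ T', (loop (act fun s : Fin 3 → Bool =>
        (if s 2 then some e else none, Function.update s 2 true, false))).Run
        (fun _ => True) h T e 0 T' ∧ T' 2 = code (c + 1) by
    obtain ⟨T', h1, h2⟩ := H ((k + 2) * v + i) _ T le_rfl (fun u => by
      rw [hm u]
      congr 1
      apply propext
      omega)
    exact ⟨T', (run_seek hv rfl (setCol_col _ _).symm trivial trivial).bind h1, h2⟩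
  intro c h
  induction h with
  | zero =>
    intro T hc hT
    refine ⟨put T 2 0 true, Run.loop_exit (run_act_of _ false ?_ (setCol_update _ _ _ _).symm rfl
      trivial trivial), ?_⟩
    · simp [col, hT 0]
    · funext u
      rw [put_apply, hT]
      by_cases hu : u = 0
      · simp [hu, code]
      · simp [hu, code]
        omega
  | succ h ih =>
    intro T hc hT
    obtain ⟨T', h1, h2⟩ := ih (put T 2 (h + 1) true) (by omega) (fun u => by
      rw [put_apply, hT]
      by_cases hu : u = h + 1
      · simp [hu, hc]
      · simp only [hu, and_false, if_false]
        congr 1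
        apply propext
        omega)
    refine ⟨T', Run.loop_step (run_act_of _ false ?_ (setCol_update _ _ _ _).symm rfl
      trivial trivial) h1, h2⟩
    simp [col, hT (h + 1)]

end Frag
-- Primitive recursive functions on registers
namespace Frag

variable {E E' : Type}

/-- The tapes represent the registers `ρ 0, …, ρ (k + 1)`. -/
def Rep (k : ℕ) (T : Tapes) (ρ : ℕ → ℕ) : Prop := Marked T ∧ ∀ i < k + 2, Holds k T i (ρ i)

/-- `F` transforms the registers `ρ` into `ρ'` and leaves through `e`. -/
def Comp (k : ℕ) (F : Frag E) (ρ : ℕ → ℕ) (e : E) (ρ' : ℕ → ℕ) : Prop :=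
  ∀ T, Rep k T ρ → ∃ T', Rep k T' ρ' ∧ F.Run (Same k T) 0 T e 0 T'

variable {k : ℕ} {ρ ρ' ρ'' : ℕ → ℕ}

theorem comp_ret (e : E) : Comp k (mv false e) ρ e ρ := fun T hT =>
  ⟨T, hT, run_mv_zero (Same.refl k T) e⟩

theorem Comp.bind [Fintype E] {F : Frag E} {G : E → Frag E'} {e : E} {e' : E'}
    (hF : Comp k F ρ e ρ') (hG : Comp k (G e) ρ' e' ρ'') : Comp k (F.bind G) ρ e' ρ'' := by
  intro T hT
  obtain ⟨T', hT', h1⟩ := hF T hT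
  obtain ⟨T'', hT'', h2⟩ := hG T' hT'
  exact ⟨T'', hT'', h1.bind (h2.mono fun _ h => h1.inv_right.trans h)⟩

theorem Comp.loop_exit {F : Frag (Option E)} {e : E} (hF : Comp k F ρ (some e) ρ') :
    Comp k F.loop ρ e ρ' := by
  intro T hT
  obtain ⟨T', hT', h1⟩ := hF T hT
  exact ⟨T', hT', h1.loop_exit⟩

theorem Comp.loop_step {F : Frag (Option E)} {e : E} (hF : Comp k F ρ none ρ')
    (hL : Comp k F.loop ρ' e ρ'') : Comp k F.loop ρ e ρ'' := by
  intro T hT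
  obtain ⟨T', hT', h1⟩ := hF T hT
  obtain ⟨T'', hT'', h2⟩ := hL T' hT'
  exact ⟨T'', hT'', h1.loop_step (h2.mono fun _ h => h1.inv_right.trans h)⟩

theorem comp_inc {i : ℕ} (hi : 0 < i) (hik : i < k + 2) :
    Comp k (inc k i) ρ () (Function.update ρ i (ρ i + 1)) := by
  intro T hT
  have h1 := same_put (v := ρ i) hi hik T false
  refine ⟨_, ⟨marked_put (marked_put hT.1 _ _) _ _, fun j hj => ?_⟩,
    run_inc hT.1 (hT.2 i hik) (Same.refl k T) h1 (h1.trans (same_put hi hik _ true))⟩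
  by_cases h : j = i
  · subst h
    simpa using holds_inc hj (hT.2 j hj)
  · rw [Function.update_of_ne h]
    exact holds_put_of_ne (Ne.symm h) hik hj (holds_put_of_ne (Ne.symm h) hik hj (hT.2 j hj))

theorem comp_dec {i v : ℕ} (hi : 0 < i) (hik : i < k + 2) (hv : ρ i = v + 1) :
    Comp k (dec k i) ρ () (Function.update ρ i v) := by
  intro T hT
  have h1 := same_put (v := v) hi hik T true
  have h2 := hT.2 i hik
  rw [hv] at h2
  refine ⟨_, ⟨marked_put hT.1 _ _, fun j hj => ?_⟩, run_dec hT.1 h2 (Same.refl k T) h1⟩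
  by_cases h : j = i
  · subst h
    simpa using holds_dec hj h2
  · rw [Function.update_of_ne h]
    exact holds_put_of_ne (Ne.symm h) hik hj (hT.2 j hj)

theorem comp_test {i : ℕ} (hik : i < k + 2) : Comp k (test i) ρ (decide (ρ i = 0)) ρ := fun T hT =>
  ⟨T, hT, run_test hT.1 (hT.2 i hik) (Same.refl k T)⟩

theorem comp_isEq {i : ℕ} (hi : 0 < i) (hik : i < k + 2) (h : ρ i ≤ ρ 0) :
    Comp k (isEq k i) ρ (decide (ρ i = ρ 0)) ρ := fun T hT =>
  ⟨T, hT, run_isEq hi hT.1 (hT.2 i hik) (hT.2 0 (by omega)) h (Same.refl k T)⟩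

/-- As long as register `i` is positive, decrease it and run `F`. -/
def whilePos (k i : ℕ) (F : Frag Unit) : Frag Unit :=
  loop ((test i).bind fun z => if z then mv false (some ()) else
    (dec k i).bind fun _ => F.bind fun _ => mv false none)

/-- `P m` is the loop invariant when register `i` still has the value `m`. The body starts after the
decrement, whence `Function.update ρ i m`. -/
theorem comp_while {i : ℕ} (hi : 0 < i) (hik : i < k + 2) {F : Frag Unit}
    (P : ℕ → (ℕ → ℕ) → Prop) (h0 : ∀ ρ, P 0 ρ → ρ i = 0)
    (h : ∀ m ρ, P (m + 1) ρ → ρ i = m + 1 ∧ ∃ ρ', Comp k F (Function.update ρ i m) () ρ' ∧ P m ρ')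
    (m : ℕ) (hP : P m ρ) : ∃ ρ', Comp k (whilePos k i F) ρ () ρ' ∧ P 0 ρ' := by
  induction m generalizing ρ with
  | zero =>
    refine ⟨ρ, Comp.loop_exit (Comp.bind (comp_test hik) ?_), hP⟩
    simpa [h0 ρ hP] using comp_ret _
  | succ m ih =>
    obtain ⟨h1, ρ', h2, h3⟩ := h m ρ hP
    obtain ⟨ρ'', h4, h5⟩ := ih h3
    refine ⟨ρ'', Comp.loop_step (Comp.bind (comp_test hik) ?_) h4, h5⟩
    simp only [h1, Nat.add_eq_zero_iff, one_ne_zero, and_false, decide_false, Bool.false_eq_true,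
      if_false]
    exact (comp_dec hi hik h1).bind (h2.bind (comp_ret _))

/-- Set register `i` to zero. -/
def clear (k i : ℕ) : Frag Unit := whilePos k i (mv false ())

theorem comp_clear {i : ℕ} (hi : 0 < i) (hik : i < k + 2) :
    Comp k (clear k i) ρ () (Function.update ρ i 0) := by
  obtain ⟨ρ', h1, rfl⟩ := comp_while (ρ := ρ) (F := mv false ()) hi hik
    (fun m σ => σ = Function.update ρ i m) (by rintro _ rfl; simp)
    (by
      rintro m _ rfl
      exact ⟨by simp, _, comp_ret (), by simp⟩) (ρ i) (by simp)
  exact h1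

/-- Add register `x` to the registers `y` and `z`, and set `x` to zero. -/
def drain (k x y z : ℕ) : Frag Unit :=
  whilePos k x ((inc k y).bind fun _ => inc k z)

theorem comp_drain {x y z : ℕ} (hx : 0 < x) (hxk : x < k + 2) (hy : 0 < y) (hyk : y < k + 2)
    (hz : 0 < z) (hzk : z < k + 2) (hxy : x ≠ y) (hxz : x ≠ z) (hyz : y ≠ z) :
    ∃ ρ', Comp k (drain k x y z) ρ () ρ' ∧ ρ' x = 0 ∧ ρ' y = ρ y + ρ x ∧ ρ' z = ρ z + ρ x ∧
      ∀ j, j ≠ x → j ≠ y → j ≠ z → ρ' j = ρ j := by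
  obtain ⟨ρ', h1, h2⟩ := comp_while (ρ := ρ) (F := (inc k y).bind fun _ => inc k z) hx hxk
    (fun m σ => σ x = m ∧ σ y + m = ρ y + ρ x ∧ σ z + m = ρ z + ρ x ∧
      ∀ j, j ≠ x → j ≠ y → j ≠ z → σ j = ρ j) (fun σ h => h.1)
    (by
      rintro m σ ⟨h1, h2, h3, h4⟩
      refine ⟨h1, _, (comp_inc hy hyk).bind (comp_inc hz hzk), ?_, ?_, ?_, ?_⟩
      · simp [hxy, hxz]
      · simp [hxy.symm, hyz]
        omega
      · simp [hxz.symm, hyz.symm]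
        omega
      · intro j h5 h6 h7
        simp [h5, h6, h7, h4]) (ρ x) ⟨rfl, rfl, rfl, fun _ _ _ _ => rfl⟩
  exact ⟨ρ', h1, by simpa using h2⟩

/-- Copy register `x` to register `y`, with the help of register `t`. -/
def copy (k x y t : ℕ) : Frag Unit :=
  (clear k y).bind fun _ => (clear k t).bind fun _ => (drain k x y t).bind fun _ =>
    whilePos k t (inc k x)

/-- Reading a register by counting it down destroys it. Register `t` therefore receives a second
copy, from which `x` is restored. -/
theorem comp_copy {x y t : ℕ} (hx : 0 < x) (hxk : x < k + 2) (hy : 0 < y) (hyk : y < k + 2)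
    (ht : 0 < t) (htk : t < k + 2) (hxy : x ≠ y) (hxt : x ≠ t) (hyt : y ≠ t) :
    ∃ ρ', Comp k (copy k x y t) ρ () ρ' ∧ ρ' y = ρ x ∧ ∀ j, j ≠ y → j ≠ t → ρ' j = ρ j := by
  obtain ⟨ρ₁, h1, h2, h3, h4, h5⟩ := comp_drain
    (ρ := Function.update (Function.update ρ y 0) t 0) hx hxk hy hyk ht htk hxy hxt hyt
  obtain ⟨ρ₂, h6, h7⟩ := comp_while (ρ := ρ₁) (F := inc k x) ht htk
    (fun m σ => σ t = m ∧ σ x + m = ρ x ∧ σ y = ρ x ∧ ∀ j, j ≠ x → j ≠ y → j ≠ t → σ j = ρ j)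
    (fun σ h => h.1)
    (by
      rintro m σ ⟨h1, h2, h3, h4⟩
      refine ⟨h1, _, comp_inc hx hxk, ?_, ?_, ?_, ?_⟩
      · simp [hxt.symm]
      · simp [hxt]
        omega
      · simp [hxy.symm, hyt, h3]
      · intro j h5 h6 h7
        simp [h5, h6, h7, h4]) (ρ x) (by
      refine ⟨?_, ?_, ?_, ?_⟩
      · rw [h4]; simp [hxt, hxy]
      · rw [h2]; simp
      · rw [h3]; simp [hyt, hxt, hxy]
      · intro j h6 h7 h8
        rw [h5 j h6 h7 h8]
        simp [h7, h8])
  obtain ⟨h8, h9, h10, h11⟩ := h7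
  refine ⟨ρ₂, (comp_clear hy hyk).bind ((comp_clear ht htk).bind (h1.bind h6)), h10,
    fun j hj hj' => ?_⟩
  by_cases h : j = x
  · subst h
    simpa using h9
  · exact h11 j h hj hj'

/-- Copy register `0` to register `y`. -/
def copyZero (k y : ℕ) : Frag Unit :=
  (clear k y).bind fun _ => loop ((isEq k y).bind fun b => if b then mv false (some ()) else
    (inc k y).bind fun _ => mv false none)

/-- Register `0` has to survive limits and must never be touched, which rules out draining it.
Instead `y` counts up from zero until it equals register `0`. -/
theorem comp_copyZero {y : ℕ} (hy : 0 < y) (hyk : y < k + 2) :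
    Comp k (copyZero k y) ρ () (Function.update ρ y (ρ 0)) := by
  refine (comp_clear hy hyk).bind ?_
  suffices H : ∀ d v, v + d = ρ 0 → Comp k (loop ((isEq k y).bind fun b => if b then
      mv false (some ()) else (inc k y).bind fun _ => mv false none))
      (Function.update ρ y v) () (Function.update ρ y (ρ 0)) from H (ρ 0) 0 (by simp)
  intro d
  induction d with
  | zero =>
    rintro v hv
    have he := comp_isEq (ρ := Function.update ρ y v) hy hyk (by simp [hy.ne]; omega)
    refine Comp.loop_exit (he.bind ?_)
    simp only [add_zero] at hv
    simpa [hy.ne, hv] using comp_ret _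
  | succ d ih =>
    intro v hv
    have he := comp_isEq (ρ := Function.update ρ y v) hy hyk (by simp [hy.ne]; omega)
    refine Comp.loop_step (he.bind ?_) (ih (v + 1) (by omega))
    have hne : ¬ v = ρ 0 := by omega
    simp only [Function.update_self, Function.update_of_ne hy.ne, hne, decide_false,
      Bool.false_eq_true, if_false]
    refine Comp.bind (comp_inc (ρ := Function.update ρ y v) hy hyk) ?_
    simpa using comp_ret _

/-- A program for `f` with inputs in the registers `ins`, the output in register `out` and
scratch registers from `s` on. -/
def Implements (k : ℕ) {m : ℕ} (f : List.Vector ℕ m → ℕ) (ins : Fin m → ℕ) (out s : ℕ)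
    (F : Frag Unit) : Prop :=
  ∀ ρ, ∃ ρ', Comp k F ρ () ρ' ∧ ρ' out = f (List.Vector.ofFn fun i => ρ (ins i)) ∧
    ∀ j < s, j ≠ out → ρ' j = ρ j

/-- With `w` scratch registers, there are programs for `f`. -/
def Implementable {m : ℕ} (f : List.Vector ℕ m → ℕ) (w : ℕ) : Prop :=
  ∀ (k : ℕ) (ins : Fin m → ℕ) (out s : ℕ), (∀ i, 0 < ins i ∧ ins i < s ∧ ins i ≠ out) → 0 < out →
    out < s → s + w ≤ k + 2 → ∃ F, Implements k f ins out s F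

theorem Implementable.mono {m : ℕ} {f : List.Vector ℕ m → ℕ} {w w' : ℕ} (h : Implementable f w)
    (hw : w ≤ w') : Implementable f w' := fun k ins out s h1 h2 h3 h4 =>
  h k ins out s h1 h2 h3 (by omega)

theorem implementable_zero : Implementable (m := 0) (fun _ => 0) 0 := by
  intro k ins out s _ h2 h3 h4
  exact ⟨clear k out, fun ρ => ⟨_, comp_clear h2 (by omega), by simp, fun j _ hj => by simp [hj]⟩⟩

theorem implementable_get {m : ℕ} (i : Fin m) : Implementable (fun v => v.get i) 1 := by
  intro k ins out s h1 h2 h3 h4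
  obtain ⟨hi1, hi2, hi3⟩ := h1 i
  refine ⟨copy k (ins i) out s, fun ρ => ?_⟩
  obtain ⟨ρ', h5, h6, h7⟩ := comp_copy (k := k) (ρ := ρ) (x := ins i) (y := out) (t := s) hi1
    (by omega) h2 (by omega) (by omega) (by omega) hi3 (by omega) (by omega)
  exact ⟨ρ', h5, by simp [h6], fun j hj hj' => h7 j hj' (by omega)⟩

theorem implementable_succ : Implementable (m := 1) (fun v => v.head.succ) 1 := by
  intro k ins out s h1 h2 h3 h4
  obtain ⟨F, hF⟩ := implementable_get (0 : Fin 1) k ins out s h1 h2 h3 h4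
  refine ⟨F.bind fun _ => inc k out, fun ρ => ?_⟩
  obtain ⟨ρ', h5, h6, h7⟩ := hF ρ
  refine ⟨_, h5.bind (comp_inc h2 (by omega)), ?_, fun j hj hj' => by simp [hj', h7 j hj hj']⟩
  simp [h6]

/-- The inner functions of a composition are evaluated one by one into the registers `s, s + 1, …`.
Scratch space begins at `s + n`, so earlier results are kept. -/
theorem exists_seq_implements {m n w : ℕ} {g : Fin n → List.Vector ℕ m → ℕ}
    (hg : ∀ i, Implementable (g i) w) {k : ℕ} {ins : Fin m → ℕ} {s : ℕ}
    (hs : 0 < s) (h1 : ∀ i, 0 < ins i ∧ ins i < s) (h4 : s + n + w ≤ k + 2) (n' : ℕ) (hn : n' ≤ n) :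
    ∃ F : Frag Unit, ∀ ρ, ∃ ρ', Comp k F ρ () ρ' ∧
      (∀ i : Fin n, i < n' → ρ' (s + i) = g i (List.Vector.ofFn fun i => ρ (ins i))) ∧
      ∀ j < s, ρ' j = ρ j := by
  induction n' with
  | zero => exact ⟨mv false (), fun ρ => ⟨ρ, comp_ret (), fun i hi => absurd hi (by omega),
      fun _ _ => rfl⟩⟩
  | succ n' ih =>
    obtain ⟨F, hF⟩ := ih (by omega)
    obtain ⟨G, hG⟩ := hg ⟨n', by omega⟩ k ins (s + n') (s + n)
      (fun i => ⟨(h1 i).1, by have := (h1 i).2; omega, by have := (h1 i).2; omega⟩) (by omega)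
      (by omega) h4
    refine ⟨F.bind fun _ => G, fun ρ => ?_⟩
    obtain ⟨ρ₁, h5, h6, h7⟩ := hF ρ
    obtain ⟨ρ₂, h8, h9, h10⟩ := hG ρ₁
    refine ⟨ρ₂, h5.bind h8, fun i hi => ?_, fun j hj => by
      rw [h10 j (by omega) (by omega), h7 j hj]⟩
    rcases Nat.lt_succ_iff_lt_or_eq.1 hi with h | h
    · rw [h10 _ (by omega) (by omega), h6 i h]
    · obtain ⟨i, hin⟩ := i
      dsimp only at h
      subst h
      rw [h9]
      congr 2
      funext i
      exact h7 _ (h1 i).2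

theorem implementable_comp {m n w : ℕ} {f : List.Vector ℕ n → ℕ} {g : Fin n → List.Vector ℕ m → ℕ}
    (hf : Implementable f w) (hg : ∀ i, Implementable (g i) w) :
    Implementable (fun a => f (List.Vector.ofFn fun i => g i a)) (n + w) := by
  intro k ins out s h1 h2 h3 h4
  obtain ⟨F, hF⟩ := exists_seq_implements hg (k := k) (ins := ins) (s := s)
    (by omega) (fun i => ⟨(h1 i).1, (h1 i).2.1⟩) (by omega) n le_rfl
  obtain ⟨G, hG⟩ := hf k (fun i => s + i) out (s + n)
    (fun i => ⟨by omega, by omega, by omega⟩) h2 (by omega) (by omega)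
  refine ⟨F.bind fun _ => G, fun ρ => ?_⟩
  obtain ⟨ρ₁, h5, h6, h7⟩ := hF ρ
  obtain ⟨ρ₂, h8, h9, h10⟩ := hG ρ₁
  refine ⟨ρ₂, h5.bind h8, ?_, fun j hj hj' => by rw [h10 j (by omega) hj', h7 j hj]⟩
  rw [h9]
  congr 2
  funext i
  exact h6 i i.2

/-- Register `s` counts the remaining rounds, `s + 1` holds the current argument, `s + 2` the value
there, `s + 3` the next value, and `s + 4` is scratch space for copying. The programs for `f` and
`g` use scratch registers from `s + 5` on. -/
theorem implementable_prec {n w : ℕ} {f : List.Vector ℕ n → ℕ} {g : List.Vector ℕ (n + 2) → ℕ}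
    (hf : Implementable f w) (hg : Implementable g w) :
    Implementable (fun v : List.Vector ℕ (n + 1) =>
      v.head.rec (f v.tail) fun y IH => g (y ::ᵥ IH ::ᵥ v.tail)) (5 + w) := by
  intro k ins out s h1 h2 h3 h4
  have i1 : ∀ i, 0 < ins i := fun i => (h1 i).1
  have i2 : ∀ i, ins i < s := fun i => (h1 i).2.1
  have i3 : ∀ i, ins i ≠ out := fun i => (h1 i).2.2
  obtain ⟨F, hF⟩ := hf k (fun i => ins i.succ) (s + 2) (s + 5)
    (fun i => ⟨i1 _, by have := i2 i.succ; omega, by have := i2 i.succ; omega⟩)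
    (by omega) (by omega) (by omega)
  obtain ⟨G, hG⟩ := hg k (Fin.cons (s + 1) (Fin.cons (s + 2) fun i => ins i.succ)) (s + 3) (s + 5)
    (fun i => by
      refine Fin.cases ?_ (fun i => Fin.cases ?_ (fun i => ?_) i) i
      · simp
      · simp
      · have := i2 i.succ
        have := i1 i.succ
        simp
        omega)
    (by omega) (by omega) (by omega)
  refine ⟨(copy k (ins 0) s (s + 4)).bind fun _ => (clear k (s + 1)).bind fun _ => F.bind fun _ =>
    (whilePos k s (G.bind fun _ => (copy k (s + 3) (s + 2) (s + 4)).bind fun _ => inc k (s + 1))).bind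
      fun _ => copy k (s + 2) out (s + 4), fun ρ => ?_⟩
  have i20 := i2 0
  have i10 := i1 0
  obtain ⟨ρ₁, a1, a2, a3⟩ := comp_copy (k := k) (ρ := ρ) (x := ins 0) (y := s) (t := s + 4) i10
    (by omega) (by omega) (by omega) (by omega) (by omega) (by omega) (by omega) (by omega)
  have b1 := comp_clear (k := k) (i := s + 1) (ρ := ρ₁) (by omega) (by omega)
  obtain ⟨ρ₂, c1, c2, c3⟩ := hF (Function.update ρ₁ (s + 1) 0)
  let rc : ℕ → ℕ := fun m => Nat.rec (f (List.Vector.ofFn fun i => ρ (ins i.succ)))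
    (fun y IH => g (y ::ᵥ IH ::ᵥ List.Vector.ofFn fun i => ρ (ins i.succ))) m
  obtain ⟨ρ₃, d1, d2, d3, d4, d5⟩ := comp_while (k := k) (i := s) (ρ := ρ₂)
    (F := G.bind fun _ => (copy k (s + 3) (s + 2) (s + 4)).bind fun _ => inc k (s + 1))
    (by omega) (by omega)
    (fun m σ => σ s = m ∧ σ (s + 1) + m = ρ (ins 0) ∧ σ (s + 2) = rc (σ (s + 1)) ∧
      ∀ j < s, σ j = ρ j) (fun σ h => h.1)
    (by
      rintro m σ ⟨e1, e2, e3, e4⟩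
      obtain ⟨σ₁, f1, f2, f3⟩ := hG (Function.update σ s m)
      obtain ⟨σ₂, g1, g2, g3⟩ := comp_copy (k := k) (ρ := σ₁) (x := s + 3) (y := s + 2)
        (t := s + 4) (by omega) (by omega) (by omega) (by omega) (by omega) (by omega) (by omega)
        (by omega) (by omega)
      have f4 : σ₁ (s + 3) = rc (σ (s + 1) + 1) := by
        rw [f2]
        have : rc (σ (s + 1) + 1) = g (σ (s + 1) ::ᵥ σ (s + 2) ::ᵥ
          List.Vector.ofFn fun i => ρ (ins i.succ)) := by rw [e3]
        rw [this]
        congr 1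
        simp only [List.Vector.ofFn, Fin.cons_zero, Fin.cons_succ]
        congr 1
        · simp
        · congr 1
          · simp
          · congr 1
            funext i
            have := i2 i.succ
            rw [Function.update_of_ne (by omega), e4 _ this]
      have f5 : σ₁ (s + 1) = σ (s + 1) := by rw [f3 _ (by omega) (by omega)]; simp
      refine ⟨e1, _, f1.bind (g1.bind (comp_inc (by omega) (by omega))), ?_, ?_, ?_, ?_⟩
      · rw [Function.update_of_ne (by omega), g3 _ (by omega) (by omega),
          f3 _ (by omega) (by omega), Function.update_self]
      · rw [Function.update_self, g3 _ (by omega) (by omega), f5]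
        omega
      · rw [Function.update_self, Function.update_of_ne (by omega), g2,
          g3 _ (by omega) (by omega), f5, f4]
      · intro j hj
        rw [Function.update_of_ne (by omega), g3 _ (by omega) (by omega),
          f3 _ (by omega) (by omega), Function.update_of_ne (by omega), e4 j hj])
    (ρ (ins 0)) (by
      have h5 : ρ₂ (s + 1) = 0 := by rw [c3 _ (by omega) (by omega), Function.update_self]
      refine ⟨?_, by omega, ?_, ?_⟩
      · rw [c3 _ (by omega) (by omega), Function.update_of_ne (by omega), a2]
      · rw [h5, c2]
        change _ = f _
        congr 2
        funext i
        have := i2 i.succ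
        dsimp only
        rw [Function.update_of_ne (by omega), a3 _ (by omega) (by omega)]
      · intro j hj
        rw [c3 _ (by omega) (by omega), Function.update_of_ne (by omega),
          a3 _ (by omega) (by omega)])
  obtain ⟨ρ₄, e1, e2, e3⟩ := comp_copy (k := k) (ρ := ρ₃) (x := s + 2) (y := out)
    (t := s + 4) (by omega) (by omega) (by omega) (by omega) (by omega) (by omega) (by omega)
    (by omega) (by omega)
  refine ⟨ρ₄, a1.bind (b1.bind (c1.bind (d1.bind e1))), ?_, fun j hj hj' => by
    rw [e3 j hj' (by omega), d5 j hj]⟩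
  rw [e2, d4, show ρ₃ (s + 1) = ρ (ins 0) by omega]
  rfl

theorem exists_implementable {m : ℕ} {f : List.Vector ℕ m → ℕ} (hf : Nat.Primrec' f) :
    ∃ w, Implementable f w := by
  induction hf with
  | zero => exact ⟨0, implementable_zero⟩
  | succ => exact ⟨1, implementable_succ⟩
  | get i => exact ⟨1, implementable_get i⟩
  | comp g _ _ ihf ihg =>
    obtain ⟨w, hw⟩ := ihf
    choose w' hw' using ihg
    exact ⟨_, implementable_comp (w := w + ∑ i, w' i) (hw.mono (by omega)) fun i =>
      (hw' i).mono ((Finset.single_le_sum (fun _ _ => Nat.zero_le _) (Finset.mem_univ i)).trans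
        (by omega))⟩
  | prec _ _ ihf ihg =>
    obtain ⟨w, hw⟩ := ihf
    obtain ⟨w', hw'⟩ := ihg
    exact ⟨_, implementable_prec (w := max w w') (hw.mono (le_max_left _ _))
      (hw'.mono (le_max_right _ _))⟩

end Frag

/-! ### Random access processes -/

/-- A random access process on an infinite bit memory. Its control state is an element of `A`;
at the stage `0` and at limits it is `start`. In each step one bit of the memory is read and
rewritten. The functions depend on a parameter. The process is considered to stop when its signal is not
zero. -/
structure RAM (A : Type) where
  start : A
  signal : ℕ → A → ℕ
  addr : ℕ → A → ℕ
  bit : ℕ → A → Bool → Bool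
  next : ℕ → A → Bool → A

namespace RAM

variable {A : Type}

/-- One step of the process with parameter `n`. -/
def step (R : RAM A) (n : ℕ) (c : A × (ℕ → Bool)) : A × (ℕ → Bool) :=
  (R.next n c.1 (c.2 (R.addr n c.1)),
    Function.update c.2 (R.addr n c.1) (R.bit n c.1 (c.2 (R.addr n c.1))))

open Classical in
/-- The stages of the process with parameter `n`. -/
noncomputable def run (R : RAM A) (n : ℕ) (a : Ordinal.{0}) : A × (ℕ → Bool) :=
  Ordinal.limitRecOn a (R.start, fun _ => false) (fun _ c => R.step n c)
    (fun o _ c => (R.start, fun v => decide (∀ b < o, ∃ d, ∃ h : d < o, b ≤ d ∧ (c d h).2 v = true)))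

theorem run_zero (R : RAM A) (n : ℕ) : R.run n 0 = (R.start, fun _ => false) :=
  Ordinal.limitRecOn_zero ..

theorem run_add_one (R : RAM A) (n : ℕ) (a : Ordinal.{0}) :
    R.run n (a + 1) = R.step n (R.run n a) :=
  Ordinal.limitRecOn_add_one ..

theorem run_limit_fst (R : RAM A) (n : ℕ) {o : Ordinal.{0}} (ho : IsSuccLimit o) :
    (R.run n o).1 = R.start := by
  rw [run, Ordinal.limitRecOn_limit _ _ _ _ ho]

theorem run_limit_snd (R : RAM A) (n : ℕ) {o : Ordinal.{0}} (ho : IsSuccLimit o) (v : ℕ) :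
    (R.run n o).2 v = true ↔ LimSup o fun d => (R.run n d).2 v := by
  rw [run, Ordinal.limitRecOn_limit _ _ _ _ ho]
  simp only [LimSup, exists_prop, decide_eq_true_eq]
  rfl

theorem run_start (R : RAM A) (n : ℕ) {o : Ordinal.{0}} (ho : o = 0 ∨ IsSuccLimit o) :
    (R.run n o).1 = R.start := by
  rcases ho with rfl | ho
  · rw [run_zero]
  · exact run_limit_fst R n ho

/-- The data of the process are primitive recursive. -/
structure IsPrimrec [Primcodable A] (R : RAM A) : Prop where
  signal : Primrec fun p : ℕ × A => R.signal p.1 p.2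
  addr : Primrec fun p : ℕ × A => R.addr p.1 p.2
  bit : Primrec fun p : ℕ × A × Bool => R.bit p.1 p.2.1 p.2.2
  next : Primrec fun p : ℕ × A × Bool => R.next p.1 p.2.1 p.2.2

end RAM

theorem ITTM.tape_limit {n : ℕ} (M : ITTM n) (x : ℕ → Bool) {o : Ordinal.{0}} (ho : IsSuccLimit o)
    (i : Fin 3) (v : ℕ) : (M.run x o).tape i v = true ↔ LimSup o fun d => (M.run x d).tape i v := by
  rw [M.run_limit x ho, ITTM.limitCfg]
  simp only [LimSup, exists_prop, decide_eq_true_eq]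

/-! ### Loading the parameter and resetting the registers -/

namespace Frag

/-- Set the registers `1, …, j` to zero. -/
def setZeros : ℕ → Frag Unit
  | 0 => mv false ()
  | j + 1 => (setZeros j).bind fun _ => setZero (j + 1)

theorem same_put_block_zero {k i : ℕ} (hi : 0 < i) (hik : i < k + 2) (T : Tapes) (b : Bool) :
    Same k T (put T 1 i b) := by
  simpa using same_put (v := 0) hi hik T b

theorem run_setZeros {k n : ℕ} {T : Tapes} (hm : Marked T) (hn : Holds k T 0 n) (j : ℕ)
    (hj : j < k + 2) : ∃ T', (setZeros j).Run (Same k T) 0 T () 0 T' ∧ Marked T' ∧ Holds k T' 0 n ∧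
      ∀ i, 0 < i → i ≤ j → Holds k T' i 0 := by
  induction j with
  | zero => exact ⟨T, run_mv_zero (Same.refl k T) (), hm, hn, fun i h1 h2 => absurd h1 (by omega)⟩
  | succ j ih =>
    obtain ⟨T', h1, h2, h3, h4⟩ := ih (by omega)
    have hs := same_put_block_zero (Nat.succ_pos j) hj T' true
    refine ⟨put T' 1 (j + 1) true, h1.bind (run_setZero h2 h1.inv_right (h1.inv_right.trans hs)),
      marked_put h2 _ _, ?_, fun i h5 h6 => ?_⟩
    · simpa using holds_put_of_ne (k := k) (i := j + 1) (v := 0) (b := true) (by omega) hj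
        (by omega) h3
    · by_cases h : i = j + 1
      · subst h
        exact holds_setZero k _ T'
      · simpa using holds_put_of_ne (k := k) (i := j + 1) (v := 0) (b := true) (Ne.symm h) hj
          (by omega) (h4 i h5 (by omega))

/-- The tapes at the beginning of a computation of the program `load`. -/
def inputTapes (n : ℕ) : Tapes := fun i => if i = 0 then code n else fun _ => false

/-- The second half of `load`: remove the ones from the first tape, the last one first, counting
them in slot `0`. -/
def loadLoop (k : ℕ) : Frag Unit :=
  loop ((act fun s => (s 0, s, false)).bind fun b =>
    if b then (loop (act fun s => if s 0 then (none, s, true) else (some (), s, false))).bind fun _ =>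
      (act fun s => ((), Function.update s 0 false, false)).bind fun _ => (rewind ()).bind fun _ =>
        (inc k 0).bind fun _ => mv false none
    else mv false (some ()))

/-- Move the number on the first tape to slot `0`. -/
def load (k : ℕ) : Frag Unit :=
  (act fun s => ((), ![s 0, true, true], false)).bind fun _ => loadLoop k

/-- The tapes during the computation of `load`. -/
def loadTapes (k n m : ℕ) : Tapes :=
  ![code m, fun c => decide (c = (k + 2) * n), fun c => decide (c = 0)]

theorem marked_loadTapes (k n m : ℕ) : Marked (loadTapes k n m) := fun _ => rfl

theorem holds_loadTapes (k n m : ℕ) : Holds k (loadTapes k n m) 0 n :=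
  ⟨by simp [loadTapes], fun u hu => by simp [loadTapes]; omega⟩

theorem put_loadTapes (k n m : ℕ) :
    put (put (loadTapes k n m) 1 ((k + 2) * n + 0) false) 1 ((k + 2) * (n + 1) + 0) true =
      loadTapes k (n + 1) m := by
  funext i c
  rw [put_apply, put_apply]
  fin_cases i
  · simp [loadTapes]
  · simp only [loadTapes]
    by_cases h1 : c = (k + 2) * (n + 1)
    · simp [h1]
    · by_cases h2 : c = (k + 2) * n
      · simp [h2]
      · simp [h1, h2]
  · simp [loadTapes]

theorem put_loadTapes_zero (k n m : ℕ) :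
    put (loadTapes k n (m + 1)) 0 m false = loadTapes k n m := by
  funext i c
  rw [put_apply]
  fin_cases i
  · by_cases h : c = m
    · simp [h, loadTapes, code]
    · simp [h, loadTapes, code]
      omega
  · simp [loadTapes]
  · simp [loadTapes]

theorem run_loadLoop (k n m : ℕ) :
    (loadLoop k).Run (fun _ => True) 0 (loadTapes k n m) () 0 (loadTapes k (n + m) 0) := by
  induction m generalizing n with
  | zero =>
    exact Run.loop_exit (Run.bind (e := false) (run_act_of (col (loadTapes k n 0) 0) false
      (by simp [col, loadTapes, code]) (setCol_col _ _).symm rfl trivial trivial)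
        (run_mv_zero trivial _))
  | succ m ih =>
    -- From any position among the ones, the inner loop runs to the first zero, at `m + 1`, and
    -- steps back onto the last one, at `m`.
    have h1 : ∀ d h, h + d = m + 1 →
        (loop (act fun s => if s 0 then (none, s, true) else (some (), s, false))).Run
        (fun _ => True) h (loadTapes k n (m + 1)) () m (loadTapes k n (m + 1)) := by
      intro d
      induction d with
      | zero =>
        rintro h hd
        obtain rfl : h = m + 1 := by omega
        exact Run.loop_exit (run_act_of (col (loadTapes k n (m + 1)) (m + 1)) false
          (by simp [col, loadTapes, code]) (setCol_col _ _).symm rfl trivial trivial)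
      | succ d ihd =>
        intro h hd
        have hlt : h < m + 1 := by omega
        exact Run.loop_step (run_act_of (col (loadTapes k n (m + 1)) h) true
          (by simp [col, loadTapes, code, hlt]) (setCol_col _ _).symm rfl trivial trivial)
          (ihd (h + 1) (by omega))
    have h2 := run_inc (I := fun _ => True) (marked_loadTapes k n m) (holds_loadTapes k n m) trivial
      trivial trivial
    rw [put_loadTapes] at h2
    have h3 := ih (n + 1)
    rw [show n + 1 + m = n + (m + 1) by omega] at h3
    refine Run.loop_step (Run.bind (e := true) (run_act_of (col (loadTapes k n (m + 1)) 0) false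
      (by simp [col, loadTapes, code]) (setCol_col _ _).symm rfl trivial trivial) ?_) h3
    refine Run.bind (h1 (m + 1) 0 (by omega)) (Run.bind (e := ()) (run_act_of
      (Function.update (col (loadTapes k n (m + 1)) m) 0 false) false rfl
      (by rw [setCol_update, put_loadTapes_zero]) rfl trivial trivial) ?_)
    exact (run_rewind trivial (marked_loadTapes k n m) () _).bind (h2.bind (run_mv_zero trivial _))

theorem run_load (k n : ℕ) :
    (load k).Run (fun _ => True) 0 (inputTapes n) () 0 (loadTapes k n 0) := by
  have := run_loadLoop k 0 n
  rw [zero_add] at this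
  refine Run.bind (e := ()) (run_act_of ![inputTapes n 0 0, true, true] false rfl ?_ rfl trivial
    trivial) this
  funext i c
  fin_cases i
  · simp [loadTapes, setCol, inputTapes]
  · by_cases h : c = 0
    · simp [loadTapes, setCol, inputTapes, h]
    · simp [loadTapes, setCol, inputTapes, h]
  · by_cases h : c = 0
    · simp [loadTapes, setCol, inputTapes, h]
    · simp [loadTapes, setCol, inputTapes, h]

end Frag
-- One step of a process as a program
namespace Frag

variable {A E : Type} {k : ℕ} {ρ ρ' : ℕ → ℕ}

theorem Comp.run {F : Frag E} {e : E} (h : Comp k F ρ e ρ') {T T₁ : Tapes} (hT : Rep k T₁ ρ)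
    (hs : Same k T T₁) : ∃ T₂, Rep k T₂ ρ' ∧ Same k T T₂ ∧ F.Run (Same k T) 0 T₁ e 0 T₂ := by
  obtain ⟨T₂, h1, h2⟩ := h T₁ hT
  exact ⟨T₂, h1, hs.trans h2.inv_right, h2.mono fun _ h => hs.trans h⟩

theorem same_put_zero {T T' : Tapes} (h : Same k T T') (c : ℕ) (b : Bool) :
    Same k (put T 0 c b) (put T' 0 c b) := by
  refine ⟨?_, ?_, fun v => ?_⟩
  · funext d
    simp [put_apply, h.1]
  · funext d
    simp [put_apply, h.2.1]
  · simp [put_apply, h.2.2]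

theorem rep_put_zero {T : Tapes} (h : Rep k T ρ) (c : ℕ) (b : Bool) : Rep k (put T 0 c b) ρ := by
  refine ⟨fun v => ?_, fun i hi => ⟨?_, fun u hu => ?_⟩⟩
  · simpa [put_apply] using h.1 v
  · simpa [put_apply] using (h.2 i hi).1
  · simpa [put_apply] using (h.2 i hi).2 u hu

/-- With the parameter in register `3` and a code of the control state in register `2`, the program
computes `f` in the register `out` and uses scratch registers from `7` on. -/
def Evaluates [Encodable A] (k : ℕ) (f : ℕ → A → ℕ) (out : ℕ) (F : Frag Unit) : Prop :=
  ∀ (ρ : ℕ → ℕ) (a : A), ρ 2 = Encodable.encode a → ∃ ρ', Comp k F ρ () ρ' ∧ ρ' out = f (ρ 3) a ∧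
    ∀ j < 7, j ≠ out → ρ' j = ρ j

theorem exists_evaluates [Primcodable A] [Inhabited A] {f : ℕ → A → ℕ}
    (hf : Primrec fun p : ℕ × A => f p.1 p.2) :
    ∃ w, ∀ k out, 0 < out → out ≠ 2 → out ≠ 3 → out < 7 → 7 + w ≤ k + 2 →
      ∃ F, Evaluates k f out F := by
  -- Numbers that are not codes of control states are read as `default`. Register `2` always holds a
  -- code, so this case does not occur.
  have h1 : Primrec fun v : List.Vector ℕ 2 =>
      f v.head ((Encodable.decode (α := A) v.tail.head).getD default) :=
    hf.comp (Primrec.pair Primrec.vector_head (Primrec.option_getD.comp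
      (Primrec.decode.comp (Primrec.vector_head.comp Primrec.vector_tail)) (Primrec.const default)))
  obtain ⟨w, hw⟩ := exists_implementable (Nat.Primrec'.prim_iff.2 h1)
  refine ⟨w, fun k out h0 h2 h3 h7 hk => ?_⟩
  obtain ⟨F, hF⟩ := hw k ![3, 2] out 7 (fun i => by fin_cases i <;> simp <;> omega) h0 h7 hk
  refine ⟨F, fun ρ a ha => ?_⟩
  obtain ⟨ρ', h4, h5, h6⟩ := hF ρ
  refine ⟨ρ', h4, ?_, h6⟩
  rw [h5]
  simp [List.Vector.ofFn, ha]

/-- One step of a random access process; the last exit is taken if the process stops. -/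
def body (k : ℕ) (Fs Fa : Frag Unit) (Fb Fn : Bool → Frag Unit) : Frag (Option Unit) :=
  (copyZero k 3).bind fun _ => Fs.bind fun _ => (test 4).bind fun z =>
    if z then Fa.bind fun _ => (readBit k).bind fun b => (Fb b).bind fun _ => (Fn b).bind fun _ =>
      (copy k 5 2 6).bind fun _ => (test 4).bind fun z => writeBit k (!z) none
    else (dec k 4).bind fun _ => (test 4).bind fun z =>
      if z then mv false (some ()) else fill k 4 (some ())

variable [Encodable A] {R : RAM A} {Fs Fa : Frag Unit} {Fb Fn : Bool → Frag Unit}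
  (hk : 7 ≤ k + 2)
  (hs : Evaluates k R.signal 4 Fs) (ha : Evaluates k R.addr 1 Fa)
  (hb : ∀ b, Evaluates k (fun n a => (R.bit n a b).toNat) 4 (Fb b))
  (hn : ∀ b, Evaluates k (fun n a => Encodable.encode (R.next n a b)) 5 (Fn b))

include hk hs in
theorem run_body_start {T : Tapes} {a : A} (hT : Rep k T ρ) (h2 : ρ 2 = Encodable.encode a) :
    ∃ ρ' T', Rep k T' ρ' ∧ Same k T T' ∧ ρ' 0 = ρ 0 ∧ ρ' 2 = ρ 2 ∧ ρ' 3 = ρ 0 ∧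
      ρ' 4 = R.signal (ρ 0) a ∧ ∀ {e : Option Unit} {T'' : Tapes} {I : Tapes → Prop},
      (∀ T'', Same k T T'' → I T'') →
      Run (if ρ' 4 = 0 then Fa.bind fun _ => (readBit k).bind fun b => (Fb b).bind fun _ =>
        (Fn b).bind fun _ => (copy k 5 2 6).bind fun _ => (test 4).bind fun z => writeBit k (!z) none
      else (dec k 4).bind fun _ => (test 4).bind fun z =>
        if z then mv false (some ()) else fill k 4 (some ())) I 0 T' e 0 T'' →
      (body k Fs Fa Fb Fn).Run I 0 T e 0 T'' := by
  obtain ⟨T₁, r1, s1, u1⟩ := (comp_copyZero (k := k) (ρ := ρ) (y := 3) (by omega)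
    (by omega)).run hT (Same.refl k T)
  obtain ⟨ρ₂, c2, v2, w2⟩ := hs (Function.update ρ 3 (ρ 0)) a (by simp [h2])
  obtain ⟨T₂, r2, s2, u2⟩ := c2.run r1 s1
  obtain ⟨T₃, r3, s3, u3⟩ := (comp_test (k := k) (ρ := ρ₂) (i := 4) (by omega)).run r2 s2
  refine ⟨ρ₂, T₃, r3, s3, ?_, ?_, ?_, ?_, fun hI h => (u1.mono hI).bind ((u2.mono hI).bind
    ((u3.mono hI).bind ?_))⟩
  · rw [w2 0 (by omega) (by omega)]; simp
  · rw [w2 2 (by omega) (by omega)]; simp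
  · rw [w2 3 (by omega) (by omega)]; simp
  · rw [v2]; simp
  · by_cases h0 : ρ₂ 4 = 0
    · simpa [h0] using h
    · simpa [h0] using h

-- Register `1` holds the address, `2` the control state, `3` a copy of the parameter, `4` first the
-- signal and later the bit to be written, `5` the next control state; `6` is scratch. Memory cell
-- `v` lies in column `(k + 2) * v + 1` of the first tape, the column of the mark of register `1`
-- when that register holds `v`. The memory changes only in the concluding `writeBit`, so every tape
-- on the way agrees with the old or with the new one in the observed bits.
include hk hs ha hb hn in
theorem run_body_step {T : Tapes} {c : A × (ℕ → Bool)} (hT : Rep k T ρ)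
    (h2 : ρ 2 = Encodable.encode c.1) (hX : ∀ v, T 0 ((k + 2) * v + 1) = c.2 v)
    (hst : R.signal (ρ 0) c.1 = 0) :
    ∃ ρ' T', Rep k T' ρ' ∧ ρ' 0 = ρ 0 ∧ ρ' 2 = Encodable.encode (R.step (ρ 0) c).1 ∧
      Same k (put T 0 ((k + 2) * R.addr (ρ 0) c.1 + 1)
        (R.bit (ρ 0) c.1 (c.2 (R.addr (ρ 0) c.1)))) T' ∧
      (body k Fs Fa Fb Fn).Run (fun T'' => Same k T T'' ∨
        Same k (put T 0 ((k + 2) * R.addr (ρ 0) c.1 + 1)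
          (R.bit (ρ 0) c.1 (c.2 (R.addr (ρ 0) c.1)))) T'') 0 T none 0 T' := by
  obtain ⟨ρ₁, T₁, r1, s1, p0, p2, p3, p4, H⟩ := run_body_start (Fa := Fa) (Fb := Fb) (Fn := Fn)
    hk hs hT h2
  rw [hst] at p4
  obtain ⟨ρ₂, c2, v2, w2⟩ := ha ρ₁ c.1 (by rw [p2, h2])
  obtain ⟨T₂, r2, s2, u2⟩ := c2.run r1 s1
  have u3 := run_readBit (k := k) r2.1 (r2.2 1 (by omega)) s2
  rw [v2, p3] at u3
  set v := R.addr (ρ 0) c.1 with hv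
  have hbit : T₂ 0 ((k + 2) * v + 1) = c.2 v := by rw [s2.1, hX]
  rw [hbit] at u3
  set b := c.2 v with hbdef
  obtain ⟨ρ₄, c4, v4, w4⟩ := hb b ρ₂ c.1 (by rw [w2 2 (by omega) (by omega), p2, h2])
  obtain ⟨T₄, r4, s4, u4⟩ := c4.run r2 s2
  obtain ⟨ρ₅, c5, v5, w5⟩ := hn b ρ₄ c.1 (by
    rw [w4 2 (by omega) (by omega), w2 2 (by omega) (by omega), p2, h2])
  obtain ⟨T₅, r5, s5, u5⟩ := c5.run r4 s4
  obtain ⟨ρ₆, c6, v6, w6⟩ := comp_copy (k := k) (ρ := ρ₅) (x := 5) (y := 2) (t := 6) (by omega)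
    (by omega) (by omega) (by omega) (by omega) (by omega) (by omega) (by omega) (by omega)
  obtain ⟨T₆, r6, s6, u6⟩ := c6.run r5 s5
  obtain ⟨T₇, r7, s7, u7⟩ := (comp_test (k := k) (ρ := ρ₆) (i := 4) (by omega)).run r6 s6
  have q3 : ρ₂ 3 = ρ 0 := by rw [w2 3 (by omega) (by omega), p3]
  have q4 : ρ₆ 4 = (R.bit (ρ 0) c.1 b).toNat := by
    rw [w6 4 (by omega) (by omega), w5 4 (by omega) (by omega), v4, q3]
  have q1 : ρ₆ 1 = v := by
    rw [w6 1 (by omega) (by omega), w5 1 (by omega) (by omega), w4 1 (by omega) (by omega), v2, p3]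
  have q2 : ρ₆ 2 = Encodable.encode (R.next (ρ 0) c.1 b) := by
    rw [v6, v5, w4 3 (by omega) (by omega), q3]
  have q0 : ρ₆ 0 = ρ 0 := by
    rw [w6 0 (by omega) (by omega), w5 0 (by omega) (by omega), w4 0 (by omega) (by omega),
      w2 0 (by omega) (by omega), p0]
  have h7 := r7.2 1 (by omega)
  rw [q1] at h7
  have hI : ∀ T'', Same k T T'' → (Same k T T'' ∨
      Same k (put T 0 ((k + 2) * v + 1) (R.bit (ρ 0) c.1 b)) T'') := fun _ h => Or.inl h
  have s8 := same_put_zero s7 ((k + 2) * v + 1) (R.bit (ρ 0) c.1 b)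
  have u8 := run_writeBit (k := k) (I := fun T'' => Same k T T'' ∨
    Same k (put T 0 ((k + 2) * v + 1) (R.bit (ρ 0) c.1 b)) T'') (b := R.bit (ρ 0) c.1 b) (e := (none : Option Unit)) r7.1 h7
    (hI _ s7) (Or.inr s8)
  refine ⟨ρ₆, _, rep_put_zero r7 _ _, q0, q2, s8, H hI ?_⟩
  rw [if_pos p4]
  refine (u2.mono hI).bind ((u3.mono hI).bind ((u4.mono hI).bind ((u5.mono hI).bind
    ((u6.mono hI).bind ((u7.mono hI).bind ?_)))))
  have hz : (!decide (ρ₆ 4 = 0)) = R.bit (ρ 0) c.1 b := by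
    rw [q4]
    cases R.bit (ρ 0) c.1 b <;> simp
  rw [hz]
  exact u8

-- For signal `1` nothing has to be written, because the marker at the left end of the third tape
-- already is `code 1`. For signal `v + 2` register `4` is left with `v + 1`, and filling up to its
-- mark produces `(k + 2) * (v + 1) + 4 + 1` ones. A number above `v` is all that the busy beaver
-- argument needs, so an exact output is not attempted.
include hk hs in
theorem run_body_halt {T : Tapes} {a : A} (hT : Rep k T ρ) (h2 : ρ 2 = Encodable.encode a) :
    (R.signal (ρ 0) a = 1 → ∃ T', (body k Fs Fa Fb Fn).Run (fun _ => True) 0 T (some ()) 0 T' ∧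
      T' 2 = code 1) ∧
    (∀ v, R.signal (ρ 0) a = v + 2 → ∃ T' y, v < y ∧
      (body k Fs Fa Fb Fn).Run (fun _ => True) 0 T (some ()) 0 T' ∧ T' 2 = code y) := by
  obtain ⟨ρ₁, T₁, r1, s1, p0, p2, p3, p4, H⟩ := run_body_start (Fa := Fa) (Fb := Fb) (Fn := Fn)
    hk hs hT h2
  have key : ∀ v, R.signal (ρ 0) a = v + 1 → ∃ ρ₂ T₂, Rep k T₂ ρ₂ ∧ Same k T T₂ ∧ ρ₂ 4 = v ∧
      ∀ T', (if v = 0 then mv false (some ()) else fill k 4 (some ())).Run (fun _ => True) 0 T₂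
        (some ()) 0 T' → (body k Fs Fa Fb Fn).Run (fun _ => True) 0 T (some ()) 0 T' := by
    intro v hv
    rw [hv] at p4
    obtain ⟨T₂, r2, s2, u2⟩ := (comp_dec (k := k) (ρ := ρ₁) (i := 4) (by omega) (by omega) p4).run
      r1 s1
    obtain ⟨T₃, r3, s3, u3⟩ := (comp_test (k := k) (i := 4) (by omega)).run r2 s2
    refine ⟨_, T₃, r3, s3, by simp, fun T' h => H (fun _ _ => trivial) ?_⟩
    rw [if_neg (by omega)]
    refine (u2.mono fun _ _ => trivial).bind ((u3.mono fun _ _ => trivial).bind ?_)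
    simpa using h
  constructor
  · intro h
    obtain ⟨ρ₂, T₂, r2, s2, h4, H'⟩ := key 0 h
    refine ⟨T₂, H' T₂ (by simpa using run_mv_zero trivial _), ?_⟩
    funext v
    rw [r2.1 v]
    simp [code]
  · intro v h
    obtain ⟨ρ₂, T₂, r2, s2, h4, H'⟩ := key (v + 1) h
    obtain ⟨T', h5, h6⟩ := run_fill (e := some ()) r2.1 (r2.2 4 (by omega))
    rw [h4] at h6
    refine ⟨T', _, ?_, H' T' (by simpa using h5), h6⟩
    have : v + 1 ≤ (k + 2) * (v + 1) := Nat.le_mul_of_pos_left _ (by omega)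
    omega

end Frag

/-! ### Realization of processes by machines -/

/-- The machine `M` on input `x` behaves like the process `R` with parameter `n`: if `R` stops with
value `1`, the output is `1`; if it stops with value `v + 2`, the output is larger than `v`. -/
structure Realizes {A : Type} {m : ℕ} (M : ITTM m) (x : ℕ → Bool) (R : RAM A) (n : ℕ) : Prop where
  one : ∀ a, R.signal n (R.run n a).1 = 1 → (∀ b < a, R.signal n (R.run n b).1 = 0) →
    M.Outputs x (code 1)
  large : ∀ a v, R.signal n (R.run n a).1 = v + 2 → (∀ b < a, R.signal n (R.run n b).1 = 0) →
    ∃ y, v < y ∧ M.Outputs x (code y)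
  diverge : (∀ a, R.signal n (R.run n a).1 = 0) → ∀ y, ¬ M.Outputs x y

namespace Frag

variable {A : Type}

/-- The observed bits of the tapes: the memory, slot `0`, and the marker. -/
def obsTapes (k : ℕ) (T : Tapes) : Fin 3 × ℕ → Bool
  | (0, v) => T 0 ((k + 2) * v + 1)
  | (1, v) => T 1 ((k + 2) * v)
  | (2, v) => T 2 v

/-- The corresponding bits of a process with parameter `n`. -/
def obsProc (n : ℕ) (c : A × (ℕ → Bool)) : Fin 3 × ℕ → Bool
  | (0, v) => c.2 v
  | (1, v) => decide (v = n)
  | (2, v) => decide (v = 0)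

theorem Same.obs {k : ℕ} {T T' : Tapes} (h : Same k T T') (p : Fin 3 × ℕ) :
    obsTapes k T' p = obsTapes k T p := by
  obtain ⟨i, v⟩ := p
  fin_cases i
  · exact congrFun h.1 _
  · exact h.2.2 v
  · exact congrFun h.2.1 _

theorem obsProc_limit (R : RAM A) (n : ℕ) {o : Ordinal.{0}} (ho : IsSuccLimit o) (p : Fin 3 × ℕ) :
    obsProc n (R.run n o) p = true ↔ LimSup o fun d => obsProc n (R.run n d) p := by
  obtain ⟨i, v⟩ := p
  fin_cases i
  · exact R.run_limit_snd n ho v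
  · exact (limSup_of_eventually ho.bot_lt fun _ _ _ => rfl).symm
  · exact (limSup_of_eventually ho.bot_lt fun _ _ _ => rfl).symm

theorem obs_put {k n : ℕ} {R : RAM A} {T : Tapes} {c : A × (ℕ → Bool)}
    (h : ∀ p, obsTapes k T p = obsProc n c p) (p : Fin 3 × ℕ) :
    obsTapes k (put T 0 ((k + 2) * R.addr n c.1 + 1) (R.bit n c.1 (c.2 (R.addr n c.1)))) p =
      obsProc n (R.step n c) p := by
  obtain ⟨i, v⟩ := p
  have h := h (i, v)
  fin_cases i
  · simp only [obsTapes, obsProc, RAM.step, put_apply, Function.update_apply] at h ⊢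
    by_cases hv : v = R.addr n c.1
    · simp [hv]
    · simp [hv]
      simpa [obsTapes, obsProc] using h
  · simpa [obsTapes, obsProc, put_apply] using h
  · simpa [obsTapes, obsProc, put_apply] using h

/-- The observed bits determine the marker and register `0`, and these are all that `Init`
presupposes. So a block can be started from the limsups alone. -/
theorem holds_of_obs {k n : ℕ} {T : Tapes} {c : A × (ℕ → Bool)}
    (h : ∀ p, obsTapes k T p = obsProc n c p) : Marked T ∧ Holds k T 0 n := by
  refine ⟨fun v => h (2, v), ?_, fun u hu => ?_⟩
  · simpa [obsTapes, obsProc] using h (1, n)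
  · simpa [obsTapes, obsProc, hu.ne] using h (1, u)

theorem card_bind_unit (F G : Frag Unit) :
    Fintype.card (F.bind fun _ => G).Q = Fintype.card F.Q + Fintype.card G.Q := by
  have : Fintype.card (F.bind fun _ => G).Q = Fintype.card (F.Q ⊕ Σ _ : Unit, G.Q) := rfl
  rw [this]
  simp

section Machine

variable [Encodable A] {R : RAM A} {k n : ℕ} {P Init : Frag Unit} {B : Frag (Option Unit)}

/-- The whole program: a prologue, and then, to be repeated after limits, the preparation of the
registers and the main loop. -/
def whole (P Init : Frag Unit) (B : Frag (Option Unit)) : Frag Unit :=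
  P.bind fun _ => Init.bind fun _ => B.loop

/-- The state that is entered at limits. -/
def entry (P Init : Frag Unit) (B : Frag (Option Unit)) : (whole P Init B).Q :=
  Sum.inr ⟨(), Sum.inl Init.start⟩

/-- The entry state of the main loop. -/
def head (P Init : Frag Unit) (B : Frag (Option Unit)) : (whole P Init B).Q :=
  Sum.inr ⟨(), Sum.inr ⟨(), B.start⟩⟩

/-- The machine is about to execute the main loop, in accordance with the snapshot `c` of
the process. -/
def Matches (P Init : Frag Unit) (B : Frag (Option Unit)) (k n : ℕ) (c : A × (ℕ → Bool))
    (f : Cfg (Fintype.card (whole P Init B).Q)) : Prop :=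
  ∃ T ρ, f = (whole P Init B).toCfg (Sum.inl (head P Init B), 0, T) ∧ Rep k T ρ ∧ ρ 0 = n ∧
    ρ 2 = Encodable.encode c.1 ∧ ∀ p, obsTapes k T p = obsProc n c p

theorem steps_init {I : Tapes → Prop} {T T' : Tapes} (h : Init.Run I 0 T () 0 T') :
    (whole P Init B).Steps I (Sum.inl (entry P Init B), 0, T) (Sum.inl (head P Init B), 0, T') :=
  Steps.bind_right P (G := fun _ => Init.bind fun _ => B.loop) (e := ()) (Steps.bind_left _ h)

theorem steps_body_none {I : Tapes → Prop} {T T' : Tapes} (h : B.Run I 0 T none 0 T') :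
    (whole P Init B).Steps I (Sum.inl (head P Init B), 0, T) (Sum.inl (head P Init B), 0, T') :=
  Steps.bind_right P (G := fun _ => Init.bind fun _ => B.loop) (e := ())
    (Steps.bind_right Init (G := fun _ => B.loop) (e := ()) (Steps.loop h))

theorem steps_body_some {I : Tapes → Prop} {T T' : Tapes} (h : B.Run I 0 T (some ()) 0 T') :
    (whole P Init B).Steps I (Sum.inl (head P Init B), 0, T) (Sum.inr (), 0, T') :=
  Steps.bind_right P (G := fun _ => Init.bind fun _ => B.loop) (e := ())
    (Steps.bind_right Init (G := fun _ => B.loop) (e := ()) (Steps.loop h))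

theorem steps_prologue {I : Tapes → Prop} {T T' : Tapes} (h : P.Run I 0 T () 0 T') :
    (whole P Init B).Steps I (Sum.inl (whole P Init B).start, 0, T)
      (Sum.inl (entry P Init B), 0, T') :=
  Steps.bind_left _ h

end Machine

theorem ITTM.run_add_nat {m : ℕ} (M : ITTM m) (x : ℕ → Bool) (a : Ordinal.{0}) (j : ℕ) :
    M.run x (a + j) = M.step^[j] (M.run x a) :=
  iterate_stage (fun a => M.run_add_one x a) a j

/-- This is `exists_follows` for the process `R` and the machine after its prologue, which takes
`N₀` steps. Shifting by the finite `N₀` turns limits into limits, so the blocks of both sides stay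
aligned. `Init` runs at the start of each block, and each passage through `B` is one step of `R`. -/
theorem realizes_whole [Encodable A] {R : RAM A} {k n : ℕ} {P Init : Frag Unit}
    {B : Frag (Option Unit)} {x : ℕ → Bool}
    (hP : P.Run (fun _ => True) 0 (fun i => if i = 0 then x else fun _ => false) () 0
      (loadTapes k n 0))
    (hInit : ∀ T, Marked T → Holds k T 0 n → ∃ T' ρ, Init.Run (Same k T) 0 T () 0 T' ∧
      Rep k T' ρ ∧ ρ 0 = n ∧ ρ 2 = Encodable.encode R.start)
    (hstep : ∀ (T : Tapes) (ρ : ℕ → ℕ) (c : A × (ℕ → Bool)), Rep k T ρ → ρ 0 = n →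
      ρ 2 = Encodable.encode c.1 → (∀ v, T 0 ((k + 2) * v + 1) = c.2 v) → R.signal n c.1 = 0 →
      ∃ ρ' T', Rep k T' ρ' ∧ ρ' 0 = n ∧ ρ' 2 = Encodable.encode (R.step n c).1 ∧
      Same k (put T 0 ((k + 2) * R.addr n c.1 + 1) (R.bit n c.1 (c.2 (R.addr n c.1)))) T' ∧
      B.Run (fun T'' => Same k T T'' ∨ Same k (put T 0 ((k + 2) * R.addr n c.1 + 1)
          (R.bit n c.1 (c.2 (R.addr n c.1)))) T'') 0 T none 0 T')
    (hsig : ∀ (T : Tapes) (ρ : ℕ → ℕ) (a : A), Rep k T ρ → ρ 0 = n → ρ 2 = Encodable.encode a →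
      (R.signal n a = 1 → ∃ T', B.Run (fun _ => True) 0 T (some ()) 0 T' ∧ T' 2 = code 1) ∧
      (∀ v, R.signal n a = v + 2 → ∃ T' y, v < y ∧ B.Run (fun _ => True) 0 T (some ()) 0 T' ∧
        T' 2 = code y)) :
    Realizes ((whole P Init B).toITTM (entry P Init B)) x R n := by
  set W := whole P Init B with hW
  set M := W.toITTM (entry P Init B) with hM
  obtain ⟨N₀, hN₀, hrun₀, hok₀⟩ := (steps_prologue (Init := Init) (B := B) hP).iterate (entry P Init B)
  have hinit : M.run x 0 = W.toCfg (Sum.inl W.start, 0, fun i => if i = 0 then x else fun _ => false) :=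
    M.run_zero x
  have hfin : ∀ j : ℕ, M.run x j = M.step^[j] (W.toCfg (Sum.inl W.start, 0,
      fun i => if i = 0 then x else fun _ => false)) := by
    intro j
    have := ITTM.run_add_nat M x 0 j
    rwa [zero_add, hinit] at this
  have hF0 : M.run x ((N₀ : Ordinal.{0}) + 0) =
      W.toCfg (Sum.inl (entry P Init B), 0, loadTapes k n 0) := by
    rw [add_zero, hfin, hrun₀]
  have hFl : ∀ o : Ordinal.{0}, IsSuccLimit o → ∃ T, M.run x (N₀ + o) = ⟨some none, 0, T⟩ := by
    intro o ho
    rw [M.run_limit x (isSuccLimit_add _ ho)]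
    exact ⟨_, rfl⟩
  have main := exists_follows (C := R.run n) (F := fun a => M.run x (N₀ + a))
    (R := Matches P Init B k n) (stepF := M.step) (ok := fun f => f.state ≠ none)
    (live := fun c => R.signal n c.1 = 0) (oc := obsProc n) (of := fun f => obsTapes k f.tape)
    (by
      rintro c _ ⟨T, ρ, rfl, -, -, -, h⟩ p
      exact h p)
    (fun a => by rw [← add_assoc, M.run_add_one])
    (fun o ho p => obsProc_limit R n ho p)
    (by
      intro o ho p
      have h1 : ∀ i v, (M.run x (N₀ + o)).tape i v = true ↔
          LimSup o fun d => (M.run x (N₀ + d)).tape i v := fun i v => by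
        rw [ITTM.tape_limit M x (isSuccLimit_add _ ho), limSup_add ho.bot_lt]
      obtain ⟨i, v⟩ := p
      fin_cases i <;> exact h1 _ _)
    (by
      rintro ⟨i, v⟩
      rw [hF0, RAM.run_zero]
      fin_cases i
      · simp [obsTapes, obsProc, toCfg, loadTapes, code]
      · simp [obsTapes, obsProc, toCfg, loadTapes]
      · simp [obsTapes, obsProc, toCfg, loadTapes])
    (by
      intro o ho hobs
      -- At a limit the machine is in the Limit state instead of `entry`, and the two runs only
      -- agree after at least one step. Hence the condition `0 < N`.
      have hT : ∃ T, (M.run x (N₀ + o)).tape = T ∧ (M.run x (N₀ + o)).state ≠ none ∧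
          ∀ N, 0 < N → M.step^[N] (M.run x (N₀ + o)) =
            M.step^[N] (W.toCfg (Sum.inl (entry P Init B), 0, T)) := by
        rcases ho with rfl | ho
        · rw [hF0]
          exact ⟨_, rfl, by simp [toCfg], fun _ _ => rfl⟩
        · obtain ⟨T, hT⟩ := hFl o ho
          refine ⟨T, by rw [hT], by simp [hT], fun N hN => ?_⟩
          obtain ⟨N, rfl⟩ := Nat.exists_eq_succ_of_ne_zero hN.ne'
          rw [Function.iterate_succ_apply, Function.iterate_succ_apply, hT, step_limit]
      obtain ⟨T, hT1, hT2, hT3⟩ := hT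
      have hobs' : ∀ p, obsTapes k T p = obsProc n (R.run n o) p := by
        intro p
        rw [← hT1]
        exact hobs p
      obtain ⟨hm, hh⟩ := holds_of_obs hobs'
      obtain ⟨T', ρ, h1, h2, h3, h4⟩ := hInit T hm hh
      obtain ⟨N, hN, h5, h6⟩ := (steps_init (P := P) (B := B) h1).iterate (entry P Init B)
      have h7 : ∀ p, obsTapes k T' p = obsProc n (R.run n o) p := fun p => by
        rw [h1.inv_right.obs, hobs']
      refine ⟨N, ⟨T', ρ, by rw [hT3 N hN]; exact h5, h2, h3, by rw [R.run_start n ho, h4], h7⟩,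
        fun j hj => ?_⟩
      rcases Nat.eq_zero_or_pos j with rfl | hj0
      · exact ⟨hT2, hobs⟩
      · rw [hT3 j hj0]
        rcases hj.lt_or_eq with hj | rfl
        · exact ⟨(h6 j hj).1, fun p => ((h6 j hj).2.obs p).trans (hobs' p)⟩
        · rw [show M.step^[j] _ = _ from h5]
          exact ⟨by simp [toCfg], h7⟩)
    (by
      rintro a _ hlive ⟨T, ρ, rfl, h1, h2, h3, h4⟩
      obtain ⟨ρ', T', h5, h6, h7, h8, h9⟩ := hstep T ρ (R.run n a) h1 h2 h3
        (fun v => h4 (0, v)) hlive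
      obtain ⟨N, hN, h10, h11⟩ := (steps_body_none (P := P) (Init := Init) h9).iterate
        (entry P Init B)
      have h12 : ∀ p, obsTapes k T' p = obsProc n (R.run n (a + 1)) p := fun p => by
        rw [h8.obs, R.run_add_one, obs_put h4]
      refine ⟨N, hN, ⟨T', ρ', h10, h5, h6, by rw [R.run_add_one, h7], h12⟩, fun j hj => ?_⟩
      rcases hj.lt_or_eq with hj | rfl
      · refine ⟨(h11 j hj).1, fun p => ?_⟩
        rcases (h11 j hj).2 with h | h
        · exact Or.inl ((h.obs p).trans (h4 p))
        · right
          rw [R.run_add_one, ← obs_put h4]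
          exact h.obs p
      · rw [show M.step^[j] _ = _ from h10]
        exact ⟨by simp [toCfg], fun p => Or.inr (h12 p)⟩)
  have hbefore : ∀ j : ℕ, j < N₀ → (M.run x j).state ≠ none := fun j hj => by
    rw [hfin]
    exact (hok₀ j hj).1
  have hsplit : ∀ b : Ordinal.{0}, (∃ j : ℕ, j < N₀ ∧ b = j) ∨ ∃ d, b = N₀ + d := by
    intro b
    rcases lt_or_ge b N₀ with h | h
    · obtain ⟨j, rfl⟩ := lt_omega0.1 (h.trans (natCast_lt_omega0 N₀))
      exact Or.inl ⟨j, by exact_mod_cast h, rfl⟩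
    · exact Or.inr ⟨b - N₀, (Ordinal.add_sub_cancel_of_le h).symm⟩
  have hout : ∀ a (Y : (ℕ → Bool) → Prop), (∀ b < a, R.signal n (R.run n b).1 = 0) →
      (∀ T ρ, Rep k T ρ → ρ 0 = n → ρ 2 = Encodable.encode (R.run n a).1 →
        ∃ T', B.Run (fun _ => True) 0 T (some ()) 0 T' ∧ Y (T' 2)) → ∃ y, Y y ∧ M.Outputs x y := by
    intro a Y hlive hB
    obtain ⟨l, t, rfl⟩ := exists_eq_omega0_mul_add a
    obtain ⟨s, hs⟩ := main l fun b hb => hlive b (hb.trans_le le_self_add)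
    obtain ⟨T, ρ, h1, h2, h3, h4, -⟩ := hs.rel t hlive
    obtain ⟨T', h5, h6⟩ := hB T ρ h2 h3 h4
    obtain ⟨N, hN, h7, h8⟩ := (steps_body_some (P := P) (Init := Init) h5).iterate (entry P Init B)
    have h9 : ∀ j : ℕ, M.run x (N₀ + (ω * l + (s t : ℕ)) + j) = M.step^[j]
        (W.toCfg (Sum.inl (head P Init B), 0, T)) := fun j => by
      rw [ITTM.run_add_nat, h1]
    refine ⟨T' 2, h6, N₀ + (ω * l + (s t : ℕ)) + N, ⟨?_, fun b hb => ?_⟩, ?_⟩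
    · rw [h9, show M.step^[N] _ = _ from h7]
      simp [toCfg]
    -- No earlier stage is halting: `hbefore` covers the prologue, `ok_of_le` the blocks before `l`
    -- and block `l` up to `s t`, and `h8` the last passage through the body.
    · rcases hsplit b with ⟨j, hj, rfl⟩ | ⟨d, rfl⟩
      · exact hbefore j hj
      · have hd : d < ω * l + ((s t + N : ℕ) : Ordinal.{0}) := by
          rw [add_assoc, add_assoc] at hb
          push_cast
          exact lt_of_add_lt_add_left hb
        obtain ⟨l', j, rfl⟩ := exists_eq_omega0_mul_add d
        rcases lt_trichotomy l' l with hl | rfl | hl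
        · obtain ⟨s', hs'⟩ := main l' fun b hb => hlive b
            ((hb.trans_le (by gcongr)).trans_le le_self_add)
          exact hs'.ok_of_le j (fun b hb => hlive b
            ((hb.trans (omega0_mul_add_nat_lt hl j)).trans_le le_self_add)) (hs'.1.id_le j)
        · rcases lt_or_ge (s t) j with hj | hj
          · obtain ⟨i, rfl⟩ := Nat.exists_eq_add_of_lt hj
            have hi : s t + i + 1 < s t + N := by
              have := (add_lt_add_iff_left (ω * l')).1 hd
              exact_mod_cast this
            have := (h8 (i + 1) (by omega)).1
            rw [← h9] at this
            convert this using 3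
            push_cast
            simp only [add_assoc]
          · exact hs.ok_of_le t hlive hj
        · exact absurd (omega0_mul_add_nat_lt hl (s t + N)) (not_lt.2 (le_self_add.trans hd.le))
    · rw [h9, show M.step^[N] _ = _ from h7]
      rfl
  refine ⟨fun a h1 h2 => ?_, fun a v h1 h2 => ?_, fun h y hy => ?_⟩
  · obtain ⟨y, rfl, hy⟩ := hout a (· = code 1) h2 fun T ρ h3 h4 h5 => (hsig T ρ _ h3 h4 h5).1 h1
    exact hy
  · obtain ⟨_, ⟨y, h3, rfl⟩, hy⟩ := hout a (fun z => ∃ y, v < y ∧ z = code y) h2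
      fun T ρ h3 h4 h5 => by
        obtain ⟨T', y, h6, h7, h8⟩ := (hsig T ρ _ h3 h4 h5).2 v h1
        exact ⟨T', h7, y, h6, h8⟩
    exact ⟨y, h3, hy⟩
  · obtain ⟨b, ⟨h1, -⟩, -⟩ := hy
    rcases hsplit b with ⟨j, hj, rfl⟩ | ⟨d, rfl⟩
    · exact hbefore j hj h1
    · obtain ⟨l, j, rfl⟩ := exists_eq_omega0_mul_add d
      obtain ⟨s, hs⟩ := main l fun b _ => h b
      exact hs.ok_of_le j (fun b _ => h b) (hs.1.id_le j) h1

/-- The slots other than `0` may contain anything here. They are set to zero before the constant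
program for the code of `a` runs. -/
theorem exists_init [Encodable A] (a : A) : ∃ w, ∀ k, 7 + w ≤ k + 2 → ∃ Init : Frag Unit,
    ∀ T n, Marked T → Holds k T 0 n → ∃ T' ρ, Init.Run (Same k T) 0 T () 0 T' ∧
      Rep k T' ρ ∧ ρ 0 = n ∧ ρ 2 = Encodable.encode a := by
  obtain ⟨w, hw⟩ := exists_implementable (Nat.Primrec'.const (n := 0) (Encodable.encode a))
  refine ⟨w, fun k hk => ?_⟩
  obtain ⟨F, hF⟩ := hw k Fin.elim0 2 7 (fun i => i.elim0) (by omega) (by omega) hk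
  refine ⟨(setZeros (k + 1)).bind fun _ => F, fun T n hm hh => ?_⟩
  obtain ⟨T₁, h1, h2, h3, h4⟩ := run_setZeros hm hh (k + 1) (by omega)
  obtain ⟨ρ, h5, h6, h7⟩ := hF (fun i => if i = 0 then n else 0)
  obtain ⟨T₂, h8, h9, h10⟩ := h5.run (T := T) (T₁ := T₁) ⟨h2, fun i hi => by
    by_cases h0 : i = 0
    · subst h0; simpa using h3
    · simpa [h0] using h4 i (by omega) (by omega)⟩ h1.inv_right
  exact ⟨T₂, ρ, h1.bind h10, h8, by rw [h7 0 (by omega) (by omega)]; rfl, h6⟩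

theorem exists_evaluates_bool [Primcodable A] [Inhabited A] {f : ℕ → A → Bool → ℕ}
    (hf : Primrec fun p : ℕ × A × Bool => f p.1 p.2.1 p.2.2) :
    ∃ w, ∀ k out, 0 < out → out ≠ 2 → out ≠ 3 → out < 7 → 7 + w ≤ k + 2 →
      ∃ F : Bool → Frag Unit, ∀ b, Evaluates k (fun n a => f n a b) out (F b) := by
  have h : ∀ b, ∃ w, ∀ k out, 0 < out → out ≠ 2 → out ≠ 3 → out < 7 → 7 + w ≤ k + 2 →
      ∃ F, Evaluates k (fun n a => f n a b) out F := fun b =>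
    exists_evaluates (f := fun n a => f n a b)
      (hf.comp (Primrec.pair Primrec.fst (Primrec.pair Primrec.snd (Primrec.const b))))
  choose w hw using h
  refine ⟨max (w true) (w false), fun k out h1 h2 h3 h4 h5 => ?_⟩
  have : ∀ b, ∃ F, Evaluates k (fun n a => f n a b) out F := fun b =>
    hw b k out h1 h2 h3 h4 (by cases b <;> omega)
  choose F hF using this
  exact ⟨F, hF⟩

end Frag

/-- Every primitive recursive random access process is realized by a machine that takes the parameter
from its first tape; a prologue may prepare that tape. -/
theorem RAM.IsPrimrec.exists_machine {A : Type} [Primcodable A] {R : RAM A} (hR : R.IsPrimrec) :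
    ∃ N, ∀ P : Frag Unit, ∃ m ≤ Fintype.card P.Q + N, ∃ M : ITTM m, ∀ x n,
      P.Run (fun _ => True) 0 (fun i => if i = 0 then x else fun _ => false) () 0
        (Frag.inputTapes n) → Realizes M x R n := by
  have : Inhabited A := ⟨R.start⟩
  obtain ⟨w₁, h₁⟩ := Frag.exists_evaluates hR.signal
  obtain ⟨w₂, h₂⟩ := Frag.exists_evaluates hR.addr
  obtain ⟨w₃, h₃⟩ := Frag.exists_evaluates_bool (f := fun n a b => (R.bit n a b).toNat)
    ((Primrec.dom_finite Bool.toNat).comp hR.bit)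
  obtain ⟨w₄, h₄⟩ := Frag.exists_evaluates_bool (f := fun n a b => Encodable.encode (R.next n a b))
    (Primrec.encode.comp hR.next)
  obtain ⟨w₅, h₅⟩ := Frag.exists_init R.start
  obtain ⟨k, hk⟩ : ∃ k, k = 7 + w₁ + w₂ + w₃ + w₄ + w₅ := ⟨_, rfl⟩
  obtain ⟨Fs, hs⟩ := h₁ k 4 (by omega) (by omega) (by omega) (by omega) (by omega)
  obtain ⟨Fa, ha⟩ := h₂ k 1 (by omega) (by omega) (by omega) (by omega) (by omega)
  obtain ⟨Fb, hb⟩ := h₃ k 4 (by omega) (by omega) (by omega) (by omega) (by omega)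
  obtain ⟨Fn, hn⟩ := h₄ k 5 (by omega) (by omega) (by omega) (by omega) (by omega)
  obtain ⟨Init, hi⟩ := h₅ k (by omega)
  refine ⟨Fintype.card (Frag.load k).Q +
    Fintype.card (Init.bind fun _ => (Frag.body k Fs Fa Fb Fn).loop).Q, fun P =>
    ⟨_, le_of_eq ?_, (Frag.whole (P.bind fun _ => Frag.load k) Init
      (Frag.body k Fs Fa Fb Fn)).toITTM (Frag.entry _ _ _), fun x n hP => ?_⟩⟩
  · rw [Frag.whole, Frag.card_bind_unit, Frag.card_bind_unit, add_assoc]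
  · refine Frag.realizes_whole (k := k) (hP.bind (Frag.run_load k n)) (fun T h1 h2 => hi T n h1 h2) ?_ ?_
    · rintro T ρ c h1 rfl h3 h4 h5
      exact Frag.run_body_step (by omega) hs ha hb hn h1 h3 h4 h5
    · rintro T ρ a h1 rfl h3
      exact Frag.run_body_halt (by omega) hs h1 h3

/-- The sets semi-decided by primitive recursive random access processes are semi-decidable. -/
theorem RAM.IsPrimrec.mem_sD {A : Type} [Primcodable A] {R : RAM A} (hR : R.IsPrimrec)
    (h1 : ∀ n a, R.signal n a ≤ 1) : {n | ∃ a, R.signal n (R.run n a).1 = 1} ∈ sD := by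
  obtain ⟨N, hN⟩ := hR.exists_machine
  obtain ⟨m, -, M, hM⟩ := hN (Frag.mv false ())
  obtain ⟨f, hf⟩ := M.exists_computes
  refine ⟨f, ⟨m, M, hf⟩, fun n => ?_⟩
  have hr : Realizes M (code n) R n := hM _ _ (Frag.run_mv_zero trivial ())
  have hz : ∀ a, R.signal n (R.run n a).1 ≠ 1 → R.signal n (R.run n a).1 = 0 := fun a h => by
    have := h1 n (R.run n a).1
    omega
  refine Part.ext fun y => ?_
  rw [hf]
  by_cases hn : ∃ a, R.signal n (R.run n a).1 = 1
  · have h2 : M.Outputs (code n) (code 1) := by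
      obtain ⟨a, ha, hmin⟩ := WellFounded.has_min Ordinal.lt_wf {a | R.signal n (R.run n a).1 = 1} hn
      exact hr.one a ha fun b hb => hz b fun h => hmin b h hb
    constructor
    · intro h
      exact ⟨hn, ITTM.outputs_unique h2 h⟩
    · rintro ⟨-, rfl⟩
      exact h2
  · constructor
    · intro h
      exact absurd h (hr.diverge (fun a => hz a fun h => hn ⟨a, h⟩) y)
    · rintro ⟨h, -⟩
      exact absurd h hn

/-! ### Well-foundedness of recursive trees -/

namespace Tree

/-- The children of a node of the tree of finite sequences, where nodes are coded by numbers. -/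
def child (p k : ℕ) : ℕ := Nat.pair k p + 1

/-- All paths through `t` meet a leaf. -/
inductive Dies (L : ℕ → Bool) : ℕ → Prop
  | leaf {t : ℕ} : L t = true → Dies L t
  | node {t : ℕ} : (∀ k, Dies L (child t k)) → Dies L t

/-- The number of a node among its siblings. -/
def idx (t : ℕ) : ℕ := (t - 1).unpair.1

/-- The parent of a node. -/
def par (t : ℕ) : ℕ := (t - 1).unpair.2

@[simp] theorem idx_child (p k : ℕ) : idx (child p k) = k := by simp [idx, child]
@[simp] theorem par_child (p k : ℕ) : par (child p k) = p := by simp [par, child]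

theorem child_par_idx {t : ℕ} (h : t ≠ 0) : child (par t) (idx t) = t := by
  simp only [child, par, idx, Nat.pair_unpair]
  omega

theorem child_ne_zero (p k : ℕ) : child p k ≠ 0 := Nat.succ_ne_zero _

theorem child_lt_child {p k k' : ℕ} (h : k < k') : child p k < child p k' :=
  Nat.succ_lt_succ (Nat.pair_lt_pair_left p h)

/-- The process that visits the nodes in turn. Bit `2 * t` says that `t` is known to die; bit
`2 * t + 1` says that this has been recorded by the parent of `t`, which records its children in
order, and flashes its own first bit with each record. -/
def proc (L : ℕ → ℕ → Bool) : RAM (ℕ × ℕ) where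
  start := (0, 0)
  signal _ a := if a.1 = 6 then 1 else 0
  -- In control state `(i, t)` the node `t` is being treated in mode `i`. Mode `0` asks whether the
  -- older sibling is recorded, `1` whether `t` is dead, `2` whether `t` is still unrecorded. Modes
  -- `3` and `4` switch the flash of the parent on and off, `5` makes the record, and `6` means that
  -- the root is dead. A negative answer leads to the node `t + 1`.
  addr _ a :=
    if a.1 = 0 then (if a.2 = 0 then 0 else 2 * child (par a.2) (idx a.2 - 1) + 1)
    else if a.1 = 1 then 2 * a.2
    else if a.1 = 2 then 2 * a.2 + 1
    else if a.1 = 3 then 2 * par a.2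
    else if a.1 = 4 then 2 * par a.2
    else if a.1 = 5 then 2 * a.2 + 1
    else 0
  bit _ a b := if a.1 = 3 then true else if a.1 = 4 then false else if a.1 = 5 then true else b
  next n a b :=
    if a.1 = 0 then
      if a.2 = 0 then (if (b || L n 0) = true then (6, 0) else (0, 1))
      else if (b || decide (idx a.2 = 0)) = true then (1, a.2) else (0, a.2 + 1)
    else if a.1 = 1 then (if (b || L n a.2) = true then (2, a.2) else (0, a.2 + 1))
    else if a.1 = 2 then (if b = true then (0, a.2 + 1) else (3, a.2))
    else if a.1 = 3 then (4, a.2)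
    else if a.1 = 4 then (5, a.2)
    else if a.1 = 5 then (0, a.2 + 1)
    else (6, a.2)

theorem isPrimrec_proc {L : ℕ → ℕ → Bool} (hL : Primrec fun p : ℕ × ℕ => L p.1 p.2) :
    (proc L).IsPrimrec := by
  have hpar : Primrec par := Primrec.snd.comp (Primrec.unpair.comp Primrec.pred)
  have hidx : Primrec idx := Primrec.fst.comp (Primrec.unpair.comp Primrec.pred)
  have hchild : Primrec₂ child := Primrec.succ.comp₂ (Primrec₂.natPair.comp₂ Primrec₂.right Primrec₂.left)
  have hdouble : ∀ {α : Type} [Primcodable α] {f : α → ℕ}, Primrec f → Primrec fun a => 2 * f a :=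
    fun h => Primrec.nat_mul.comp (Primrec.const 2) h
  have eqc : ∀ {α : Type} [Primcodable α] {f : α → ℕ} (c : ℕ), Primrec f →
      PrimrecPred fun a => f a = c := fun c h => Primrec.eq.comp h (Primrec.const c)
  have eqb : ∀ {α : Type} [Primcodable α] {f : α → Bool}, Primrec f →
      PrimrecPred fun a => f a = true := fun h => Primrec.eq.comp h (Primrec.const true)
  constructor
  · exact Primrec.ite (eqc 6 (Primrec.fst.comp Primrec.snd)) (Primrec.const 1) (Primrec.const 0)
  · have m : Primrec fun p : ℕ × ℕ × ℕ => p.2.1 := Primrec.fst.comp Primrec.snd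
    have t : Primrec fun p : ℕ × ℕ × ℕ => p.2.2 := Primrec.snd.comp Primrec.snd
    refine Primrec.ite (eqc 0 m) (Primrec.ite (eqc 0 t) (Primrec.const 0) (Primrec.succ.comp
      (hdouble (hchild.comp (hpar.comp t) (Primrec.pred.comp (hidx.comp t))))))
      (Primrec.ite (eqc 1 m) (hdouble t) (Primrec.ite (eqc 2 m) (Primrec.succ.comp (hdouble t))
      (Primrec.ite (eqc 3 m) (hdouble (hpar.comp t)) (Primrec.ite (eqc 4 m) (hdouble (hpar.comp t))
      (Primrec.ite (eqc 5 m) (Primrec.succ.comp (hdouble t)) (Primrec.const 0))))))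
  · have m : Primrec fun p : ℕ × (ℕ × ℕ) × Bool => p.2.1.1 :=
      Primrec.fst.comp (Primrec.fst.comp Primrec.snd)
    have b : Primrec fun p : ℕ × (ℕ × ℕ) × Bool => p.2.2 := Primrec.snd.comp Primrec.snd
    exact Primrec.ite (eqc 3 m) (Primrec.const true) (Primrec.ite (eqc 4 m) (Primrec.const false)
      (Primrec.ite (eqc 5 m) (Primrec.const true) b))
  · have m : Primrec fun p : ℕ × (ℕ × ℕ) × Bool => p.2.1.1 :=
      Primrec.fst.comp (Primrec.fst.comp Primrec.snd)
    have t : Primrec fun p : ℕ × (ℕ × ℕ) × Bool => p.2.1.2 :=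
      Primrec.snd.comp (Primrec.fst.comp Primrec.snd)
    have b : Primrec fun p : ℕ × (ℕ × ℕ) × Bool => p.2.2 := Primrec.snd.comp Primrec.snd
    have n : Primrec fun p : ℕ × (ℕ × ℕ) × Bool => p.1 := Primrec.fst
    have nextt : Primrec fun p : ℕ × (ℕ × ℕ) × Bool => ((0, p.2.1.2 + 1) : ℕ × ℕ) :=
      Primrec.pair (Primrec.const 0) (Primrec.succ.comp t)
    have at' : ∀ c : ℕ, Primrec fun p : ℕ × (ℕ × ℕ) × Bool => ((c, p.2.1.2) : ℕ × ℕ) := fun c =>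
      Primrec.pair (Primrec.const c) t
    exact Primrec.ite (eqc 0 m)
      (Primrec.ite (eqc 0 t)
        (Primrec.ite (eqb (Primrec.or.comp b (hL.comp (Primrec.pair n (Primrec.const 0)))))
          (Primrec.const (6, 0)) (Primrec.const (0, 1)))
        (Primrec.ite (eqb (Primrec.or.comp b (eqc 0 (hidx.comp t)).decide)) (at' 1) nextt))
      (Primrec.ite (eqc 1 m)
        (Primrec.ite (eqb (Primrec.or.comp b (hL.comp (Primrec.pair n t)))) (at' 2) nextt)
      (Primrec.ite (eqc 2 m) (Primrec.ite (eqb b) nextt (at' 3))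
      (Primrec.ite (eqc 3 m) (at' 4) (Primrec.ite (eqc 4 m) (at' 5)
      (Primrec.ite (eqc 5 m) nextt (at' 6))))))

end Tree
-- Soundness of the tree process
namespace Tree

variable {L : ℕ → ℕ → Bool} {n : ℕ}

theorem child_inj {p k p' k' : ℕ} : child p k = child p' k' ↔ p = p' ∧ k = k' := by
  simp [child, Nat.pair_eq_pair, and_comm]

theorem two_child_inj {p k p' k' : ℕ} :
    2 * child p k + 1 = 2 * child p' k' + 1 ↔ p = p' ∧ k = k' := by
  rw [← child_inj]
  omega

/-- The invariant of the process. -/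
structure Inv (L : ℕ → Bool) (c : (ℕ × ℕ) × (ℕ → Bool)) : Prop where
  recorded : ∀ p k, c.2 (2 * child p k + 1) = true →
    Dies L (child p k) ∧ ∀ k' < k, c.2 (2 * child p k' + 1) = true
  dead : ∀ p, c.2 (2 * p) = true → Dies L p ∨ c.1.1 = 4 ∧ ∃ k, c.1.2 = child p k
  visit : 1 ≤ c.1.1 → c.1.1 ≤ 5 → ∃ p k, c.1.2 = child p k ∧
    (∀ k' < k, c.2 (2 * child p k' + 1) = true) ∧ (2 ≤ c.1.1 → Dies L (child p k)) ∧
    (3 ≤ c.1.1 → c.2 (2 * child p k + 1) = false) ∧ (c.1.1 = 4 → c.2 (2 * p) = true)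
  halt : c.1.1 = 6 → Dies L 0

theorem step_of_quiet {c : (ℕ × ℕ) × (ℕ → Bool)} (h3 : c.1.1 ≠ 3) (h4 : c.1.1 ≠ 4)
    (h5 : c.1.1 ≠ 5) : ((proc L).step n c).2 = c.2 := by
  simp [RAM.step, proc, h3, h4, h5]

theorem step_three {t : ℕ} {X : ℕ → Bool} :
    (proc L).step n ((3, t), X) = ((4, t), Function.update X (2 * par t) true) := by
  simp [RAM.step, proc]

theorem step_four {t : ℕ} {X : ℕ → Bool} :
    (proc L).step n ((4, t), X) = ((5, t), Function.update X (2 * par t) false) := by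
  simp [RAM.step, proc]

theorem step_five {t : ℕ} {X : ℕ → Bool} :
    (proc L).step n ((5, t), X) = ((0, t + 1), Function.update X (2 * t + 1) true) := by
  simp [RAM.step, proc]

theorem step_two {t : ℕ} {X : ℕ → Bool} :
    (proc L).step n ((2, t), X) = (if X (2 * t + 1) = true then (0, t + 1) else (3, t), X) := by
  simp [RAM.step, proc]

theorem step_one {t : ℕ} {X : ℕ → Bool} :
    (proc L).step n ((1, t), X) =
      (if (X (2 * t) || L n t) = true then (2, t) else (0, t + 1), X) := by
  simp [RAM.step, proc]

theorem step_root {X : ℕ → Bool} :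
    (proc L).step n ((0, 0), X) = (if (X 0 || L n 0) = true then (6, 0) else (0, 1), X) := by
  simp [RAM.step, proc]

theorem step_child {p k : ℕ} {X : ℕ → Bool} :
    (proc L).step n ((0, child p k), X) =
      (if (X (2 * child p (k - 1) + 1) || decide (k = 0)) = true then (1, child p k)
        else (0, child p k + 1), X) := by
  simp [RAM.step, proc, child_ne_zero]

theorem step_big {m t : ℕ} {X : ℕ → Bool} (hm : 6 ≤ m) :
    (proc L).step n ((m, t), X) = ((6, t), X) := by
  have : m ≠ 0 ∧ m ≠ 1 ∧ m ≠ 2 ∧ m ≠ 3 ∧ m ≠ 4 ∧ m ≠ 5 := by omega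
  simp [RAM.step, proc, this]

theorem exists_child {t : ℕ} (h : t ≠ 0) : ∃ p k, t = child p k :=
  ⟨_, _, (child_par_idx h).symm⟩

theorem Inv.same_memory {L : ℕ → Bool} {c : (ℕ × ℕ) × (ℕ → Bool)} (h : Inv L c) {a : ℕ × ℕ}
    (h4 : c.1.1 ≠ 4)
    (hv : 1 ≤ a.1 → a.1 ≤ 5 → ∃ p k, a.2 = child p k ∧
      (∀ k' < k, c.2 (2 * child p k' + 1) = true) ∧ (2 ≤ a.1 → Dies L (child p k)) ∧
      (3 ≤ a.1 → c.2 (2 * child p k + 1) = false) ∧ (a.1 = 4 → c.2 (2 * p) = true))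
    (hh : a.1 = 6 → Dies L 0) : Inv L (a, c.2) :=
  ⟨h.recorded, fun p hp => Or.inl ((h.dead p hp).resolve_right fun h => h4 h.1), hv, hh⟩

/-- A bit `2 * p` that is set without `p` being dead can only be a flash in progress, and mode `4`
removes it at once. Records are made in order because mode `0` lets a child pass only when its older
sibling has been recorded, which by the invariant covers all older ones. -/
theorem Inv.step {c : (ℕ × ℕ) × (ℕ → Bool)} (h : Inv (L n) c) (hm6 : c.1.1 ≤ 6) :
    Inv (L n) ((proc L).step n c) ∧ ((proc L).step n c).1.1 ≤ 6 := by
  obtain ⟨⟨m, t⟩, X⟩ := c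
  have hd : ∀ p, m ≠ 4 → X (2 * p) = true → Dies (L n) p := fun p h4 hp =>
    (h.dead p hp).resolve_right fun h => h4 h.1
  dsimp only at hm6
  interval_cases m
  · rcases eq_or_ne t 0 with rfl | ht
    · rw [step_root]
      split_ifs with hX
      · refine ⟨h.same_memory (by simp) (by simp) fun _ => ?_, by simp⟩
        rcases Bool.or_eq_true_iff.1 hX with h1 | h1
        · exact hd 0 (by simp) h1
        · exact Dies.leaf h1
      · exact ⟨h.same_memory (by simp) (by simp) (by simp), by simp⟩
    · obtain ⟨p, k, rfl⟩ := exists_child ht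
      rw [step_child]
      split_ifs with hX
      · refine ⟨h.same_memory (by simp) (fun _ _ => ⟨p, k, rfl, fun k' hk' => ?_, by simp, by simp,
          by simp⟩) (by simp), by simp⟩
        rcases Bool.or_eq_true_iff.1 hX with h1 | h1
        · rcases Nat.lt_succ_iff_lt_or_eq.1 (show k' < (k - 1) + 1 by omega) with h2 | rfl
          · exact (h.recorded p _ h1).2 k' h2
          · exact h1
        · simp at h1
          omega
      · exact ⟨h.same_memory (by simp) (by simp) (by simp), by simp⟩
  · obtain ⟨p, k, rfl : t = _, h1, -⟩ := h.visit (by simp) (by simp)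
    rw [step_one]
    split_ifs with hX
    · refine ⟨h.same_memory (by simp) (fun _ _ => ⟨p, k, rfl, h1, fun _ => ?_, by simp,
          by simp⟩) (by simp), by simp⟩
      rcases Bool.or_eq_true_iff.1 hX with h2 | h2
      · exact hd _ (by simp) h2
      · exact Dies.leaf h2
    · exact ⟨h.same_memory (by simp) (by simp) (by simp), by simp⟩
  · obtain ⟨p, k, rfl : t = _, h1, h2, -⟩ := h.visit (by simp) (by simp)
    rw [step_two]
    split_ifs with hX
    · exact ⟨h.same_memory (by simp) (by simp) (by simp), by simp⟩
    · exact ⟨h.same_memory (by simp) (fun _ _ => ⟨p, k, rfl, h1, fun _ => h2 (by simp),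
        fun _ => by simpa using hX, by simp⟩) (by simp), by simp⟩
  · obtain ⟨p, k, rfl : t = _, h1, h2, h3, -⟩ := h.visit (by simp) (by simp)
    rw [step_three, par_child]
    have hne : ∀ i, Function.update X (2 * p) true (2 * i + 1) = X (2 * i + 1) := fun i =>
      Function.update_of_ne (by omega) _ _
    refine ⟨⟨fun p' k' h4 => ?_, fun p' h4 => ?_, fun _ _ => ⟨p, k, rfl, ?_, fun _ => h2 (by simp),
      ?_, by simp⟩, by simp⟩, by simp⟩
    · simp only [hne] at h4 ⊢
      exact h.recorded p' k' h4
    · by_cases hp : p' = p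
      · subst hp
        exact Or.inr ⟨rfl, k, rfl⟩
      · simp only at h4
        rw [Function.update_of_ne (by omega)] at h4
        exact Or.inl (hd p' (by simp) h4)
    · simpa only [hne] using h1
    · simpa only [hne] using fun _ => h3 (by simp)
  · obtain ⟨p, k, rfl : t = _, h1, h2, h3, -⟩ := h.visit (by simp) (by simp)
    rw [step_four, par_child]
    have hne : ∀ i, Function.update X (2 * p) false (2 * i + 1) = X (2 * i + 1) := fun i =>
      Function.update_of_ne (by omega) _ _
    refine ⟨⟨fun p' k' h4 => ?_, fun p' h4 => ?_, fun _ _ => ⟨p, k, rfl, ?_, fun _ => h2 (by simp),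
      ?_, by simp⟩, by simp⟩, by simp⟩
    · simp only [hne] at h4 ⊢
      exact h.recorded p' k' h4
    · by_cases hp : p' = p
      · subst hp
        simp at h4
      · simp only at h4
        rw [Function.update_of_ne (by omega)] at h4
        refine Or.inl ((h.dead p' h4).resolve_right ?_)
        rintro ⟨-, k', h5⟩
        exact hp (child_inj.1 h5).1.symm
    · simpa only [hne] using h1
    · simpa only [hne] using fun _ => h3 (by simp)
  · obtain ⟨p, k, rfl : t = _, h1, h2, h3, -⟩ := h.visit (by simp) (by simp)
    rw [step_five]
    have hne : ∀ i, Function.update X (2 * child p k + 1) true (2 * i) = X (2 * i) := fun i =>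
      Function.update_of_ne (by omega) _ _
    have hle : ∀ i, X i = true → Function.update X (2 * child p k + 1) true i = true := by
      intro i hi
      rw [Function.update_apply]
      split_ifs <;> simp [hi]
    refine ⟨⟨fun p' k' h4 => ?_, fun p' h4 => ?_, by simp, by simp⟩, by simp⟩
    · by_cases hp : p' = p ∧ k' = k
      · obtain ⟨rfl, rfl⟩ := hp
        exact ⟨h2 (by simp), fun k'' hk'' => hle _ (h1 k'' hk'')⟩
      · simp only at h4
        rw [Function.update_of_ne (by rwa [Ne, two_child_inj])] at h4
        exact ⟨(h.recorded p' k' h4).1, fun k'' hk'' => hle _ ((h.recorded p' k' h4).2 k'' hk'')⟩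
    · simp only [hne] at h4
      exact Or.inl (hd p' (by simp) h4)
  · rw [step_big le_rfl]
    exact ⟨h.same_memory (by simp) (by simp) (fun _ => h.halt rfl), by simp⟩

theorem record_step (c : (ℕ × ℕ) × (ℕ → Bool)) (t : ℕ) (h : c.2 (2 * t + 1) = true) :
    ((proc L).step n c).2 (2 * t + 1) = true := by
  obtain ⟨⟨m, s⟩, X⟩ := c
  by_cases h3 : m = 3
  · subst h3
    rw [step_three]
    simpa [Function.update_of_ne (show 2 * t + 1 ≠ 2 * par s by omega)] using h
  by_cases h4 : m = 4
  · subst h4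
    rw [step_four]
    simpa [Function.update_of_ne (show 2 * t + 1 ≠ 2 * par s by omega)] using h
  by_cases h5 : m = 5
  · subst h5
    rw [step_five]
    simp only [Function.update_apply]
    split_ifs
    · rfl
    · exact h
  rw [step_of_quiet h3 h4 h5]
  exact h

/-- No step clears a bit with an odd number, and the limsup of a bit that is one from some stage on
is one. -/
theorem record_mono {t : ℕ} {a b : Ordinal.{0}} (hab : a ≤ b)
    (h : ((proc L).run n a).2 (2 * t + 1) = true) : ((proc L).run n b).2 (2 * t + 1) = true := by
  induction b using Ordinal.limitRecOn with
  | zero =>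
    obtain rfl : a = 0 := by simpa using hab
    exact h
  | add_one b ih =>
    rcases hab.eq_or_lt with rfl | hlt
    · exact h
    · rw [RAM.run_add_one]
      exact record_step _ _ (ih (Order.lt_add_one_iff.1 hlt))
  | limit b hb ih =>
    rcases hab.eq_or_lt with rfl | hlt
    · exact h
    · rw [RAM.run_limit_snd _ _ hb]
      exact fun d hd => ⟨max a d, max_lt hlt hd, le_max_right _ _,
        ih _ (max_lt hlt hd) (le_max_left _ _)⟩

/-- A flash in front of a record is followed by the record. -/
theorem record_of_flash {a : Ordinal.{0}} {t : ℕ} (h : ((proc L).run n a).1 = (4, t)) :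
    ((proc L).run n (a + 1 + 1)).2 (2 * t + 1) = true := by
  rw [RAM.run_add_one, RAM.run_add_one]
  have : (proc L).run n a = ((4, t), ((proc L).run n a).2) := Prod.ext h rfl
  rw [this, step_four, step_five]
  simp

theorem inv_run (a : Ordinal.{0}) :
    Inv (L n) ((proc L).run n a) ∧ ((proc L).run n a).1.1 ≤ 6 := by
  induction a using Ordinal.limitRecOn with
  | zero =>
    rw [RAM.run_zero]
    exact ⟨⟨by simp, by simp, by simp [proc], by simp [proc]⟩, by simp [proc]⟩
  | add_one a ih =>
    rw [RAM.run_add_one]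
    exact ih.1.step ih.2
  | limit o ho ih =>
    have hs : ((proc L).run n o).1 = (0, 0) := RAM.run_limit_fst _ _ ho
    have hrec : ∀ t, ((proc L).run n o).2 (2 * t + 1) = true →
        ∃ b < o, ((proc L).run n b).2 (2 * t + 1) = true := by
      intro t ht
      rw [RAM.run_limit_snd _ _ ho] at ht
      obtain ⟨d, hd, -, h⟩ := ht 0 ho.bot_lt
      exact ⟨d, hd, h⟩
    refine ⟨⟨fun p k h => ?_, fun p h => Or.inl ?_, by simp [hs], by simp [hs]⟩, by simp [hs]⟩
    · obtain ⟨b, hb, h1⟩ := hrec _ h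
      exact ⟨((ih b hb).1.recorded p k h1).1, fun k' hk' =>
        record_mono hb.le (((ih b hb).1.recorded p k h1).2 k' hk')⟩
    -- Suppose `p` is not dead, and let `K` be its least child not recorded before `o`. Beyond a
    -- stage where all children below `K` are recorded, any one of the bit `2 * p` is a flash for
    -- some child `k`. For `k < K` that child has already been recorded, for `k = K` the record
    -- would follow two steps later, and for `k > K` child `K` would have been recorded before. So
    -- the bit is eventually zero.
    · by_contra hnd
      obtain ⟨k₁, hk₁⟩ : ∃ k, ∀ b < o, ((proc L).run n b).2 (2 * child p k + 1) = false := by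
        by_contra! hall
        refine hnd (Dies.node fun k => ?_)
        obtain ⟨b, hb, h1⟩ := hall k
        exact ((ih b hb).1.recorded p k (by simpa using h1)).1
      classical
      have hex : ∃ k, ∀ b < o, ((proc L).run n b).2 (2 * child p k + 1) = false := ⟨k₁, hk₁⟩
      set K := Nat.find hex with hK
      have hKs := Nat.find_spec hex
      have hlow : ∀ j ≤ K, ∃ b < o, ∀ k < j, ((proc L).run n b).2 (2 * child p k + 1) = true := by
        intro j
        induction j with
        | zero => exact fun _ => ⟨0, ho.bot_lt, fun k hk => absurd hk (by omega)⟩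
        | succ j ihj =>
          intro hj
          obtain ⟨b, hb, h1⟩ := ihj (by omega)
          have h2 := Nat.find_min hex (m := j) (by omega)
          push Not at h2
          obtain ⟨d, hd, h3⟩ := h2
          refine ⟨max b d, max_lt hb hd, fun k hk => ?_⟩
          rcases Nat.lt_succ_iff_lt_or_eq.1 hk with h | rfl
          · exact record_mono (le_max_left _ _) (h1 k h)
          · exact record_mono (le_max_right _ _) (by simpa using h3)
      obtain ⟨b, hb, hbK⟩ := hlow K le_rfl
      rw [RAM.run_limit_snd _ _ ho] at h
      obtain ⟨d, hd, hbd, h1⟩ := h b hb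
      rcases (ih d hd).1.dead p h1 with h2 | ⟨h2, k, h3⟩
      · exact hnd h2
      · obtain ⟨p', k', h4, h5, -, h6, -⟩ := (ih d hd).1.visit (by omega) (by omega)
        obtain ⟨rfl, rfl⟩ := child_inj.1 (h3.symm.trans h4)
        have h7 := h6 (by omega)
        rcases lt_trichotomy k K with hk | hk | hk
        · rw [record_mono hbd (hbK k hk)] at h7
          exact absurd h7 (by simp)
        · have h8 := record_of_flash (a := d) (t := child p k) (Prod.ext h2 h3)
          rw [hk, hKs _ (ho.add_one_lt (ho.add_one_lt hd))] at h8
          exact absurd h8 (by simp)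
        · have := h5 K hk
          rw [hKs d hd] at this
          exact absurd this (by simp)

end Tree
-- Completeness of the tree process
namespace Tree

variable {L : ℕ → ℕ → Bool} {n : ℕ}

theorem eq_flash_of_record {c : (ℕ × ℕ) × (ℕ → Bool)} {t : ℕ} (h : c.2 (2 * t + 1) = false)
    (h' : ((proc L).step n c).2 (2 * t + 1) = true) : c.1 = (5, t) := by
  obtain ⟨⟨m, s⟩, X⟩ := c
  by_cases h3 : m = 3
  · subst h3
    rw [step_three] at h'
    simp only [Function.update_of_ne (show 2 * t + 1 ≠ 2 * par s by omega)] at h' h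
    simp [h] at h'
  by_cases h4 : m = 4
  · subst h4
    rw [step_four] at h'
    simp only [Function.update_of_ne (show 2 * t + 1 ≠ 2 * par s by omega)] at h' h
    simp [h] at h'
  by_cases h5 : m = 5
  · subst h5
    rw [step_five] at h'
    simp only [Function.update_apply] at h' h
    split_ifs at h' with hts
    · obtain rfl : t = s := by omega
      rfl
    · simp [h] at h'
  rw [step_of_quiet h3 h4 h5] at h'
  exact absurd (h.symm.trans h') (by simp)

theorem fst_of_step_eq_five {c : (ℕ × ℕ) × (ℕ → Bool)} {t : ℕ}
    (h : ((proc L).step n c).1 = (5, t)) : c.1 = (4, t) := by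
  obtain ⟨⟨m, s⟩, X⟩ := c
  simp only [RAM.step, proc] at h
  split_ifs at h <;> simp_all

/-- All record bits start at zero and are set only in mode `5`. This mode is entered only from mode
`4`, since stage `0` and limits are in mode `0`. -/
theorem exists_flash_of_record {d : Ordinal.{0}} {t : ℕ}
    (h : ((proc L).run n d).2 (2 * t + 1) = true) : ∃ e < d, ((proc L).run n e).1 = (4, t) := by
  induction d using Ordinal.limitRecOn with
  | zero => simp [RAM.run_zero] at h
  | add_one d ih =>
    by_cases hd : ((proc L).run n d).2 (2 * t + 1) = true
    · obtain ⟨e, he, h1⟩ := ih hd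
      exact ⟨e, he.trans (Order.lt_add_one_iff.2 le_rfl), h1⟩
    · rw [RAM.run_add_one] at h
      have h5 := eq_flash_of_record (by simpa using hd) h
      rcases Ordinal.zero_or_succ_or_isSuccLimit d with rfl | ⟨e, he⟩ | hl
      · rw [RAM.run_zero] at h5
        simp [proc] at h5
      · rw [Order.succ_eq_add_one] at he
        subst he
        rw [RAM.run_add_one] at h5
        have hlt : ∀ a : Ordinal.{0}, a < a + 1 := fun a => Order.lt_add_one_iff.2 le_rfl
        exact ⟨e, (hlt e).trans (hlt _), fst_of_step_eq_five h5⟩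
      · rw [RAM.run_limit_fst _ _ hl] at h5
        simp [proc] at h5
  | limit o ho ih =>
    rw [RAM.run_limit_snd _ _ ho] at h
    obtain ⟨d, hd, -, h1⟩ := h 0 ho.bot_lt
    obtain ⟨e, he, h2⟩ := ih d hd h1
    exact ⟨e, he.trans hd, h2⟩

/-- A node whose children are all recorded has its first bit set from some stage on. -/
theorem dead_mono {p : ℕ} {a b : Ordinal.{0}} (hab : a ≤ b)
    (hM : ∀ k, ((proc L).run n a).2 (2 * child p k + 1) = true)
    (hD : ((proc L).run n a).2 (2 * p) = true) : ((proc L).run n b).2 (2 * p) = true := by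
  induction b using Ordinal.limitRecOn with
  | zero =>
    obtain rfl : a = 0 := by simpa using hab
    exact hD
  | add_one b ih =>
    rcases hab.eq_or_lt with rfl | hlt
    · exact hD
    · have hab' := Order.lt_add_one_iff.1 hlt
      have h1 := ih hab'
      by_contra hne
      -- Only the end of a flash of `p` could clear its bit. But a flash announces a child of `p`
      -- that has not been recorded, and by `hM` there is none.
      have hc : ((proc L).run n b).1.1 = 4 ∧ par ((proc L).run n b).1.2 = p := by
        rw [RAM.run_add_one] at hne
        generalize (proc L).run n b = c at *
        obtain ⟨⟨m, s⟩, X⟩ := c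
        by_cases h3 : m = 3
        · subst h3
          rw [step_three] at hne
          simp only [Function.update_apply] at hne
          split_ifs at hne <;> simp_all
        by_cases h4 : m = 4
        · subst h4
          rw [step_four] at hne
          simp only [Function.update_apply] at hne
          split_ifs at hne with h5
          · exact ⟨rfl, by dsimp only; omega⟩
          · exact absurd h1 hne
        by_cases h5 : m = 5
        · subst h5
          rw [step_five] at hne
          simp only [Function.update_of_ne (show 2 * p ≠ 2 * s + 1 by omega)] at hne
          exact absurd h1 hne
        rw [step_of_quiet h3 h4 h5] at hne
        exact absurd h1 hne
      obtain ⟨p', k, h2, -, -, h3, -⟩ := (inv_run (L := L) (n := n) b).1.visit (by omega) (by omega)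
      rw [h2, par_child] at hc
      have h4 := h3 (by omega)
      rw [hc.2, record_mono hab' (hM k)] at h4
      exact absurd h4 (by simp)
  | limit b hb ih =>
    rcases hab.eq_or_lt with rfl | hlt
    · exact hD
    · rw [RAM.run_limit_snd _ _ hb]
      exact fun d hd => ⟨max a d, max_lt hlt hd, le_max_right _ _,
        ih _ (max_lt hlt hd) (le_max_left _ _)⟩

/-- Let `o` be the first stage at which all children are recorded. It is not a successor, since one
step records at most one child, while before `o` infinitely many are missing because records are
made in order. So `o` is a limit. The records before it come with flashes cofinal in `o`, hence the
bit is one at `o`, and by `dead_mono` it stays. -/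
theorem dead_of_recorded {p : ℕ} {a b : Ordinal.{0}} (hab : a ≤ b)
    (hM : ∀ k, ((proc L).run n a).2 (2 * child p k + 1) = true) :
    ((proc L).run n b).2 (2 * p) = true := by
  obtain ⟨o, hoM, hmin⟩ := WellFounded.has_min Ordinal.lt_wf
    {o | ∀ k, ((proc L).run n o).2 (2 * child p k + 1) = true} ⟨a, hM⟩
  have hoa : o ≤ a := not_lt.1 (hmin a hM)
  refine dead_mono (hoa.trans hab) hoM ?_
  have hex : ∀ d < o, ∃ k, ((proc L).run n d).2 (2 * child p k + 1) = false := by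
    intro d hd
    by_contra! h
    exact hmin d (fun k => by simpa using h k) hd
  have hup : ∀ d k, ((proc L).run n d).2 (2 * child p k + 1) = false →
      ((proc L).run n d).2 (2 * child p (k + 1) + 1) = false := by
    intro d k h
    by_contra h'
    rw [((inv_run (L := L) (n := n) d).1.recorded p (k + 1) (by simpa using h')).2 k (by omega)] at h
    exact absurd h (by simp)
  rcases Ordinal.zero_or_succ_or_isSuccLimit o with rfl | ⟨d, hd⟩ | hl
  · have := hoM 0
    simp [RAM.run_zero] at this
  · rw [Order.succ_eq_add_one] at hd
    subst hd
    obtain ⟨k, hk⟩ := hex d (Order.lt_add_one_iff.2 le_rfl)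
    have h1 := hoM k
    have h2 := hoM (k + 1)
    rw [RAM.run_add_one] at h1 h2
    have h3 := (eq_flash_of_record hk h1).symm.trans (eq_flash_of_record (hup d k hk) h2)
    have h4 := (child_inj.1 (congrArg Prod.snd h3)).2
    omega
  · rw [RAM.run_limit_snd _ _ hl]
    intro b hb
    obtain ⟨k, hk⟩ := hex b hb
    have h1 := hoM (k + 1)
    obtain ⟨e, he, h2⟩ := exists_flash_of_record h1
    obtain ⟨p', k', h3, h4, -, -, h5⟩ := (inv_run (L := L) (n := n) e).1.visit (by rw [h2]; simp)
      (by rw [h2]; simp)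
    rw [h2] at h3
    obtain ⟨rfl, rfl⟩ := child_inj.1 h3
    refine ⟨e, he, ?_, h5 (by rw [h2])⟩
    by_contra! hlt
    rw [record_mono hlt.le (h4 k (by omega))] at hk
    exact absurd hk (by simp)

/-- The process gets from one node to the next, and records the node on the way if its older sibling
has been recorded and it is dead. -/
theorem exists_next {a : Ordinal.{0}} {p k : ℕ} (h : ((proc L).run n a).1 = (0, child p k)) :
    ∃ j : ℕ, ((proc L).run n (a + j)).1 = (0, child p k + 1) ∧
      ((k = 0 ∨ ((proc L).run n a).2 (2 * child p (k - 1) + 1) = true) →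
        (L n (child p k) = true ∨ ((proc L).run n (a + 1)).2 (2 * child p k) = true) →
        ((proc L).run n (a + j)).2 (2 * child p k + 1) = true) := by
  have hrun : ∀ j : ℕ, (proc L).run n (a + j) = ((proc L).step n)^[j] ((proc L).run n a) :=
    fun j => iterate_stage (fun a => RAM.run_add_one _ _ a) a j
  have h1' : (proc L).run n (a + 1) = (proc L).step n ((proc L).run n a) := RAM.run_add_one _ _ _
  simp only [hrun, h1']
  generalize (proc L).run n a = c at *
  obtain ⟨_, X⟩ := c
  obtain rfl : _ = _ := h
  by_cases h1 : (X (2 * child p (k - 1) + 1) || decide (k = 0)) = true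
  · have e1 : (proc L).step n ((0, child p k), X) = ((1, child p k), X) := by
      rw [step_child, if_pos h1]
    by_cases h2 : (X (2 * child p k) || L n (child p k)) = true
    · have e2 : (proc L).step n ((1, child p k), X) = ((2, child p k), X) := by
        rw [step_one, if_pos h2]
      by_cases h3 : X (2 * child p k + 1) = true
      · refine ⟨3, ?_⟩
        simp only [Function.iterate_succ_apply, Function.iterate_zero, id, e1, e2]
        rw [step_two, if_pos h3]
        exact ⟨rfl, fun _ _ => h3⟩
      · refine ⟨6, ?_⟩
        simp only [Function.iterate_succ_apply, Function.iterate_zero, id, e1, e2]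
        rw [step_two, if_neg h3, step_three, step_four, step_five]
        simp
    · refine ⟨2, ?_⟩
      simp only [Function.iterate_succ_apply, Function.iterate_zero, id, e1]
      rw [step_one, if_neg h2]
      refine ⟨rfl, fun _ h => absurd ?_ h2⟩
      rcases h with h | h <;> simp [h]
  · refine ⟨1, ?_⟩
    simp only [Function.iterate_succ_apply, Function.iterate_zero, id]
    rw [step_child, if_neg h1]
    refine ⟨rfl, fun h => absurd ?_ h1⟩
    rcases h with h | h <;> simp [h]

/-- The nodes are visited in increasing order within each block. As `child p k` increases with `k`,
the older sibling has been recorded by the time `child p k` is reached. Thus a single block records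
all children of `p`, if all of them are known to be dead. -/
theorem exists_scan (hnh : ∀ a, ((proc L).run n a).1.1 ≠ 6) {l : Ordinal.{0}} {p : ℕ}
    (hdead : ∀ k, ∀ d, ω * l ≤ d → L n (child p k) = true ∨
      ((proc L).run n d).2 (2 * child p k) = true) (t : ℕ) :
    ∃ j : ℕ, ((proc L).run n (ω * l + j)).1 = (0, t) ∧
      ∀ k, child p k < t → ((proc L).run n (ω * l + j)).2 (2 * child p k + 1) = true := by
  induction t with
  | zero => exact ⟨0, by
      rw [Nat.cast_zero, add_zero]
      exact RAM.run_start _ _ (omega0_mul_zero_or_limit l), by simp⟩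
  | succ t ih =>
    obtain ⟨j, h1, h2⟩ := ih
    rcases eq_or_ne t 0 with rfl | ht
    · refine ⟨j + 1, ?_, fun k hk => absurd (child_ne_zero p k) (by omega)⟩
      have h3 : (proc L).run n (ω * l + ((j + 1 : ℕ) : Ordinal.{0})) =
          (proc L).step n ((0, 0), ((proc L).run n (ω * l + j)).2) := by
        rw [← h1, ← RAM.run_add_one]
        push_cast
        rw [add_assoc]
      have h4 := hnh (ω * l + ((j + 1 : ℕ) : Ordinal.{0}))
      rw [h3, step_root] at h4 ⊢
      split_ifs at h4 ⊢ with h5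
      · simp at h4
      · rfl
    · obtain ⟨p', k', rfl⟩ := exists_child ht
      obtain ⟨i, h3, h4⟩ := exists_next h1
      refine ⟨j + i, ?_, fun k hk => ?_⟩
      · push_cast
        rw [← add_assoc]
        exact h3
      · push_cast
        rw [← add_assoc]
        rcases Nat.lt_succ_iff_lt_or_eq.1 hk with h5 | h5
        · exact record_mono le_self_add (h2 k h5)
        · obtain ⟨rfl, rfl⟩ := child_inj.1 h5
          refine h4 ?_ (hdead k _ ?_)
          · rcases Nat.eq_zero_or_pos k with hk0 | hk0
            · exact Or.inl hk0
            · exact Or.inr (h2 _ (child_lt_child (by omega)))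
          · rw [add_assoc]
            exact le_self_add

/-- Induction on the derivation of `Dies`. If the children are known to be dead from the stages `b
k` on, then they are all known from `ω * ⨆ k, b k` on, and one more block of length `ω` records them
all. -/
theorem exists_dead (hnh : ∀ a, ((proc L).run n a).1.1 ≠ 6) {t : ℕ} (h : Dies (L n) t) :
    ∃ b : Ordinal.{0}, ∀ d, b ≤ d → L n t = true ∨ ((proc L).run n d).2 (2 * t) = true := by
  induction h with
  | leaf h => exact ⟨0, fun _ _ => Or.inl h⟩
  | @node p _ ih =>
    choose b hb using ih
    have hle : ∀ k, b k ≤ ω * ⨆ k, b k := fun k =>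
      (Ordinal.le_iSup b k).trans (Ordinal.le_mul_right _ omega0_pos)
    refine ⟨ω * ((⨆ k, b k) + 1), fun d hd => Or.inr (dead_of_recorded hd fun k => ?_)⟩
    obtain ⟨j, -, h2⟩ := exists_scan hnh (l := ⨆ k, b k)
      (fun k d hd => hb k d ((hle k).trans hd)) (child p k + 1)
    exact record_mono (omega0_mul_add_nat_lt (Order.lt_add_one_iff.2 le_rfl) j).le (h2 k (by omega))

/-- The process stops if and only if the tree is well-founded. -/
theorem stops_iff : (∃ a, (proc L).signal n ((proc L).run n a).1 = 1) ↔ Dies (L n) 0 := by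
  have hs : ∀ c, (proc L).signal n c = 1 ↔ c.1 = 6 := by
    intro c
    simp [proc]
  simp only [hs]
  constructor
  · rintro ⟨a, ha⟩
    exact (inv_run a).1.halt ha
  · intro h
    by_contra! hnh
    obtain ⟨b, hb⟩ := exists_dead hnh h
    -- At the beginning of block `b` the process examines the root, which is known to be dead, so it
    -- stops in the next step.
    refine hnh (ω * b + 1) ?_
    have h1 := RAM.run_start (proc L) n (omega0_mul_zero_or_limit b)
    have h2 : (proc L).run n (ω * b + 1) =
        (proc L).step n ((0, 0), ((proc L).run n (ω * b)).2) := by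
      rw [RAM.run_add_one]
      congr 1
      exact Prod.ext h1 rfl
    rw [h2, step_root, if_pos]
    rcases hb (ω * b) (Ordinal.le_mul_right _ omega0_pos) with h | h
    · simp [h]
    · simp only [mul_zero] at h
      simp [h]

end Tree
-- `Π¹₁` sets and well-founded trees
namespace Tree

/-- The node of the first `j` values of `α`. -/
def node (α : ℕ → ℕ) (j : ℕ) : ℕ := Encodable.encode ((List.range j).map α).reverse

theorem node_zero (α : ℕ → ℕ) : node α 0 = 0 := rfl

/-- `child` is the code of `List.cons`, which is why `node` reverses the list: the newest value
comes first. -/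
theorem node_succ (α : ℕ → ℕ) (j : ℕ) : node α (j + 1) = child (node α j) (α j) := by
  simp [node, List.range_succ, child, Encodable.encode_list_cons]

/-- With `|l| = ⟨m, i⟩`, the first `m` entries of the sequence at the node `l` satisfy the
predicate with code `c` within `i` steps. -/
def leaf (c : Nat.Partrec.Code) (n t : ℕ) : Bool :=
  let l := Denumerable.ofNat (List ℕ) t
  (Nat.Partrec.Code.evaln l.length.unpair.2 c
    (Encodable.encode (n, l.reverse.take l.length.unpair.1))).isSome

theorem primrec_leaf (c : Nat.Partrec.Code) : Primrec fun p : ℕ × ℕ => leaf c p.1 p.2 := by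
  have hl : Primrec fun p : ℕ × ℕ => Denumerable.ofNat (List ℕ) p.2 :=
    (Primrec.ofNat (List ℕ)).comp Primrec.snd
  have hu := Primrec.unpair.comp (Primrec.list_length.comp hl)
  have ht : Primrec fun p : ℕ × ℕ => ((Denumerable.ofNat (List ℕ) p.2).reverse.take
      (Denumerable.ofNat (List ℕ) p.2).length.unpair.1) :=
    Primrec.list_take.comp (Primrec.fst.comp hu) (Primrec.list_reverse.comp hl)
  exact Primrec.option_isSome.comp (Nat.Partrec.Code.primrec_evaln.comp (Primrec.pair (Primrec.pair
    (Primrec.snd.comp hu) (Primrec.const c)) (Primrec.encode.comp (Primrec.pair Primrec.fst ht))))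

theorem leaf_node {c : Nat.Partrec.Code} {n : ℕ} {α : ℕ → ℕ} {j : ℕ} : leaf c n (node α j) =
    (Nat.Partrec.Code.evaln j.unpair.2 c
      (Encodable.encode (n, (List.range j.unpair.1).map α))).isSome := by
  have h1 : Denumerable.ofNat (List ℕ) (node α j) = ((List.range j).map α).reverse :=
    Denumerable.ofNat_encode _
  have h2 : ((List.range j).map α).take j.unpair.1 = (List.range j.unpair.1).map α := by
    rw [← List.map_take, List.take_range, min_eq_left (Nat.unpair_left_le j)]
  simp only [leaf, h1, List.reverse_reverse, List.length_reverse, List.length_map,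
    List.length_range, h2]

/-- From left to right by induction on `Dies`, following `α` down the tree. Conversely, a node that
does not die is no leaf and has a child that does not die; choosing such children repeatedly yields
a path without leaves. -/
theorem dies_iff {L : ℕ → Bool} : Dies L 0 ↔ ∀ α : ℕ → ℕ, ∃ j, L (node α j) = true := by
  constructor
  · intro h α
    have : ∀ t, Dies L t → ∀ j, t = node α j → ∃ j, L (node α j) = true := by
      intro t ht
      induction ht with
      | leaf h => rintro j rfl; exact ⟨j, h⟩
      | node _ ih =>
        rintro j rfl
        exact ih (α j) (j + 1) (node_succ α j).symm
    exact this 0 h 0 (node_zero α).symm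
  · intro h
    by_contra h0
    have hstep : ∀ t, ∃ k, ¬ Dies L t → ¬ Dies L (child t k) := by
      intro t
      by_cases ht : Dies L t
      · exact ⟨0, fun h => absurd ht h⟩
      · by_contra! hall
        exact ht (Dies.node fun k => (hall k).2)
    choose f hf using hstep
    let s : ℕ → ℕ := fun j => Nat.rec 0 (fun _ t => child t (f t)) j
    have hs : ∀ j, ¬ Dies L (s j) := by
      intro j
      induction j with
      | zero => exact h0
      | succ j ih => exact hf _ ih
    have hn : ∀ j, node (fun i => f (s i)) j = s j := by
      intro j
      induction j with
      | zero => rfl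
      | succ j ih => rw [node_succ, ih]
    obtain ⟨j, hj⟩ := h fun i => f (s i)
    rw [hn] at hj
    exact hs j (Dies.leaf hj)

end Tree

theorem exists_code_of_rePred {α : Type} [Primcodable α] {p : α → Prop} (h : REPred p) :
    ∃ c : Nat.Partrec.Code, ∀ a, p a ↔ ∃ k, (c.evaln k (Encodable.encode a)).isSome = true := by
  obtain ⟨c, hc⟩ := Nat.Partrec.Code.exists_code.1 h
  refine ⟨c, fun a => ?_⟩
  have h1 : p a ↔ (c.eval (Encodable.encode a)).Dom := by
    rw [hc]
    simp [Part.assert]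
  rw [h1, Part.dom_iff_mem]
  constructor
  · rintro ⟨y, hy⟩
    obtain ⟨k, hk⟩ := Nat.Partrec.Code.evaln_complete.1 hy
    exact ⟨k, by rw [Option.mem_def.1 hk]; rfl⟩
  · rintro ⟨k, hk⟩
    obtain ⟨y, hy⟩ := Option.isSome_iff_exists.1 hk
    exact ⟨y, Nat.Partrec.Code.evaln_sound hy⟩

/-- A path lies in `P` if and only if some initial segment of length `m` is accepted within some
number `k` of steps, and then its node at depth `Nat.pair m k` is a leaf. Since `m ≤ Nat.pair m k`,
that node contains the initial segment. The leaves are primitive recursive, so `Tree.proc` applies.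
-/
theorem pi11_subset_sD : Pi11 ⊆ sD := by
  rintro A ⟨P, ⟨W, hW, hP⟩, hA⟩
  obtain ⟨c, hc⟩ := exists_code_of_rePred hW
  have h := (Tree.isPrimrec_proc (Tree.primrec_leaf c)).mem_sD (fun n a => by
    simp only [Tree.proc]
    split_ifs <;> simp)
  convert h using 1
  ext n
  rw [Set.mem_ofPred_eq, Tree.stops_iff, Tree.dies_iff, hA]
  refine forall_congr' fun α => ?_
  rw [hP]
  simp only [Tree.leaf_node]
  constructor
  · rintro ⟨m, hm⟩
    obtain ⟨k, hk⟩ := (hc _).1 hm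
    exact ⟨Nat.pair m k, by simpa using hk⟩
  · rintro ⟨j, hj⟩
    exact ⟨_, (hc _).2 ⟨_, hj⟩⟩

/-! ### Emulation of a machine by a process -/

namespace Emulate

variable {k : ℕ}

/-- The control states of the emulation of a machine: preliminaries, and the six reading and
writing operations that make up a step. -/
abbrev Ctl (k : ℕ) : Type := Fin 3 ⊕ (State k × Fin 6 × (Fin 3 → Bool))

/-- The effect of a step of the machine, where `0`, `1` and `2` in the last component stand for no
move, a move to the right and a move to the left. -/
def effect (M : ITTM k) (q : State k) (s : Fin 3 → Bool) : State k × (Fin 3 → Bool) × Fin 4 :=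
  match q with
  | none => (none, s, 0)
  | some q => let r := M.trans q s; (r.1, r.2.1, if r.2.2 then 1 else 2)

/-- The movement of the head; `3` sends it to the left end. -/
def shift (d : Fin 4) (h : ℕ) : ℕ :=
  if d = 0 then h else if d = 1 then h + 1 else if d = 2 then h - 1 else 0

/-- The transition table of the emulation. -/
def table (M : ITTM k) : Ctl k × Bool → Ctl k × Fin 4
  | (Sum.inl 0, b) => (if b then Sum.inl 1 else Sum.inl 2, 3)
  | (Sum.inl 1, b) => (Sum.inr (if b then some none else some (some M.start), 0, fun _ => false), 3)
  | (Sum.inl 2, _) => (Sum.inl 2, 1)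
  | (Sum.inr (q, 0, s), b) => (Sum.inr (q, 1, Function.update s 0 b), 0)
  | (Sum.inr (q, 1, s), b) => (Sum.inr (q, 2, Function.update s 1 b), 0)
  | (Sum.inr (q, 2, s), b) => (Sum.inr (q, 3, Function.update s 2 b), 0)
  | (Sum.inr (q, 3, s), _) => (Sum.inr (q, 4, s), 0)
  | (Sum.inr (q, 4, s), _) => (Sum.inr (q, 5, s), 0)
  | (Sum.inr (q, 5, s), _) => (Sum.inr ((effect M q s).1, 0, s), (effect M q s).2.2)

/-- The bit that is written. -/
def written (M : ITTM k) : Ctl k × Bool → Bool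
  | (Sum.inl _, _) => true
  | (Sum.inr (q, 3, s), _) => (effect M q s).2.1 0
  | (Sum.inr (q, 4, s), _) => (effect M q s).2.1 1
  | (Sum.inr (q, 5, s), _) => (effect M q s).2.1 2
  | (_, b) => b

/-- The position of the cell that is visited: its number, relative to the head if the
first component is true. -/
def place : Ctl k → Bool × ℕ
  | Sum.inl 0 => (false, 0)
  | Sum.inl 1 => (false, 1)
  | Sum.inl 2 => (true, 0)
  | Sum.inr (_, j, _) => (true, j % 3)

/-- The halting control states. -/
def halted : Ctl k → ℕ
  | Sum.inr (none, _, _) => 1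
  | _ => 0

/-- Emulation of `M` on the input `code c`, where `c` is the parameter. Cell `v` of tape `i` is bit
`2 + 3 * v + i` of the memory. In the first `ω` steps the input is written; bits `0` and `1` are
used to distinguish the stages `0` and `ω` from the other limits. -/
def proc (M : ITTM k) : RAM (Ctl k × ℕ) where
  start := (Sum.inl 0, 0)
  signal _ a := halted a.1
  addr _ a := if (place a.1).1 = true then 2 + 3 * a.2 + (place a.1).2 else (place a.1).2
  bit c a b := if a.1 = Sum.inl 2 then decide (a.2 < c) else written M (a.1, b)
  next _ a b := ((table M (a.1, b)).1, shift (table M (a.1, b)).2 a.2)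

theorem isPrimrec_proc (M : ITTM k) : (proc M).IsPrimrec := by
  have hshift : Primrec₂ shift := by
    have d : Primrec fun p : Fin 4 × ℕ => p.1 := Primrec.fst
    have h : Primrec fun p : Fin 4 × ℕ => p.2 := Primrec.snd
    exact Primrec.ite (Primrec.eq.comp d (Primrec.const 0)) h
      (Primrec.ite (Primrec.eq.comp d (Primrec.const 1)) (Primrec.succ.comp h)
      (Primrec.ite (Primrec.eq.comp d (Primrec.const 2)) (Primrec.pred.comp h) (Primrec.const 0)))
  constructor
  · exact (Primrec.dom_finite (halted (k := k))).comp (Primrec.fst.comp Primrec.snd)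
  · have hp : Primrec fun p : ℕ × Ctl k × ℕ => place p.2.1 :=
      (Primrec.dom_finite (place (k := k))).comp (Primrec.fst.comp Primrec.snd)
    exact Primrec.ite (Primrec.eq.comp (Primrec.fst.comp hp) (Primrec.const true))
      (Primrec.nat_add.comp (Primrec.nat_add.comp (Primrec.const 2) (Primrec.nat_mul.comp
        (Primrec.const 3) (Primrec.snd.comp Primrec.snd))) (Primrec.snd.comp hp))
      (Primrec.snd.comp hp)
  · have hc : Primrec fun p : ℕ × (Ctl k × ℕ) × Bool => p.2.1.1 :=
      Primrec.fst.comp (Primrec.fst.comp Primrec.snd)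
    have hh : Primrec fun p : ℕ × (Ctl k × ℕ) × Bool => p.2.1.2 :=
      Primrec.snd.comp (Primrec.fst.comp Primrec.snd)
    exact Primrec.ite (Primrec.eq.comp hc (Primrec.const (Sum.inl 2)))
      (Primrec.nat_lt.comp hh Primrec.fst).decide
      ((Primrec.dom_finite (written M)).comp (Primrec.pair hc (Primrec.snd.comp Primrec.snd)))
  · have hc : Primrec fun p : ℕ × (Ctl k × ℕ) × Bool => p.2.1.1 :=
      Primrec.fst.comp (Primrec.fst.comp Primrec.snd)
    have hh : Primrec fun p : ℕ × (Ctl k × ℕ) × Bool => p.2.1.2 :=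
      Primrec.snd.comp (Primrec.fst.comp Primrec.snd)
    have ht : Primrec fun p : ℕ × (Ctl k × ℕ) × Bool => table M (p.2.1.1, p.2.2) :=
      (Primrec.dom_finite (table M)).comp (Primrec.pair hc (Primrec.snd.comp Primrec.snd))
    exact Primrec.pair (Primrec.fst.comp ht) (hshift.comp (Primrec.snd.comp ht) hh)

variable {M : ITTM k} {c : ℕ}

theorem step_entry (h : ℕ) (X : ℕ → Bool) : (proc M).step c ((Sum.inl 0, h), X) =
    ((if X 0 then Sum.inl 1 else Sum.inl 2, 0), Function.update X 0 true) := by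
  simp [RAM.step, proc, place, table, written, shift]

theorem step_flag (h : ℕ) (X : ℕ → Bool) : (proc M).step c ((Sum.inl 1, h), X) =
    ((Sum.inr (if X 1 then some none else some (some M.start), 0, fun _ => false), 0),
      Function.update X 1 true) := by
  simp [RAM.step, proc, place, table, written, shift]

theorem step_setup (h : ℕ) (X : ℕ → Bool) : (proc M).step c ((Sum.inl 2, h), X) =
    ((Sum.inl 2, h + 1), Function.update X (2 + 3 * h) (decide (h < c))) := by
  simp [RAM.step, proc, place, table, shift]

/-- The memory during the setup phase. -/
theorem run_setup (j : ℕ) : ((proc M).run c ((j + 1 : ℕ) : Ordinal.{0})).1 = (Sum.inl 2, j) ∧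
    ((proc M).run c ((j + 1 : ℕ) : Ordinal.{0})).2 0 = true ∧
    ((proc M).run c ((j + 1 : ℕ) : Ordinal.{0})).2 1 = false ∧
    ∀ v i, i < 3 → ((proc M).run c ((j + 1 : ℕ) : Ordinal.{0})).2 (2 + 3 * v + i) =
      decide (i = 0 ∧ v < j ∧ v < c) := by
  induction j with
  | zero =>
    have h : (proc M).run c (((0 : ℕ) + 1 : ℕ) : Ordinal.{0}) =
        ((Sum.inl 2, 0), Function.update (fun _ => false) 0 true) := by
      rw [Nat.cast_add, Nat.cast_one, RAM.run_add_one, Nat.cast_zero, RAM.run_zero]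
      exact step_entry _ _
    rw [h]
    refine ⟨rfl, by simp, by simp, fun v i _ => ?_⟩
    simp only [Function.update_of_ne (show 2 + 3 * v + i ≠ 0 by omega)]
    simp
  | succ j ih =>
    obtain ⟨h1, h2, h3, h4⟩ := ih
    have h : (proc M).run c ((j + 1 + 1 : ℕ) : Ordinal.{0}) = ((Sum.inl 2, j + 1), Function.update
        ((proc M).run c ((j + 1 : ℕ) : Ordinal.{0})).2 (2 + 3 * j) (decide (j < c))) := by
      rw [Nat.cast_add (j + 1), Nat.cast_one, RAM.run_add_one, ← step_setup, ← h1]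
    rw [h]
    refine ⟨rfl, ?_, ?_, fun v i hi => ?_⟩
    · simp only [Function.update_of_ne (show 0 ≠ 2 + 3 * j by omega), h2]
    · simp only [Function.update_of_ne (show 1 ≠ 2 + 3 * j by omega), h3]
    · simp only
      by_cases hv : 2 + 3 * v + i = 2 + 3 * j
      · obtain ⟨rfl, rfl⟩ : v = j ∧ i = 0 := by omega
        simp
      · rw [Function.update_of_ne hv, h4 v i hi]
        congr 1
        apply propext
        omega

/-- The observed bits of the emulation: the flags and the tapes. -/
def obsProc (f : (Ctl k × ℕ) × (ℕ → Bool)) : Bool ⊕ Fin 3 × ℕ → Bool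
  | Sum.inl b => f.2 b.toNat
  | Sum.inr (i, v) => f.2 (2 + 3 * v + i)

/-- The observed bits of the emulated machine. -/
def obsCfg (f : Cfg k) : Bool ⊕ Fin 3 × ℕ → Bool
  | Sum.inl _ => true
  | Sum.inr (i, v) => f.tape i v

/-- In the setup phase every memory bit is constant from some finite stage on, so at stage `ω` the
whole input is present, with flag `0` set and flag `1` clear. Two more steps set flag `1` and enter
the start state. -/
theorem run_omega (M : ITTM k) (c : ℕ) :
    ∃ s, ((proc M).run c (ω + 2)).1 = (Sum.inr (some (some M.start), 0, s), 0) ∧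
    ∀ p, obsProc ((proc M).run c (ω + 2)) p = obsCfg (M.init (code c)) p := by
  have hlim : IsSuccLimit (ω : Ordinal.{0}) := isSuccLimit_omega0
  have hev : ∀ (i j : ℕ) (b : Bool), (∀ j', j ≤ j' →
      ((proc M).run c ((j' + 1 : ℕ) : Ordinal.{0})).2 i = b) → ((proc M).run c ω).2 i = b := by
    intro i j b h
    refine Bool.eq_iff_iff.2 ((RAM.run_limit_snd _ _ hlim i).trans (limSup_of_eventually
      (c := ((j + 1 : ℕ) : Ordinal.{0})) (natCast_lt_omega0 _) fun d hd hd' => ?_))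
    obtain ⟨m, rfl⟩ := lt_omega0.1 hd'
    have hm : j + 1 ≤ m := by exact_mod_cast hd
    obtain ⟨m, rfl⟩ := Nat.exists_eq_succ_of_ne_zero (show m ≠ 0 by omega)
    exact h m (by omega)
  have h0 := hev 0 0 true fun j _ => (run_setup j).2.1
  have h1 := hev 1 0 false fun j _ => (run_setup j).2.2.1
  have h2 : ∀ v i, i < 3 → ((proc M).run c ω).2 (2 + 3 * v + i) = decide (i = 0 ∧ v < c) :=
    fun v i hi => hev _ (v + 1) _ fun j hj => by
      rw [(run_setup j).2.2.2 v i hi]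
      congr 1
      apply propext
      omega
  have e : (proc M).run c (ω + 2) = ((Sum.inr (some (some M.start), 0, fun _ => false), 0),
      Function.update (Function.update ((proc M).run c ω).2 0 true) 1 true) := by
    have h3 : (proc M).run c ω = ((Sum.inl 0, 0), ((proc M).run c ω).2) :=
      Prod.ext (RAM.run_limit_fst _ _ hlim) rfl
    rw [← one_add_one_eq_two, ← add_assoc, RAM.run_add_one, RAM.run_add_one, h3, step_entry, h0]
    simp only [if_true]
    rw [step_flag]
    simp [h1]
  rw [e]
  refine ⟨_, rfl, ?_⟩
  rintro (b | ⟨i, v⟩)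
  · cases b <;> simp [obsProc, obsCfg]
  · have hi := i.2
    simp only [obsProc, obsCfg, ITTM.init]
    rw [Function.update_of_ne (by omega), Function.update_of_ne (by omega), h2 v i hi]
    by_cases h : i = 0
    · simp [h, code]
    · have : (i : ℕ) ≠ 0 := fun h' => h (Fin.ext h')
      simp [h, this]

theorem state_step (f : Cfg k) :
    (M.step f).state = (effect M f.state fun i => f.tape i f.head).1 := by
  obtain ⟨q, h, T⟩ := f
  cases q <;> rfl

theorem head_step (f : Cfg k) :
    (M.step f).head = shift (effect M f.state fun i => f.tape i f.head).2.2 f.head := by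
  obtain ⟨q, h, T⟩ := f
  rcases q with _ | q
  · rfl
  · simp only [ITTM.step, effect, shift]
    split_ifs <;> simp_all

theorem tape_step (f : Cfg k) (i : Fin 3) (v : ℕ) : (M.step f).tape i v =
    if v = f.head then (effect M f.state fun i => f.tape i f.head).2.1 i else f.tape i v := by
  obtain ⟨q, h, T⟩ := f
  rcases q with _ | q
  · simp only [ITTM.step, effect]
    split_ifs with hv
    · rw [hv]
    · rfl
  · simp only [ITTM.step, effect, Function.update_apply]

theorem step_micro (q : State k) (j : Fin 6) (s : Fin 3 → Bool) (h : ℕ) (X : ℕ → Bool) :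
    (proc M).step c ((Sum.inr (q, j, s), h), X) =
      (((table M (Sum.inr (q, j, s), X (2 + 3 * h + j % 3))).1,
        shift (table M (Sum.inr (q, j, s), X (2 + 3 * h + j % 3))).2 h),
      Function.update X (2 + 3 * h + j % 3)
        (written M (Sum.inr (q, j, s), X (2 + 3 * h + j % 3)))) := by
  simp [RAM.step, proc, place]

end Emulate
namespace Emulate

variable {k : ℕ} {M : ITTM k} {c : ℕ}

theorem iterate_read (q : State k) (s : Fin 3 → Bool) (h : ℕ) (X : ℕ → Bool) :
    (∀ j ≤ 2, ∃ s' j', ((proc M).step c)^[j] ((Sum.inr (q, 0, s), h), X) =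
      ((Sum.inr (q, j', s'), h), X)) ∧
    ((proc M).step c)^[3] ((Sum.inr (q, 0, s), h), X) =
      ((Sum.inr (q, 3, fun i : Fin 3 => X (2 + 3 * h + i)), h), X) := by
  have e1 : ∀ s, (proc M).step c ((Sum.inr (q, 0, s), h), X) =
      ((Sum.inr (q, 1, Function.update s 0 (X (2 + 3 * h))), h), X) := fun s => by
    rw [step_micro]
    simp [table, written, shift]
  have e2 : ∀ s, (proc M).step c ((Sum.inr (q, 1, s), h), X) =
      ((Sum.inr (q, 2, Function.update s 1 (X (2 + 3 * h + 1))), h), X) := fun s => by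
    rw [step_micro]
    simp [table, written, shift]
  have e3 : ∀ s, (proc M).step c ((Sum.inr (q, 2, s), h), X) =
      ((Sum.inr (q, 3, Function.update s 2 (X (2 + 3 * h + 2))), h), X) := fun s => by
    rw [step_micro]
    simp [table, written, shift]
  refine ⟨fun j hj => ?_, ?_⟩
  · interval_cases j
    · exact ⟨_, _, rfl⟩
    · exact ⟨_, _, e1 s⟩
    · rw [Function.iterate_succ_apply, e1]
      exact ⟨_, _, e2 _⟩
  · rw [Function.iterate_succ_apply, e1, Function.iterate_succ_apply, e2,
      Function.iterate_succ_apply, e3, Function.iterate_zero, id]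
    congr 5
    funext i
    fin_cases i <;> simp

/-- After `j` steps the cells of the first `j` tapes have been rewritten. The tape to which the
memory cell `i` belongs is recovered as `(i - 2) % 3`. -/
theorem iterate_write (q : State k) (s : Fin 3 → Bool) (h : ℕ) (X : ℕ → Bool) :
    ∀ j ≤ 3, (∃ q' j' h', ((proc M).step c)^[j] ((Sum.inr (q, 3, s), h), X) =
      ((Sum.inr (q', j', s), h'), fun i => if ∃ t : Fin 3, (t : ℕ) < j ∧ i = 2 + 3 * h + t then
        (effect M q s).2.1 ⟨(i - 2) % 3, Nat.mod_lt _ (by omega)⟩ else X i) ∧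
      (j < 3 → q' = q) ∧
      (j = 3 → q' = (effect M q s).1 ∧ j' = 0 ∧ h' = shift (effect M q s).2.2 h)) := by
  have e1 : ∀ X, (proc M).step c ((Sum.inr (q, 3, s), h), X) =
      ((Sum.inr (q, 4, s), h), Function.update X (2 + 3 * h) ((effect M q s).2.1 0)) := fun s => by
    rw [step_micro]
    simp [table, written, shift]
  have e2 : ∀ X, (proc M).step c ((Sum.inr (q, 4, s), h), X) =
      ((Sum.inr (q, 5, s), h), Function.update X (2 + 3 * h + 1) ((effect M q s).2.1 1)) := fun s => by
    rw [step_micro]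
    simp [table, written, shift]
  have e3 : ∀ X, (proc M).step c ((Sum.inr (q, 5, s), h), X) =
      ((Sum.inr ((effect M q s).1, 0, s), shift (effect M q s).2.2 h),
        Function.update X (2 + 3 * h + 2) ((effect M q s).2.1 2)) := fun s => by
    rw [step_micro]
    simp [table, written]
  have m : ∀ t : Fin 3, ∀ i, i = 2 + 3 * h + t →
      (⟨(i - 2) % 3, Nat.mod_lt _ (by omega)⟩ : Fin 3) = t := by
    rintro t i rfl
    have := t.2
    exact Fin.ext (by simp only; omega)
  have hX : ∀ (Y : ℕ → Bool) (j : Fin 3), (Y = fun i => if ∃ t : Fin 3, (t : ℕ) < j ∧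
      i = 2 + 3 * h + t then (effect M q s).2.1 ⟨(i - 2) % 3, Nat.mod_lt _ (by omega)⟩ else X i) →
      Function.update Y (2 + 3 * h + j) ((effect M q s).2.1 j) = fun i =>
      if ∃ t : Fin 3, (t : ℕ) < j + 1 ∧ i = 2 + 3 * h + t then
        (effect M q s).2.1 ⟨(i - 2) % 3, Nat.mod_lt _ (by omega)⟩ else X i := by
    rintro Y j rfl
    funext i
    rw [Function.update_apply]
    by_cases hi : i = 2 + 3 * h + j
    · rw [if_pos hi, if_pos ⟨j, by omega, hi⟩, m j i hi]
    · rw [if_neg hi]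
      congr 1
      apply propext
      constructor
      · rintro ⟨t, h1, h2⟩
        exact ⟨t, by omega, h2⟩
      · rintro ⟨t, h1, h2⟩
        refine ⟨t, ?_, h2⟩
        by_contra h3
        have : (t : ℕ) = j := by omega
        rw [this] at h2
        exact hi h2
  have X0 : X = fun i => if ∃ t : Fin 3, (t : ℕ) < 0 ∧ i = 2 + 3 * h + t then
        (effect M q s).2.1 ⟨(i - 2) % 3, Nat.mod_lt _ (by omega)⟩ else X i := by
    funext i
    simp
  have X1 := hX X 0 X0
  have X2 := hX _ 1 X1
  have X3 := hX _ 2 X2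
  intro j hj
  interval_cases j
  · refine ⟨q, 3, h, ?_, by simp, by simp⟩
    rw [← X0]
    rfl
  · refine ⟨q, 4, h, ?_, by simp, by simp⟩
    rw [Function.iterate_succ_apply, e1, Function.iterate_zero, id]
    exact congrArg _ X1
  · refine ⟨q, 5, h, ?_, by simp, by simp⟩
    rw [Function.iterate_succ_apply, e1, Function.iterate_succ_apply, e2, Function.iterate_zero, id]
    exact congrArg _ X2
  · refine ⟨(effect M q s).1, 0, shift (effect M q s).2.2 h, ?_, by simp, by simp⟩
    rw [Function.iterate_succ_apply, e1, Function.iterate_succ_apply, e2,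
      Function.iterate_succ_apply, e3, Function.iterate_zero, id]
    exact congrArg _ X3

/-- The emulation is about to emulate a step from the snapshot `f`. -/
def Matches (f : Cfg k) (g : (Ctl k × ℕ) × (ℕ → Bool)) : Prop :=
  (∃ s, g.1 = (Sum.inr (f.state, 0, s), f.head)) ∧ ∀ p, obsProc g p = obsCfg f p

/-- The three reads leave the memory alone, and each of the three writes settles one cell of the
scanned column. So every observed bit goes directly from its old to its new value. -/
theorem Matches.step {f : Cfg k} {g : (Ctl k × ℕ) × (ℕ → Bool)} (h : Matches f g) :
    Matches (M.step f) (((proc M).step c)^[6] g) ∧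
    ∀ j ≤ 6, (j < 6 → ∃ j' s h', (((proc M).step c)^[j] g).1 = (Sum.inr (f.state, j', s), h')) ∧
      ∀ p, obsProc (((proc M).step c)^[j] g) p = obsCfg f p ∨
        obsProc (((proc M).step c)^[j] g) p = obsCfg (M.step f) p := by
  obtain ⟨g1, X⟩ := g
  obtain ⟨⟨s, rfl : g1 = _⟩, hobs⟩ := h
  have hr : (fun i : Fin 3 => X (2 + 3 * f.head + i)) = fun i => f.tape i f.head :=
    funext fun i => hobs (Sum.inr (i, f.head))
  obtain ⟨r1, r2⟩ := iterate_read (M := M) (c := c) f.state s f.head X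
  have w := iterate_write (M := M) (c := c) f.state (fun i : Fin 3 => X (2 + 3 * f.head + i)) f.head X
  have hsplit : ∀ j, ((proc M).step c)^[j + 3] ((Sum.inr (f.state, 0, s), f.head), X) =
      ((proc M).step c)^[j] ((Sum.inr (f.state, 3, fun i : Fin 3 => X (2 + 3 * f.head + i)), f.head), X) :=
    fun j => by rw [Function.iterate_add_apply, r2]
  have hw : ∀ j ≤ 3, ∀ p, (obsProc (((proc M).step c)^[j + 3]
      ((Sum.inr (f.state, 0, s), f.head), X)) p = obsCfg f p ∧ j < 3) ∨
      obsProc (((proc M).step c)^[j + 3] ((Sum.inr (f.state, 0, s), f.head), X)) p =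
        obsCfg (M.step f) p := by
    intro j hj p
    obtain ⟨q', j', h', h1, -⟩ := w j hj
    rw [hsplit, h1]
    rcases p with b | ⟨i, v⟩
    · right
      have := hobs (Sum.inl b)
      simp only [obsProc, obsCfg] at this ⊢
      rw [if_neg, this]
      rintro ⟨t, -, ht⟩
      cases b <;> simp at ht <;> omega
    · have hi := i.2
      have := hobs (Sum.inr (i, v))
      simp only [obsProc, obsCfg] at this ⊢
      rw [tape_step, hr]
      by_cases hv : v = f.head
      · subst hv
        by_cases hij : (i : ℕ) < j
        · right
          rw [if_pos ⟨i, hij, rfl⟩, if_pos rfl]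
          refine congrArg _ (Fin.ext ?_)
          change (2 + 3 * f.head + i - 2) % 3 = i
          omega
        · left
          rw [if_neg, this]
          · exact ⟨rfl, by omega⟩
          · rintro ⟨t, h2, h3⟩
            omega
      · right
        rw [if_neg, if_neg hv, this]
        rintro ⟨t, h2, h3⟩
        have := t.2
        omega
  refine ⟨⟨?_, fun p => ?_⟩, fun j hj => ?_⟩
  · obtain ⟨q', j', h', h1, -, h2⟩ := w 3 le_rfl
    obtain ⟨rfl, rfl, rfl⟩ := h2 rfl
    refine ⟨fun i : Fin 3 => X (2 + 3 * f.head + i), ?_⟩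
    rw [hsplit 3, h1, state_step, head_step, hr]
  · rcases hw 3 le_rfl p with h | h
    · exact absurd h.2 (by omega)
    · exact h
  · rcases Nat.lt_or_ge j 3 with h3 | h3
    · obtain ⟨s', j', h1⟩ := r1 j (by omega)
      rw [h1]
      exact ⟨fun _ => ⟨_, _, _, rfl⟩, fun p => Or.inl (hobs p)⟩
    · obtain ⟨i, rfl⟩ := Nat.exists_eq_add_of_le' h3
      refine ⟨fun hi => ?_, fun p => (hw i (by omega) p).imp And.left id⟩
      obtain ⟨q', j', h', h1, h2, -⟩ := w i (by omega)
      rw [hsplit, h1, h2 (by omega)]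
      exact ⟨_, _, _, rfl⟩

theorem halted_inr (q : State k) (j : Fin 6) (s : Fin 3 → Bool) :
    halted (Sum.inr (q, j, s)) ≠ 0 ↔ q = none := by
  cases q <;> simp [halted]

theorem obsCfg_limit (x : ℕ → Bool) {o : Ordinal.{0}} (ho : IsSuccLimit o) (p : Bool ⊕ Fin 3 × ℕ) :
    obsCfg (M.run x o) p = true ↔ LimSup o fun d => obsCfg (M.run x d) p := by
  rcases p with b | ⟨i, v⟩
  · exact (limSup_of_eventually ho.bot_lt fun _ _ _ => rfl).symm
  · exact M.tape_limit x ho i v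

/-- The emulation follows the machine. -/
theorem exists_follows_run (M : ITTM k) (c : ℕ) (l : Ordinal.{0}) : ∃ s,
    Follows (M.run (code c)) (fun a => (proc M).run c (ω + 2 + a)) Matches
      (fun g => (∀ a, (M.run (code c) a).state ≠ none) → halted g.1.1 = 0) (fun _ => True)
      obsCfg obsProc l s := by
  have hlim : ∀ o : Ordinal.{0}, IsSuccLimit o → ∀ p, obsProc ((proc M).run c (ω + 2 + o)) p = true ↔
      LimSup o fun d => obsProc ((proc M).run c (ω + 2 + d)) p := by
    intro o ho p
    rcases p with b | ⟨i, v⟩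
    · exact (RAM.run_limit_snd _ _ (isSuccLimit_add _ ho) _).trans
        (limSup_add ho.bot_lt fun d => ((proc M).run c d).2 b.toNat)
    · exact (RAM.run_limit_snd _ _ (isSuccLimit_add _ ho) _).trans
        (limSup_add ho.bot_lt fun d => ((proc M).run c d).2 (2 + 3 * v + i))
  obtain ⟨s₀, hs₀, hobs₀⟩ := run_omega M c
  refine exists_follows (stepF := (proc M).step c) (fun f g h => h.2)
    (fun a => by rw [← add_assoc, RAM.run_add_one]) (fun o ho p => obsCfg_limit _ ho p) hlim ?_ ?_
    ?_ l fun _ _ => trivial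
  · intro p
    rw [add_zero, M.run_zero]
    exact hobs₀ p
  · rintro o (rfl | ho) hobs
    · have h0 : halted ((proc M).run c (ω + 2 + 0)).1.1 = 0 := by
        rw [add_zero, hs₀]
        rfl
      -- At `o = 0` no preparation is needed, because stage `ω + 2` is already in the start state of
      -- `M`.
      refine ⟨0, ⟨⟨s₀, ?_⟩, hobs⟩, fun j hj => ?_⟩
      · rw [M.run_zero, add_zero]
        exact hs₀
      · obtain rfl : j = 0 := by omega
        exact ⟨fun _ => h0, hobs⟩
    · have h1 : ((proc M).run c (ω + 2 + o)).1 = (Sum.inl 0, 0) :=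
        RAM.run_limit_fst _ _ (isSuccLimit_add _ ho)
      have h2 : (M.run (code c) o).state = some none ∧ (M.run (code c) o).head = 0 := by
        rw [M.run_limit _ ho]
        exact ⟨rfl, rfl⟩
      have h3 := hobs (Sum.inl false)
      have h4 := hobs (Sum.inl true)
      generalize (proc M).run c (ω + 2 + o) = g at *
      obtain ⟨g1, X⟩ := g
      obtain rfl : g1 = _ := h1
      have h3 : X 0 = true := h3
      have h4 : X 1 = true := h4
      have hX0 : Function.update X 0 true = X := by rw [← h3, Function.update_eq_self]
      have hX1 : Function.update X 1 true = X := by rw [← h4, Function.update_eq_self]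
      have e1 : (proc M).step c ((Sum.inl 0, 0), X) = ((Sum.inl 1, 0), X) := by
        rw [step_entry, h3, hX0]
        rfl
      have e2 : (proc M).step c ((Sum.inl 1, 0), X) =
          ((Sum.inr (some none, 0, fun _ => false), 0), X) := by
        rw [step_flag, h4, hX1]
        rfl
      have e3 : ((proc M).step c)^[2] ((Sum.inl 0, 0), X) =
          ((Sum.inr (some none, 0, fun _ => false), 0), X) := by
        rw [Function.iterate_succ_apply, e1, Function.iterate_succ_apply, e2]
        rfl
      -- At later limits both flags are set. Two steps check them, without altering anything, and
      -- lead to the Limit state of `M`.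
      refine ⟨2, ?_, fun j hj => ?_⟩
      · rw [e3]
        exact ⟨⟨fun _ => false, by rw [h2.1, h2.2]⟩, hobs⟩
      · interval_cases j
        · exact ⟨fun _ => rfl, hobs⟩
        · rw [Function.iterate_one, e1]
          exact ⟨fun _ => rfl, hobs⟩
        · rw [e3]
          exact ⟨fun _ => rfl, hobs⟩
  · intro a g _ hg
    obtain ⟨h1, h2⟩ := hg.step (M := M) (c := c)
    rw [← M.run_add_one] at h1 h2
    refine ⟨6, by omega, h1, fun j hj => ⟨fun hne => ?_, (h2 j hj).2⟩⟩
    rcases hj.lt_or_eq with hj | rfl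
    · obtain ⟨j', s, h', h3⟩ := (h2 j hj.le).1 hj
      rw [h3]
      by_contra h4
      exact hne a ((halted_inr _ _ _).1 h4)
    · obtain ⟨⟨s, h3⟩, -⟩ := h1
      rw [h3]
      by_contra h4
      exact hne _ ((halted_inr _ _ _).1 h4)

/-- The emulation also follows `M` past a halt, so no liveness is required. If `M` never halts, then
`ok` excludes halting control states from stage `ω + 2` on. If it halts, the matching stage has the
Halt state. -/
theorem stops_iff (M : ITTM k) (c : ℕ) : (∃ a, (proc M).signal c ((proc M).run c a).1 ≠ 0) ↔
    ∃ y, M.Outputs (code c) y := by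
  constructor
  · rintro ⟨a, ha⟩
    by_contra hno
    have hne : ∀ a, (M.run (code c) a).state ≠ none := by
      intro a ha
      obtain ⟨b, hb, hmin⟩ := WellFounded.has_min Ordinal.lt_wf
        {a | (M.run (code c) a).state = none} ⟨a, ha⟩
      exact hno ⟨_, b, ⟨hb, fun d hd h => hmin d h hd⟩, rfl⟩
    -- The stages before `ω + 2` belong to the setup and the flag test, and their control states are
    -- not halting.
    rcases lt_or_ge a (ω + 2) with h | h
    · have h0 : halted ((proc M).run c a).1.1 = 0 := by
        rcases lt_or_ge a ω with h1 | h1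
        · obtain ⟨m, rfl⟩ := lt_omega0.1 h1
          cases m with
          | zero => rw [Nat.cast_zero, RAM.run_zero]; rfl
          | succ m => rw [(run_setup m).1]; rfl
        · have h2 : ((proc M).run c ω).1 = (Sum.inl 0, 0) := RAM.run_limit_fst _ _ isSuccLimit_omega0
          rcases h1.eq_or_lt with rfl | h1
          · rw [h2]; rfl
          · obtain rfl : a = ω + 1 := by
              refine le_antisymm (Order.lt_add_one_iff.1 ?_) (Order.add_one_le_of_lt h1)
              rwa [add_assoc, one_add_one_eq_two]
            rw [RAM.run_add_one]
            have : (proc M).run c ω = ((Sum.inl 0, 0), ((proc M).run c ω).2) := Prod.ext h2 rfl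
            rw [this, step_entry]
            split_ifs <;> rfl
      exact ha h0
    · rw [← Ordinal.add_sub_cancel_of_le h] at ha
      obtain ⟨l, j, hlj⟩ := exists_eq_omega0_mul_add (a - (ω + 2))
      rw [hlj] at ha
      obtain ⟨s, hs⟩ := exists_follows_run M c l
      exact ha (hs.ok_of_le j (fun _ _ => trivial) (hs.1.id_le j) hne)
  · rintro ⟨y, a, ⟨ha, -⟩, -⟩
    obtain ⟨l, t, rfl⟩ := exists_eq_omega0_mul_add a
    obtain ⟨s, hs⟩ := exists_follows_run M c l
    obtain ⟨⟨s', h1⟩, -⟩ := hs.rel t fun _ _ => trivial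
    refine ⟨ω + 2 + (ω * l + s t), ?_⟩
    have : halted ((proc M).run c (ω + 2 + (ω * l + s t))).1.1 ≠ 0 := by
      rw [h1]
      exact (halted_inr _ _ _).2 ha
    exact this

end Emulate
-- Running infinitely many computations in parallel
namespace RAM

variable {A : Type}

/-- Replace the entry number `m` of a list that is continued by `s`. -/
def replace (s : A) (l : List A) (m : ℕ) (a : A) : List A :=
  (List.range (max l.length (m + 1))).map fun j => if j = m then a else l.getD j s

theorem getD_replace (s : A) (l : List A) (m : ℕ) (a : A) (j : ℕ) :
    (replace s l m a).getD j s = if j = m then a else l.getD j s := by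
  by_cases hj : j < max l.length (m + 1)
  · simp [replace, List.getD_eq_getElem?_getD, hj]
  · have h1 : l.length ≤ j := le_trans (le_max_left _ _) (not_lt.1 hj)
    have h2 : j ≠ m := by
      have := le_trans (le_max_right l.length (m + 1)) (not_lt.1 hj)
      omega
    rw [List.getD_eq_default _ _ (by simpa [replace] using not_lt.1 hj), if_neg h2,
      List.getD_eq_default _ _ h1]

theorem primrec_replace [Primcodable A] (s : A) :
    Primrec fun p : List A × ℕ × A => replace s p.1 p.2.1 p.2.2 := by
  have l : Primrec fun p : List A × ℕ × A => p.1 := Primrec.fst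
  have m : Primrec fun p : List A × ℕ × A => p.2.1 := Primrec.fst.comp Primrec.snd
  have a : Primrec fun p : List A × ℕ × A => p.2.2 := Primrec.snd.comp Primrec.snd
  refine Primrec.list_map (Primrec.list_range.comp (Primrec.nat_max.comp (Primrec.list_length.comp l)
    (Primrec.succ.comp m))) ?_
  exact Primrec.ite (Primrec.eq.comp Primrec.snd (m.comp Primrec.fst)) (a.comp Primrec.fst)
    ((Primrec.list_getD s).comp (l.comp Primrec.fst) Primrec.snd)

/-- Run the process `P` with the parameters `h n 0, h n 1, …` in parallel, until one of these
computations stops. Cell `v` of computation `m` is cell `Nat.pair m v` of the memory. The control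
state consists of a clock and the control states of the computations. -/
def dovetail (P : RAM A) (h : ℕ → ℕ → ℕ) : RAM (ℕ × List A) where
  start := (0, [])
  signal n p := if P.signal (h n p.1.unpair.1) (p.2.getD p.1.unpair.1 P.start) = 0 then 0
    else p.1.unpair.1 + 2
  addr n p := Nat.pair p.1.unpair.1 (P.addr (h n p.1.unpair.1) (p.2.getD p.1.unpair.1 P.start))
  bit n p b := P.bit (h n p.1.unpair.1) (p.2.getD p.1.unpair.1 P.start) b
  next n p b := (p.1 + 1, replace P.start p.2 p.1.unpair.1
    (P.next (h n p.1.unpair.1) (p.2.getD p.1.unpair.1 P.start) b))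

theorem IsPrimrec.dovetail [Primcodable A] {P : RAM A} (hP : P.IsPrimrec) {h : ℕ → ℕ → ℕ}
    (hh : Primrec₂ h) : (P.dovetail h).IsPrimrec := by
  have hm : Primrec fun p : ℕ × ℕ × List A => p.2.1.unpair.1 :=
    Primrec.fst.comp (Primrec.unpair.comp (Primrec.fst.comp Primrec.snd))
  have hc : Primrec fun p : ℕ × ℕ × List A => h p.1 p.2.1.unpair.1 := hh.comp Primrec.fst hm
  have hr : Primrec fun p : ℕ × ℕ × List A => p.2.2.getD p.2.1.unpair.1 P.start :=
    (Primrec.list_getD P.start).comp (Primrec.snd.comp Primrec.snd) hm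
  have hl : Primrec fun p : ℕ × (ℕ × List A) × Bool => (p.1, p.2.1) :=
    Primrec.pair Primrec.fst (Primrec.fst.comp Primrec.snd)
  have hb : Primrec fun p : ℕ × (ℕ × List A) × Bool => p.2.2 := Primrec.snd.comp Primrec.snd
  constructor
  · exact Primrec.ite (Primrec.eq.comp (hP.signal.comp (Primrec.pair hc hr)) (Primrec.const 0))
      (Primrec.const 0) (Primrec.succ.comp (Primrec.succ.comp hm))
  · exact Primrec₂.natPair.comp hm (hP.addr.comp (Primrec.pair hc hr))
  · exact hP.bit.comp (Primrec.pair (hc.comp hl) (Primrec.pair (hr.comp hl) hb))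
  · exact Primrec.pair (Primrec.succ.comp (Primrec.fst.comp (Primrec.snd.comp hl)))
      ((primrec_replace P.start).comp (Primrec.pair (Primrec.snd.comp (Primrec.snd.comp hl))
      (Primrec.pair (hm.comp hl) (hP.next.comp (Primrec.pair (hc.comp hl)
        (Primrec.pair (hr.comp hl) hb))))))

variable {P : RAM A} {h : ℕ → ℕ → ℕ} {n m : ℕ}

/-- The snapshot `x` of computation `m` is part of the snapshot `f`. -/
def Part (P : RAM A) (m : ℕ) (x : A × (ℕ → Bool)) (f : (ℕ × List A) × (ℕ → Bool)) : Prop :=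
  f.1.2.getD m P.start = x.1 ∧ ∀ v, f.2 (Nat.pair m v) = x.2 v

theorem dovetail_step_fst (f : (ℕ × List A) × (ℕ → Bool)) :
    ((P.dovetail h).step n f).1.1 = f.1.1 + 1 := rfl

theorem dovetail_iterate_fst (f : (ℕ × List A) × (ℕ → Bool)) (j : ℕ) :
    (((P.dovetail h).step n)^[j] f).1.1 = f.1.1 + j := by
  induction j with
  | zero => rfl
  | succ j ih => rw [Function.iterate_succ_apply', dovetail_step_fst, ih, add_assoc]

theorem Part.step_of_ne {x : A × (ℕ → Bool)} {f : (ℕ × List A) × (ℕ → Bool)} (H : P.Part m x f)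
    (hm : f.1.1.unpair.1 ≠ m) : P.Part m x ((P.dovetail h).step n f) := by
  refine ⟨?_, fun v => ?_⟩
  · rw [← H.1]
    simp only [RAM.step, dovetail]
    rw [getD_replace, if_neg (Ne.symm hm)]
  · rw [← H.2 v]
    simp only [RAM.step, dovetail]
    rw [Function.update_of_ne]
    exact fun h => hm (Nat.pair_eq_pair.1 h).1.symm

theorem Part.step_of_eq {x : A × (ℕ → Bool)} {f : (ℕ × List A) × (ℕ → Bool)} (H : P.Part m x f)
    (hm : f.1.1.unpair.1 = m) : P.Part m (P.step (h n m) x) ((P.dovetail h).step n f) := by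
  have h2 : f.2 (Nat.pair m (P.addr (h n m) x.1)) = x.2 (P.addr (h n m) x.1) := H.2 _
  refine ⟨?_, fun v => ?_⟩
  · simp only [RAM.step, dovetail]
    rw [hm, getD_replace, if_pos rfl, H.1, h2]
  · simp only [RAM.step, dovetail]
    rw [hm, H.1, h2, Function.update_apply, Function.update_apply, H.2]
    simp

/-- The turn of computation `m` comes at clock times `Nat.pair m u`, and `Nat.pair m u ≥ u`, so
there is one after any given time. Until then the other computations do not touch its part. -/
theorem Part.wait {x : A × (ℕ → Bool)} {f : (ℕ × List A) × (ℕ → Bool)} (H : P.Part m x f) :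
    ∃ N, (((P.dovetail h).step n)^[N] f).1.1.unpair.1 = m ∧
      ∀ j ≤ N, P.Part m x (((P.dovetail h).step n)^[j] f) := by
  classical
  have hex : ∃ N, (f.1.1 + N).unpair.1 = m := by
    refine ⟨Nat.pair m f.1.1 - f.1.1, ?_⟩
    rw [Nat.add_sub_cancel' (Nat.right_le_pair m f.1.1), Nat.unpair_pair]
  refine ⟨Nat.find hex, by rw [dovetail_iterate_fst]; exact Nat.find_spec hex, fun j => ?_⟩
  induction j with
  | zero => exact fun _ => H
  | succ j ih =>
    intro hj
    rw [Function.iterate_succ_apply']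
    refine (ih (by omega)).step_of_ne ?_
    rw [dovetail_iterate_fst]
    exact Nat.find_min hex (by omega)

/-- Each computation gets infinitely many turns in a block, so its blocks match those of the whole.
A limit empties the list of control states, which amounts to `P.start` for every computation, as it
should at a limit. The other computations may have stopped; the process runs on regardless, and so
liveness is trivial. -/
theorem exists_follows_dovetail (P : RAM A) (h : ℕ → ℕ → ℕ) (n m : ℕ) (l : Ordinal.{0}) : ∃ s,
    Follows (P.run (h n m)) ((P.dovetail h).run n) (fun x f => f.1.1.unpair.1 = m ∧ P.Part m x f)
      (fun f => (∀ a, P.signal (h n m) (P.run (h n m) a).1 = 0) →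
        P.signal (h n m) (f.1.2.getD m P.start) = 0)
      (fun _ => True) (fun x => x.2) (fun f v => f.2 (Nat.pair m v)) l s := by
  have hok : ∀ a f, P.Part m (P.run (h n m) a) f →
      (∀ a, P.signal (h n m) (P.run (h n m) a).1 = 0) → P.signal (h n m) (f.1.2.getD m P.start) = 0 :=
    fun a f H hs => by rw [H.1]; exact hs a
  refine exists_follows (stepF := (P.dovetail h).step n) (live := fun _ => True)
    (R := fun x f => f.1.1.unpair.1 = m ∧ P.Part m x f) (fun x f H => H.2.2)
    (fun a => run_add_one _ _ _) (fun o ho v => run_limit_snd _ _ ho _)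
    (fun o ho v => run_limit_snd _ _ ho _) (fun v => ?_) (fun o ho hobs => ?_) (fun a f _ H => ?_) l
    fun _ _ => trivial
  · rw [run_zero, run_zero]
  · have H : P.Part m (P.run (h n m) o) ((P.dovetail h).run n o) := by
      refine ⟨?_, hobs⟩
      rw [run_start _ _ ho, run_start _ _ ho]
      rfl
    obtain ⟨N, h1, h2⟩ := H.wait (h := h) (n := n)
    exact ⟨N, ⟨h1, h2 N le_rfl⟩, fun j hj => ⟨hok o _ (h2 j hj), (h2 j hj).2⟩⟩
  · have H' : P.Part m (P.run (h n m) (a + 1)) ((P.dovetail h).step n f) := by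
      rw [run_add_one]
      exact H.2.step_of_eq H.1
    obtain ⟨N, h1, h2⟩ := H'.wait (h := h) (n := n)
    refine ⟨N + 1, by omega, ⟨h1, h2 N le_rfl⟩, fun j hj => ?_⟩
    cases j with
    | zero => exact ⟨hok a _ H.2, fun v => Or.inl (H.2.2 v)⟩
    | succ j => exact ⟨hok _ _ (h2 j (by omega)), fun v => Or.inr ((h2 j (by omega)).2 v)⟩

theorem dovetail_stops {a : Ordinal.{0}} (ha : P.signal (h n m) (P.run (h n m) a).1 ≠ 0) :
    ∃ b, (P.dovetail h).signal n ((P.dovetail h).run n b).1 ≠ 0 := by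
  obtain ⟨l, t, rfl⟩ := exists_eq_omega0_mul_add a
  obtain ⟨s, hs⟩ := exists_follows_dovetail P h n m l
  obtain ⟨h1, h2⟩ := hs.rel t fun _ _ => trivial
  refine ⟨ω * l + s t, ?_⟩
  simp only [dovetail] at h1 h2 ⊢
  rw [h1, h2.1, if_neg ha]
  omega

/-- The signal comes from the computation `m` whose turn it is at stage `a`. Following this one,
`ok` says that it could not signal if it never stopped by itself. -/
theorem exists_ne_zero_of_dovetail {a : Ordinal.{0}} {v : ℕ}
    (ha : (P.dovetail h).signal n ((P.dovetail h).run n a).1 = v + 1) :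
    ∃ m, v = m + 1 ∧ ∃ b, P.signal (h n m) (P.run (h n m) b).1 ≠ 0 := by
  obtain ⟨l, j, rfl⟩ := exists_eq_omega0_mul_add a
  obtain ⟨m, hm⟩ : ∃ m, m = ((P.dovetail h).run n (ω * l + j)).1.1.unpair.1 := ⟨_, rfl⟩
  obtain ⟨s, hs⟩ := exists_follows_dovetail P h n m l
  have hok := hs.ok_of_le j (fun _ _ => trivial) (hs.1.id_le j)
  have hv : (if P.signal (h n m) (((P.dovetail h).run n (ω * l + j)).1.2.getD m P.start) = 0 then 0
    else m + 2) = v + 1 := by rw [hm]; exact ha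
  split_ifs at hv with h0
  refine ⟨m, by omega, ?_⟩
  by_contra! hno
  exact h0 (hok hno)

end RAM
-- Writing the argument with few states
namespace Frag

/-- Write `m + 1` ones on the first tape, and a mark on the third one at the left end. -/
def writeOnes : ℕ → Frag Unit
  | 0 => act fun s => ((), ![true, s 1, true], true)
  | m + 1 => (writeOnes m).bind fun _ => act fun s => ((), ![true, s 1, s 2], true)

/-- Return to the mark on the third tape and remove it. -/
def home : Frag Unit :=
  loop (act fun s => if s 2 then (some (), ![s 0, s 1, false], false) else (none, s, false))

/-- Write `m + 1` on the first tape, with `m + 2` states. -/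
def writer (m : ℕ) : Frag Unit := (writeOnes m).bind fun _ => home

/-- The slope `1` of this count is decisive: it is smaller than the factor `2` in the arguments `2 *
n` and `2 * n + 1` at which `f` is evaluated. -/
theorem card_writer (m : ℕ) : Fintype.card (writer m).Q = m + 2 := by
  have h1 : ∀ m, Fintype.card (writeOnes m).Q = m + 1 := by
    intro m
    induction m with
    | zero => exact Fintype.card_unit
    | succ m ih =>
      rw [writeOnes, card_bind_unit, ih]
      exact congrArg (m + 1 + ·) Fintype.card_unit
  rw [writer, card_bind_unit, h1]
  exact congrArg (m + 1 + ·) Fintype.card_unit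

/-- The tapes during the computation of `writer`. -/
def markedTapes (m : ℕ) : Tapes := ![code m, fun _ => false, fun c => decide (c = 0)]

theorem run_writeOnes (m : ℕ) : (writeOnes m).Run (fun _ => True) 0 (inputTapes 0) () (m + 1)
    (markedTapes (m + 1)) := by
  induction m with
  | zero =>
    refine run_act_of ![true, inputTapes 0 1 0, true] true rfl ?_ rfl trivial trivial
    funext i c
    fin_cases i <;> by_cases h : c = 0 <;>
      simp [markedTapes, setCol, inputTapes, code, h]
  | succ m ih =>
    refine ih.bind (run_act_of ![true, markedTapes (m + 1) 1 (m + 1), markedTapes (m + 1) 2 (m + 1)]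
      true rfl ?_ rfl trivial trivial)
    funext i c
    fin_cases i
    · by_cases h : c = m + 1
      · simp [markedTapes, setCol, code, h]
      · simp [markedTapes, setCol, code, h]
        omega
    · by_cases h : c = m + 1 <;> simp [markedTapes, setCol, h]
    · by_cases h : c = m + 1 <;> simp [markedTapes, setCol, h]

theorem run_home (m h : ℕ) :
    home.Run (fun _ => True) h (markedTapes m) () 0 (inputTapes m) := by
  induction h with
  | zero =>
    refine Run.loop_exit (run_act_of ![markedTapes m 0 0, markedTapes m 1 0, false] false
      (by simp [col, markedTapes]) ?_ rfl trivial trivial)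
    funext i c
    fin_cases i <;> by_cases h : c = 0 <;>
      simp [markedTapes, setCol, inputTapes, h]
  | succ h ih =>
    exact Run.loop_step (run_act_of (col (markedTapes m) (h + 1)) false
      (by simp [col, markedTapes]) (setCol_col _ _).symm rfl trivial trivial) ih

theorem run_writer (m : ℕ) :
    (writer m).Run (fun _ => True) 0 (inputTapes 0) () 0 (inputTapes (m + 1)) :=
  (run_writeOnes m).bind (run_home _ _)

end Frag

/-! ### Domination by the busy beaver function -/

theorem mem_scores_of_outputs {k n y : ℕ} {M : ITTM k} (hk : k ≤ n)
    (hy : M.Outputs (code 0) (code y)) : y ∈ scores n := by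
  obtain ⟨f, hf⟩ := M.exists_computes
  have h : y ∈ star f 0 := mem_star.2 ((hf _ _).2 hy)
  exact ⟨f, ⟨⟨k, M, hf⟩, Part.dom_iff_mem.2 ⟨y, h⟩, k, hk, M, hf⟩, h⟩

theorem le_sigmaInf_of_outputs {k n y : ℕ} {M : ITTM k} (hk : k ≤ n)
    (hy : M.Outputs (code 0) (code y)) : y ≤ sigmaInf n :=
  le_csSup (scores_finite n).bddAbove (mem_scores_of_outputs hk hy)

/-- The code of the ball with centre `i` and radius `1`. -/
def ball (i : ℕ) : ℕ := Nat.pair i (Nat.pair 1 0)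

theorem mem_nbhd_ball (i k : ℕ) : k ∈ nbhd (ball i) ↔ k = i := by
  by_cases h : k = i <;> simp [nbhd, ball, h]

/-- A process that searches for the value at `d n` of a function whose neighbourhood diagram is
semi-decidable. -/
theorem exists_search {f : ℕ → ℕ} (hf : RecursiveFor sD f) {d : ℕ → ℕ} (hd : Primrec d) :
    ∃ (A : Type) (_ : Primcodable A) (R : RAM A), R.IsPrimrec ∧ ∀ n,
      (∃ a, R.signal n (R.run n a).1 ≠ 0) ∧
      ∀ a, R.signal n (R.run n a).1 ≠ 0 → R.signal n (R.run n a).1 = f (d n) + 2 := by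
  obtain ⟨g, ⟨k, M, hM⟩, hg⟩ := hf
  have hh : Primrec₂ fun n j => Nat.pair (d n) (ball j) :=
    Primrec₂.natPair.comp (hd.comp Primrec.fst)
      (Primrec₂.natPair.comp Primrec.snd (Primrec.const (Nat.pair 1 0)))
  have key : ∀ n j, (∃ a, (Emulate.proc M).signal (Nat.pair (d n) (ball j))
      ((Emulate.proc M).run (Nat.pair (d n) (ball j)) a).1 ≠ 0) ↔ f (d n) = j := by
    intro n j
    rw [Emulate.stops_iff, ← mem_nbhd_ball]
    have : (∃ y, M.Outputs (code (Nat.pair (d n) (ball j))) y) ↔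
        (g (code (Nat.pair (d n) (ball j)))).Dom := by
      rw [Part.dom_iff_mem]
      exact exists_congr fun y => (hM _ _).symm
    rw [this, hg]
    constructor
    · rintro ⟨n', s, h1, h2⟩
      obtain ⟨h3, h4⟩ := Nat.pair_eq_pair.1 h1
      rwa [h3, h4]
    · exact fun h => ⟨_, _, rfl, h⟩
  -- Computation `j` tests whether `f (d n)` lies in the ball of radius `1` about `j`, which is
  -- `{j}`. So exactly one computation stops, and its index is the value.
  refine ⟨_, _, _, (Emulate.isPrimrec_proc M).dovetail hh, fun n => ⟨?_, fun a ha => ?_⟩⟩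
  · obtain ⟨a, ha⟩ := (key n (f (d n))).2 rfl
    exact RAM.dovetail_stops ha
  · obtain ⟨v, hv⟩ := Nat.exists_eq_succ_of_ne_zero ha
    obtain ⟨j, rfl, hj⟩ := RAM.exists_ne_zero_of_dovetail hv
    rw [hv, (key n j).1 hj]

/-- The search machine is fixed before `m`, so `N` is a constant and only the writer of `m + 1`
grows with `m`. -/
theorem lt_sigmaInf_of_recursiveFor {f : ℕ → ℕ} (hf : RecursiveFor sD f) {d : ℕ → ℕ}
    (hd : Primrec d) : ∃ N, ∀ m n, m + N ≤ n → f (d (m + 1)) < sigmaInf n := by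
  obtain ⟨A, _, R, hR, hsig⟩ := exists_search hf hd
  obtain ⟨N, hN⟩ := hR.exists_machine
  refine ⟨N + 2, fun m n hmn => ?_⟩
  obtain ⟨k, hk, M, hM⟩ := hN (Frag.writer m)
  rw [Frag.card_writer] at hk
  have hr : Realizes M (code 0) R (m + 1) := hM _ _ (Frag.run_writer m)
  obtain ⟨a, ha, hmin⟩ := WellFounded.has_min Ordinal.lt_wf
    {a | R.signal (m + 1) (R.run (m + 1) a).1 ≠ 0} (hsig (m + 1)).1
  obtain ⟨y, hy, ho⟩ := hr.large a _ ((hsig (m + 1)).2 a ha) fun b hb => by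
    by_contra h
    exact hmin b h hb
  exact hy.trans_le (le_sigmaInf_of_outputs (by omega) ho)

theorem eventuallyDominates_of_recursiveFor_sD {f : ℕ → ℕ} (hf : RecursiveFor sD f) :
    EventuallyDominates sigmaInf f := by
  have hdouble : Primrec fun n : ℕ => 2 * n := Primrec.nat_mul.comp (Primrec.const 2) Primrec.id
  obtain ⟨N₀, h₀⟩ := lt_sigmaInf_of_recursiveFor hf hdouble
  obtain ⟨N₁, h₁⟩ := lt_sigmaInf_of_recursiveFor hf (Primrec.succ.comp hdouble)
  -- For `n = 2 * (i + 1)` or `n = 2 * (i + 1) + 1` at least this large, `i` is at least `N₀ + N₁`,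
  -- whence `i + N₀` and `i + N₁` are at most `n`.
  refine ⟨2 * (N₀ + N₁) + 2, fun n hn => ?_⟩
  rcases Nat.even_or_odd' n with ⟨m, rfl | rfl⟩
  · obtain ⟨i, rfl⟩ := Nat.exists_eq_add_of_le' (show 1 ≤ m by omega)
    exact h₀ i _ (by omega)
  · obtain ⟨i, rfl⟩ := Nat.exists_eq_add_of_le' (show 1 ≤ m by omega)
    exact h₁ i _ (by omega)

end ITBB

theorem corollary2 :
    (∀ f : ℕ → ℕ, ITBB.RecursiveFor ITBB.sD f → ITBB.EventuallyDominates ITBB.sigmaInf f) ∧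
    ITBB.Pi11 ⊆ ITBB.sD ∧
    (∀ f : ℕ → ℕ, ITBB.RecursiveFor ITBB.Pi11 f →
      ITBB.EventuallyDominates ITBB.sigmaInf f) :=
  ⟨fun _ hf => ITBB.eventuallyDominates_of_recursiveFor_sD hf, ITBB.pi11_subset_sD,
    fun _ hf => ITBB.eventuallyDominates_of_recursiveFor_sD (ITBB.pi11_subset_sD hf)⟩
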